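/- Let $M$ and $N$ be compact complex manifolds of pure dimension (Hausdorff, not necessarily connected). A compact complex manifold $X$ of pure dimension $n$ is called strongly Gauduchon if it carries a smooth Hermitian metric whose fundamental form, a real strictly positive $(1,1)$-form $\omega$, satisfies $$\partial(\omega^{n-1})=\overline{\partial}\alpha$$ for some smooth complex-valued $(2n-2)$-form $\alpha$ on $X$; for $n=0$ the condition on $\omega^{n-1}$ is void. (1) Let $f\colon M\to N$ be a holomorphic submersion whose image meets every connected component of $N$ (for instance, $f$ surjective, or $M$ nonempty and $N$ connected). If $M$ is strongly Gauduchon, then so is $N$. (2) If $M$ and $N$ are nonempty, then $M\times N$ is strongly Gauduchon if and only if both $M$ and $N$ are strongly Gauduchon. -/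

import Mathlib

open scoped Manifold ContDiff Topology

noncomputable section

namespace StronglyGauduchon

section Linear

variable {V : Type*} [AddCommGroup V] [Module ℝ V] [TopologicalSpace V]

/-- The exterior product of complex-valued real-multilinear alternating forms, normalised so that
`(a ∧ b) (v₁, v₂) = a v₁ * b v₂ - a v₂ * b v₁` for one-forms. -/
def wedge {p q : ℕ} (a : V [⋀^Fin p]→L[ℝ] ℂ) (b : V [⋀^Fin q]→L[ℝ] ℂ) :
    V [⋀^Fin (p + q)]→L[ℝ] ℂ :=
  { ((LinearMap.mul' ℝ ℂ).compAlternatingMap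
      (a.toAlternatingMap.domCoprod b.toAlternatingMap)).domDomCongr finSumFinEquiv with
    cont := by
      have h : ∀ v : Fin p ⊕ Fin q → V,
          LinearMap.mul' ℝ ℂ (a.toAlternatingMap.domCoprod b.toAlternatingMap v) =
            ∑ σ : Equiv.Perm.ModSumCongr (Fin p) (Fin q),
              LinearMap.mul' ℝ ℂ
                (AlternatingMap.domCoprod.summand a.toAlternatingMap b.toAlternatingMap σ v) := by
        intro v
        rw [AlternatingMap.domCoprod_apply, _root_.sum_apply, map_sum]
      change Continuous fun v : Fin (p + q) → V ↦
        LinearMap.mul' ℝ ℂ (a.toAlternatingMap.domCoprod b.toAlternatingMap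
          (fun i ↦ v (finSumFinEquiv i)))
      simp only [h]
      refine continuous_finsetSum _ fun σ _ ↦ ?_
      induction σ using Quotient.inductionOn' with
      | h σ =>
        simp only [AlternatingMap.domCoprod.summand_mk'', _root_.smul_apply,
          MultilinearMap.domDomCongr_apply, MultilinearMap.domCoprod_apply, map_zsmul_unit,
          LinearMap.mul'_apply]
        refine Continuous.const_smul (Continuous.mul ?_ ?_) _
        · exact a.cont.comp (by fun_prop)
        · exact b.cont.comp (by fun_prop) }

/-- The exterior power `w ∧ ⋯ ∧ w` (`k` factors) of a two-form; the zeroth power is `1`. -/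
def wedgePow (w : V [⋀^Fin 2]→L[ℝ] ℂ) : (k : ℕ) → V [⋀^Fin (2 * k)]→L[ℝ] ℂ
  | 0 => ContinuousAlternatingMap.constOfIsEmpty ℝ V (Fin 0) 1
  | k + 1 => wedge (wedgePow w k) w

end Linear

section Flat

variable {E : Type*} [NormedAddCommGroup E] [NormedSpace ℂ E]

/-- Multiplication by the imaginary unit, as a real-linear map. -/
def mulI (E : Type*) [NormedAddCommGroup E] [NormedSpace ℂ E] : E →L[ℝ] E :=
  (Complex.I • ContinuousLinearMap.id ℂ E).restrictScalars ℝ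

/-- The complex-linear part `v ↦ (L v - i L (i v)) / 2` of a real-linear map. -/
def linearPart {G : Type*} [NormedAddCommGroup G] [NormedSpace ℝ G] [NormedSpace ℂ G]
    [SMulCommClass ℝ ℂ G] (L : E →L[ℝ] G) : E →L[ℝ] G :=
  (1 / 2 : ℂ) • (L - Complex.I • L.comp (mulI E))

/-- The conjugate-linear part `v ↦ (L v + i L (i v)) / 2` of a real-linear map. -/
def antilinearPart {G : Type*} [NormedAddCommGroup G] [NormedSpace ℝ G] [NormedSpace ℂ G]
    [SMulCommClass ℝ ℂ G] (L : E →L[ℝ] G) : E →L[ℝ] G :=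
  (1 / 2 : ℂ) • (L + Complex.I • L.comp (mulI E))

/-- The operator `∂` on complex-valued forms on a complex normed space: the exterior derivative
formed with the complex-linear part of the derivative of the coefficients,
`∂ (∑ f_A e_A) = ∑ ∂f_A ∧ e_A` for constant forms `e_A`. -/
def flatDel {k : ℕ} (a : E → E [⋀^Fin k]→L[ℝ] ℂ) (y : E) : E [⋀^Fin (k + 1)]→L[ℝ] ℂ :=
  .alternatizeUncurryFin (linearPart (fderiv ℝ a y))

/-- The operator `∂̄` on complex-valued forms on a complex normed space. The sum of `flatDel` and
`flatDelBar` is `extDeriv`. -/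
def flatDelBar {k : ℕ} (a : E → E [⋀^Fin k]→L[ℝ] ℂ) (y : E) : E [⋀^Fin (k + 1)]→L[ℝ] ℂ :=
  .alternatizeUncurryFin (antilinearPart (fderiv ℝ a y))

end Flat

section Manifold

variable {E : Type*} [NormedAddCommGroup E] [NormedSpace ℂ E] {H : Type*} [TopologicalSpace H]
  (I : ModelWithCorners ℂ E H) (M : Type*) [TopologicalSpace M] [ChartedSpace H M]

/-- Complex-valued differential `k`-forms (not necessarily smooth) on a complex manifold. -/
abbrev CForm (k : ℕ) : Type _ := (x : M) → TangentSpace I x [⋀^Fin k]→L[ℝ] ℂ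

variable {M}

/-- The coordinate expression of a form in the preferred chart at `x₀`, that is, its pullback
under the inverse of this chart. It is meaningful on the target of the chart. -/
def CForm.inChart {k : ℕ} (a : CForm I M k) (x₀ : M) (y : E) : E [⋀^Fin k]→L[ℝ] ℂ :=
  (a ((extChartAt I x₀).symm y)).compContinuousLinearMap
    ((mfderiv 𝓘(ℂ, E) I (extChartAt I x₀).symm y).restrictScalars ℝ)

/-- A form on a manifold (without boundary) is smooth if all its coordinate expressions are. -/
def CForm.IsSmooth {k : ℕ} (a : CForm I M k) : Prop :=
  ∀ x₀ : M, ContDiffOn ℝ ∞ (a.inChart I x₀) (extChartAt I x₀).target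

/-- The operator `∂` on forms, computed at `x` in the preferred chart at `x`. -/
def CForm.del {k : ℕ} (a : CForm I M k) : CForm I M (k + 1) := fun x ↦
  (flatDel (a.inChart I x) (extChartAt I x x)).compContinuousLinearMap
    ((mfderiv I 𝓘(ℂ, E) (extChartAt I x) x).restrictScalars ℝ)

/-- The operator `∂̄` on forms, computed at `x` in the preferred chart at `x`. -/
def CForm.delBar {k : ℕ} (a : CForm I M k) : CForm I M (k + 1) := fun x ↦
  (flatDelBar (a.inChart I x) (extChartAt I x x)).compContinuousLinearMap
    ((mfderiv I 𝓘(ℂ, E) (extChartAt I x) x).restrictScalars ℝ)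

/-- A form is `∂̄`-exact if it is `∂̄ a` for a smooth form `a`. -/
def CForm.IsDelBarExact {k : ℕ} (b : CForm I M (k + 1)) : Prop :=
  ∃ a : CForm I M k, a.IsSmooth I ∧ b = a.delBar I

/-- A Hermitian metric, given by its fundamental form: a smooth real form of type `(1, 1)`
which is strictly positive, `w (v, i v) > 0` for all nonzero tangent vectors `v`. -/
structure IsHermitianMetric (w : CForm I M 2) : Prop where
  smooth : w.IsSmooth I
  real : ∀ (x : M) (u v : TangentSpace I x), (w x ![u, v]).im = 0
  type_one_one : ∀ (x : M) (u v : TangentSpace I x),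
    w x ![Complex.I • u, Complex.I • v] = w x ![u, v]
  pos : ∀ (x : M) (v : TangentSpace I x), v ≠ 0 → 0 < (w x ![v, Complex.I • v]).re

/-- A strongly Gauduchon metric on a complex manifold of pure dimension `n`: a Hermitian metric
`w` such that `∂ (w ^ (n - 1))` is `∂̄`-exact. For `n = 0`, where the exponent is truncated to `0`,
this is no condition on `w`. -/
def IsStronglyGauduchonMetric (w : CForm I M 2) : Prop :=
  IsHermitianMetric I w ∧
    CForm.IsDelBarExact I
      (CForm.del I (fun x ↦ wedgePow (w x) (Module.finrank ℂ E - 1) :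
        CForm I M (2 * (Module.finrank ℂ E - 1))))

variable (M)

/-- The complex manifold `M` carries a strongly Gauduchon metric. If `M` is compact,
this says that `M` is a strongly Gauduchon manifold. -/
def IsStronglyGauduchon : Prop :=
  ∃ w : CForm I M 2, IsStronglyGauduchonMetric I w

end Manifold

end StronglyGauduchon

end

open scoped Manifold ContDiff Topology

noncomputable section

namespace StronglyGauduchon

/-! ### Exterior products with a two-form as signed sums -/

section FactorialFormula

variable {V : Type*} [AddCommGroup V] [Module ℝ V] [TopologicalSpace V]

/-! Part (1). Let d be the fibre dimension of the submersion and n = dim N. Integration along the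
fibres lowers the degree of a form by 2d and commutes with both ∂ and ∂̄ (`exists_pushforward`).
From a metric ω on M with ∂(ω^(d+n-1)) = ∂̄α one obtains Ω = f_*(ω^(d+n-1)), and ∂Ω = f_*(∂̄α) =
∂̄(f_*α). The form Ω is real, invariant under multiplication by i, and strictly positive on complex
subspaces of dimension n - 1 (`IsCopositive`), because its value there is an integral of values of
ω^(d+n-1) on independent complex frames. It remains to see that such an Ω is the (n-1)-st power of a
metric.

This is Michelsohn's root. In a Hermitian vector space a form of codegree two is the same as an
operator T (`coOp`), through ⟨T u, v⟩ = u♭ ∧ (i v)♭ ∧ Ω, and copositivity says that T is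
complex-linear, self-adjoint and positive. If ω has operator S, then ω^(n-1) has operator (n-1)!
det(S) S⁻¹, as one sees in an eigenbasis of S. So T⁻¹ is a multiple of the operator of the root, and
the multiple is fixed by homogeneity. The root is unique, and it is smooth in Ω because inversion
and real powers of positive numbers are (`exists_root`, `exists_smooth_root`).

For n = 0 the condition is void. For n = 1 the exponent is zero and only a metric is needed;
f_*(ω^(d+1)) is one. Surjectivity of f follows from the hypothesis on components: f is open and M is
compact, so the image is open and closed.

Fibre integrals are defined in charts in which f is a projection F × G → F. They do not depend on
the chart (`FiberChart.push_eq_push`), by the change of variables formula and because a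
complex-linear map has nonnegative real determinant. A partition of unity glues them.

Part (2). The forward direction is part (1) for the two projections. Conversely let a, b be strongly
Gauduchon metrics on factors of dimensions m, n ≥ 1, with potentials α, β, and put p = m + n - 1. By
degree, (a + b)^p = C(p,n) a^(m-1) ∧ b^n + C(p,m) a^m ∧ b^(n-1). Since a^m and b^n are of top degree
on their factors, ∂ of this is ∂̄ of C(p,n) b^n ∧ α + C(p,m) a^m ∧ β (`sumPotential`). The identity
has codegree one on the product, so it suffices to test it on tuples containing a full frame of one
factor (`eq_zero_of_append`, `IsBiproduct.flatD_eq_flatD`). If a factor has dimension zero, the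
projection to the other is a local biholomorphism and the metric is pulled back.

Throughout, ∂ and ∂̄ are treated together as one operator with a parameter c = ∓i (`flatD`, `dc`).
-/

lemma wedge_apply_factorial {p q : ℕ} (a : V [⋀^Fin p]→L[ℝ] ℂ) (b : V [⋀^Fin q]→L[ℝ] ℂ)
    (v : Fin (p + q) → V) :
    ((p.factorial * q.factorial : ℕ) : ℂ) * wedge a b v =
      ∑ σ : Equiv.Perm (Fin p ⊕ Fin q), (Equiv.Perm.sign σ : ℤ) •
        (a (fun i ↦ v (finSumFinEquiv (σ (.inl i)))) *
          b (fun i ↦ v (finSumFinEquiv (σ (.inr i))))) := by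
  have h := congrArg (fun f : V [⋀^Fin p ⊕ Fin q]→ₗ[ℝ] TensorProduct ℝ ℂ ℂ ↦
      LinearMap.mul' ℝ ℂ (f (fun i ↦ v (finSumFinEquiv i))))
    (MultilinearMap.domCoprod_alternization_eq a.toAlternatingMap b.toAlternatingMap)
  simp only [Fintype.card_fin, MultilinearMap.alternatization_apply, map_sum] at h
  rw [show wedge a b v = LinearMap.mul' ℝ ℂ (a.toAlternatingMap.domCoprod b.toAlternatingMap
    (fun i ↦ v (finSumFinEquiv i))) from rfl, ← nsmul_eq_mul, ← map_nsmul]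
  refine h.symm.trans (Finset.sum_congr rfl fun σ _ ↦ ?_)
  rw [Units.smul_def]
  exact map_zsmul (LinearMap.mul' ℝ ℂ) (Equiv.Perm.sign σ : ℤ)
    (TensorProduct.tmul ℝ (a (fun i ↦ v (finSumFinEquiv (σ (.inl i)))))
      (b (fun i ↦ v (finSumFinEquiv (σ (.inr i))))))

/-- A permutation is determined by the image `i` of `0` and by the order in which it lists the other
indices. Inserting `i` costs the sign `(-1) ^ i` of `cycleRange`, so `sum_perm_fin_succ` is Laplace
expansion in the first slot. -/
lemma perm_fin_succ_bijective (k : ℕ) :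
    Function.Bijective (fun x : Fin (k + 1) × Equiv.Perm (Fin k) ↦
      x.1.cycleRange⁻¹ * Equiv.Perm.decomposeFin.symm (0, x.2)) := by
  rw [Fintype.bijective_iff_injective_and_card]
  refine ⟨?_, ?_⟩
  · rintro ⟨i, σ⟩ ⟨j, τ⟩ h
    have h0 := congrArg (fun π : Equiv.Perm (Fin (k + 1)) ↦ π 0) h
    simp [Equiv.Perm.mul_apply] at h0
    have h1 : i = j := by
      simpa using h0
    subst h1
    have := mul_left_cancel h
    simpa using this
  · simp [Fintype.card_perm, Nat.factorial_succ]

lemma sum_perm_fin_succ {X : Type*} {k : ℕ} (f : (Fin (k + 1) → X) → ℂ) (v : Fin (k + 1) → X) :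
    ∑ σ : Equiv.Perm (Fin (k + 1)), (Equiv.Perm.sign σ : ℤ) • f (fun i ↦ v (σ i)) =
      ∑ i : Fin (k + 1), (-1) ^ (i : ℕ) * ∑ τ : Equiv.Perm (Fin k),
        (Equiv.Perm.sign τ : ℤ) • f (Fin.cons (v i) (fun j ↦ i.removeNth v (τ j))) := by
  rw [← (perm_fin_succ_bijective k).sum_comp, Fintype.sum_prod_type]
  refine Finset.sum_congr rfl fun i _ ↦ ?_
  rw [Finset.mul_sum]
  refine Finset.sum_congr rfl fun τ _ ↦ ?_
  have h : (fun j ↦ v ((i.cycleRange⁻¹ * Equiv.Perm.decomposeFin.symm (0, τ)) j)) =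
      Fin.cons (v i) (fun j ↦ i.removeNth v (τ j)) := by
    ext j
    refine Fin.cases ?_ (fun j ↦ ?_) j
    · simp
    · simp [Fin.removeNth]
  rw [h]
  simp [Fin.sign_cycleRange, mul_assoc]

/-- Rotation by two carries the last two slots, those of the two-form, to the front. Being a square
it is even, so the reordering in `wedge_two_apply` costs no sign. -/
lemma finRotate_sq_castAdd (p : ℕ) (i : Fin p) :
    (finRotate (p + 2) ^ 2) (Fin.castAdd 2 i) = i.succ.succ := by
  ext
  rw [pow_two, Equiv.Perm.mul_apply, finRotate_apply, finRotate_apply,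
    Fin.val_add_one_of_lt, Fin.val_add_one_of_lt]
  · simp
  · simp [Fin.lt_def]
  · rw [Fin.lt_def, Fin.val_add_one_of_lt]
    · simp
    · simp [Fin.lt_def]

lemma finRotate_sq_natAdd (p : ℕ) (i : Fin 2) :
    (finRotate (p + 2) ^ 2) (Fin.natAdd p i) = ![0, 1] i := by
  rw [pow_two, Equiv.Perm.mul_apply, finRotate_apply, finRotate_apply]
  fin_cases i
  · ext
    simp [Fin.val_add]
  · ext
    simp [Fin.val_add]

/-- Two Laplace expansions choose the arguments of `w`. The remaining permutations act on `a` alone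
and contribute `p!`, which cancels; the factor `1 / 2` is the surviving `1 / 2!`. -/
lemma wedge_two_apply {p : ℕ} (a : V [⋀^Fin p]→L[ℝ] ℂ) (w : V [⋀^Fin 2]→L[ℝ] ℂ)
    (v : Fin (p + 2) → V) :
    wedge a w v = 1 / 2 * ∑ i : Fin (p + 2), (-1) ^ (i : ℕ) * ∑ j : Fin (p + 1), (-1) ^ (j : ℕ) *
      (w ![v i, i.removeNth v j] * a (j.removeNth (i.removeNth v))) := by
  set f : (Fin (p + 2) → V) → ℂ := fun u ↦ a (fun i ↦ u i.succ.succ) * w ![u 0, u 1] with hf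
  have hsum : ((p.factorial * Nat.factorial 2 : ℕ) : ℂ) * wedge a w v =
      ∑ σ : Equiv.Perm (Fin (p + 2)), (Equiv.Perm.sign σ : ℤ) • f (fun i ↦ v (σ i)) := by
    rw [wedge_apply_factorial]
    refine Fintype.sum_equiv ((finSumFinEquiv.permCongr).trans
      (Equiv.mulRight ((finRotate (p + 2) ^ 2)⁻¹))) _ _ fun σ ↦ ?_
    have h1 : ∀ i : Fin p, (finRotate (p + 2) ^ 2)⁻¹ i.succ.succ = Fin.castAdd 2 i := fun i ↦ by
      rw [← finRotate_sq_castAdd]; exact Equiv.symm_apply_apply _ _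
    have h2 : ∀ i : Fin 2, (finRotate (p + 2) ^ 2)⁻¹ (![0, 1] i) = Fin.natAdd p i := fun i ↦ by
      rw [← finRotate_sq_natAdd]; exact Equiv.symm_apply_apply _ _
    have h3 : Equiv.Perm.sign ((finSumFinEquiv.permCongr σ) * (finRotate (p + 2) ^ 2)⁻¹) =
        Equiv.Perm.sign σ := by
      rw [Equiv.Perm.sign_mul, Equiv.Perm.sign_permCongr, Equiv.Perm.sign_inv, map_pow,
        Int.units_sq, mul_one]
    simp only [Equiv.trans_apply, Equiv.coe_mulRight, h3, hf, Equiv.Perm.mul_apply, h1]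
    congr 2
    · simp [Equiv.permCongr_apply]
    · congr 1
      ext i
      have := h2 i
      fin_cases i
      · simp at this
        simp [this, Equiv.permCongr_apply]
      · simp at this
        simp [this, Equiv.permCongr_apply]
  have hp : ((p.factorial : ℕ) : ℂ) ≠ 0 := by exact_mod_cast p.factorial_ne_zero
  have key : ∀ u : Fin p → V, ∑ τ : Equiv.Perm (Fin p), (Equiv.Perm.sign τ : ℤ) •
      a (fun j ↦ u (τ j)) = p.factorial * a u := by
    intro u
    have : ∀ τ : Equiv.Perm (Fin p), (Equiv.Perm.sign τ : ℤ) • a (fun j ↦ u (τ j)) = a u := by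
      intro τ
      have := a.map_perm u τ
      change a (fun j ↦ u (τ j)) = _ at this
      rw [this, Units.smul_def, smul_smul]
      simp [← Units.val_mul, Int.units_mul_self]
    simp [this, Fintype.card_perm]
  have h2 : ((p.factorial * Nat.factorial 2 : ℕ) : ℂ) * wedge a w v = p.factorial *
      ∑ i : Fin (p + 2), (-1) ^ (i : ℕ) * ∑ j : Fin (p + 1), (-1) ^ (j : ℕ) *
        (w ![v i, i.removeNth v j] * a (j.removeNth (i.removeNth v))) := by
    rw [hsum, sum_perm_fin_succ, Finset.mul_sum]
    refine Finset.sum_congr rfl fun i _ ↦ ?_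
    rw [sum_perm_fin_succ (fun u ↦ f (Fin.cons (v i) u)) (i.removeNth v), mul_left_comm,
      Finset.mul_sum (a := (p.factorial : ℂ))]
    congr 1
    refine Finset.sum_congr rfl fun j _ ↦ ?_
    rw [mul_left_comm, mul_left_comm (p.factorial : ℂ) (w _), ← key, Finset.mul_sum (a := w _)]
    congr 1
    refine Finset.sum_congr rfl fun τ _ ↦ ?_
    simp only [hf, Fin.cons_succ, Fin.cons_zero]
    rw [show (1 : Fin (p + 2)) = Fin.succ 0 from rfl, Fin.cons_succ, Fin.cons_zero, mul_comm (a _),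
      mul_smul_comm]
  have : (Nat.factorial 2 : ℂ) = 2 := by norm_num
  push_cast [mul_assoc] at h2
  have h4 := mul_left_cancel₀ hp h2
  rw [← h4]
  norm_num
  ring

end FactorialFormula

/-! ### Algebra of exterior products and powers of a two-form -/

section WedgeAlgebra
variable {V W : Type*} [AddCommGroup V] [Module ℝ V] [TopologicalSpace V]
  [AddCommGroup W] [Module ℝ W] [TopologicalSpace W]

lemma factorial_mul_ne_zero (p q : ℕ) : ((p.factorial * q.factorial : ℕ) : ℂ) ≠ 0 := by
  exact_mod_cast (Nat.mul_pos p.factorial_pos q.factorial_pos).ne'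

lemma wedge_compContinuousLinearMap {p q : ℕ} (a : V [⋀^Fin p]→L[ℝ] ℂ) (b : V [⋀^Fin q]→L[ℝ] ℂ)
    (L : W →L[ℝ] V) :
    wedge (a.compContinuousLinearMap L) (b.compContinuousLinearMap L) =
      (wedge a b).compContinuousLinearMap L := by
  ext v
  refine mul_left_cancel₀ (factorial_mul_ne_zero p q) ?_
  rw [wedge_apply_factorial, ContinuousAlternatingMap.compContinuousLinearMap_apply,
    wedge_apply_factorial]
  rfl

lemma wedge_add_left {p q : ℕ} (a a' : V [⋀^Fin p]→L[ℝ] ℂ) (b : V [⋀^Fin q]→L[ℝ] ℂ) :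
    wedge (a + a') b = wedge a b + wedge a' b := by
  ext v
  refine mul_left_cancel₀ (factorial_mul_ne_zero p q) ?_
  rw [ContinuousAlternatingMap.add_apply, mul_add]
  simp only [wedge_apply_factorial, ← Finset.sum_add_distrib, ← smul_add, ← add_mul,
    ContinuousAlternatingMap.add_apply]

lemma wedge_add_right {p q : ℕ} (a : V [⋀^Fin p]→L[ℝ] ℂ) (b b' : V [⋀^Fin q]→L[ℝ] ℂ) :
    wedge a (b + b') = wedge a b + wedge a b' := by
  ext v
  refine mul_left_cancel₀ (factorial_mul_ne_zero p q) ?_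
  rw [ContinuousAlternatingMap.add_apply, mul_add]
  simp only [wedge_apply_factorial, ← Finset.sum_add_distrib, ← smul_add, ← mul_add,
    ContinuousAlternatingMap.add_apply]

lemma wedge_smul_left {p q : ℕ} (c : ℝ) (a : V [⋀^Fin p]→L[ℝ] ℂ) (b : V [⋀^Fin q]→L[ℝ] ℂ) :
    wedge (c • a) b = c • wedge a b := by
  ext v
  refine mul_left_cancel₀ (factorial_mul_ne_zero p q) ?_
  rw [ContinuousAlternatingMap.smul_apply, mul_smul_comm]
  simp only [wedge_apply_factorial, Finset.smul_sum, ContinuousAlternatingMap.smul_apply,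
    smul_mul_assoc, smul_comm c]

lemma wedge_smul_right {p q : ℕ} (c : ℝ) (a : V [⋀^Fin p]→L[ℝ] ℂ) (b : V [⋀^Fin q]→L[ℝ] ℂ) :
    wedge a (c • b) = c • wedge a b := by
  ext v
  refine mul_left_cancel₀ (factorial_mul_ne_zero p q) ?_
  rw [ContinuousAlternatingMap.smul_apply, mul_smul_comm]
  simp only [wedge_apply_factorial, Finset.smul_sum, ContinuousAlternatingMap.smul_apply,
    mul_smul_comm, smul_comm c]

lemma conj_wedge_apply {p q : ℕ} (a a' : V [⋀^Fin p]→L[ℝ] ℂ) (b b' : V [⋀^Fin q]→L[ℝ] ℂ)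
    (ha : ∀ v, star (a v) = a' v) (hb : ∀ v, star (b v) = b' v) (v : Fin (p + q) → V) :
    star (wedge a b v) = wedge a' b' v := by
  refine mul_left_cancel₀ (factorial_mul_ne_zero p q) ?_
  have : ((p.factorial * q.factorial : ℕ) : ℂ) = star ((p.factorial * q.factorial : ℕ) : ℂ) := by
    simp
  rw [this, ← star_mul', ← this, wedge_apply_factorial, wedge_apply_factorial, star_sum]
  simp only [star_zsmul, star_mul', ha, hb]

lemma wedgePow_compContinuousLinearMap (w : V [⋀^Fin 2]→L[ℝ] ℂ) (L : W →L[ℝ] V) (k : ℕ) :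
    wedgePow (w.compContinuousLinearMap L) k = (wedgePow w k).compContinuousLinearMap L := by
  induction k with
  | zero => ext v; rfl
  | succ k ih => rw [wedgePow, ih, wedge_compContinuousLinearMap]; rfl

lemma conj_wedgePow_apply (w : V [⋀^Fin 2]→L[ℝ] ℂ) (hw : ∀ v, (w v).im = 0) (k : ℕ)
    (v : Fin (2 * k) → V) : star (wedgePow w k v) = wedgePow w k v := by
  induction k with
  | zero => simp [wedgePow]
  | succ k ih =>
    exact conj_wedge_apply _ _ _ _ ih (fun v ↦ Complex.conj_eq_iff_im.2 (hw v)) v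

lemma wedgePow_im (w : V [⋀^Fin 2]→L[ℝ] ℂ) (hw : ∀ v, (w v).im = 0) (k : ℕ)
    (v : Fin (2 * k) → V) : (wedgePow w k v).im = 0 :=
  Complex.conj_eq_iff_im.1 (conj_wedgePow_apply w hw k v)

lemma two_form_swap (w : V [⋀^Fin 2]→L[ℝ] ℂ) (u v : V) : w ![v, u] = - w ![u, v] := by
  have := w.map_swap ![u, v] (i := 0) (j := 1) (by simp)
  change w (![u, v] ∘ ⇑(Equiv.swap 0 1)) = - w ![u, v] at this
  rw [← this]
  congr 1
  ext i
  fin_cases i <;> simp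

lemma two_form_self (w : V [⋀^Fin 2]→L[ℝ] ℂ) (u : V) : w ![u, u] = 0 :=
  w.map_eq_zero_of_eq _ (i := 0) (j := 1) (by simp) (by simp)

lemma removeNth_succ_cons {X : Type*} {n : ℕ} (i : Fin (n + 1)) (x : X) (r : Fin (n + 1) → X) :
    i.succ.removeNth (Fin.cons x r : Fin (n + 2) → X) = Fin.cons x (i.removeNth r) := by
  ext j
  refine Fin.cases ?_ (fun j ↦ ?_) j
  · simp [Fin.removeNth]
  · simp [Fin.removeNth]

lemma removeNth_zero_cons {X : Type*} {n : ℕ} (x : X) (r : Fin n → X) :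
    (0 : Fin (n + 1)).removeNth (Fin.cons x r : Fin (n + 1) → X) = r := by
  ext j
  simp [Fin.removeNth]

/-- Contraction with `e` is an antiderivation, so every term has a factor `w ![e, r i]`. In the
expansion `e` is either an argument of the last factor `w`, or of the lower power, where induction
applies. -/
lemma wedgePow_succ_cons_eq_zero (w : V [⋀^Fin 2]→L[ℝ] ℂ) (e : V) (k : ℕ)
    (r : Fin (2 * k + 1) → V) (h : ∀ i, w ![e, r i] = 0) :
    wedgePow w (k + 1) (Fin.cons e r : Fin (2 * k + 1 + 1) → V) = 0 := by
  have h' : ∀ i, w ![r i, e] = 0 := fun i ↦ by rw [two_form_swap, h, neg_zero]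
  induction k with
  | zero =>
    change wedge (wedgePow w 0) w (Fin.cons e r : Fin (2 * 0 + 1 + 1) → V) = 0
    rw [wedge_two_apply]
    simp only [Fin.sum_univ_succ, Fin.cons_zero, Fin.cons_succ, removeNth_zero_cons, h,
      removeNth_succ_cons, h']
    simp
  | succ k ih =>
    change wedge (wedgePow w (k + 1)) w (Fin.cons e r : Fin (2 * (k + 1) + 1 + 1) → V) = 0
    rw [wedge_two_apply, Fin.sum_univ_succ]
    simp only [Fin.cons_zero, removeNth_zero_cons, h, Fin.cons_succ, removeNth_succ_cons]
    have : ∀ (x : Fin (2 * (k + 1) + 1)) (j : Fin (2 * (k + 1))), wedgePow w (k + 1)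
      (j.succ.removeNth (Fin.cons e (x.removeNth r) : Fin (2 * (k + 1) + 1) → V)) = 0 := by
      intro x j
      have := removeNth_succ_cons (n := 2 * k + 1) j e (x.removeNth r)
      rw [this]
      exact ih _ (fun i ↦ h _) (fun i ↦ h' _)
    have h2 : ∀ x : Fin (2 * (k + 1) + 1), ∑ j : Fin (2 * (k + 1) + 1), (-1) ^ (j : ℕ) *
        (w ![r x, (Fin.cons e (x.removeNth r) : Fin (2 * (k + 1) + 1) → V) j] *
          wedgePow w (k + 1)
            (j.removeNth (Fin.cons e (x.removeNth r) : Fin (2 * (k + 1) + 1) → V))) = 0 := by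
      intro x
      rw [Fin.sum_univ_succ]
      simp [this, h']
    simp [h2]

/-- By orthogonality `e` and `e'` must both enter `w`, in two orders that absorb the factor `1 / 2`,
or both enter `a`. The hypothesis on `a` concerns only tuples drawn from `r`, so that in the
induction below these inherit orthogonality to `e` and `e'`. -/
lemma wedge_two_cons_cons {q : ℕ} (a : V [⋀^Fin (q + 2)]→L[ℝ] ℂ) (b : V [⋀^Fin q]→L[ℝ] ℂ)
    (w : V [⋀^Fin 2]→L[ℝ] ℂ) (e e' : V) (c : ℂ) (r : Fin (q + 2) → V)
    (h : ∀ i, w ![e, r i] = 0) (h' : ∀ i, w ![e', r i] = 0)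
    (hab : ∀ s : Fin q → V, (∀ i, ∃ j, s i = r j) →
      a (Fin.cons e (Fin.cons e' s) : Fin (q + 1 + 1) → V) = c * b s) :
    wedge a w (Fin.cons e (Fin.cons e' r) : Fin (q + 2 + 1 + 1) → V) =
      w ![e, e'] * a r + c * wedge b w r := by
  have g : ∀ i, w ![r i, e] = 0 := fun i ↦ by rw [two_form_swap, h, neg_zero]
  have g' : ∀ i, w ![r i, e'] = 0 := fun i ↦ by rw [two_form_swap, h', neg_zero]
  have h0 : ∀ f : Fin (q + 4) → ℂ, ∑ i, f i = f 0 + (f (Fin.succ 0) +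
      ∑ i : Fin (q + 2), f i.succ.succ) := fun f ↦ by
    rw [Fin.sum_univ_succ, Fin.sum_univ_succ]
  rw [wedge_two_apply, wedge_two_apply, h0]
  simp only [Fin.cons_zero, removeNth_zero_cons, Fin.cons_succ, removeNth_succ_cons]
  have h1 : ∀ f : Fin (q + 3) → ℂ, (∀ j : Fin (q + 2), f j.succ = 0) → ∑ j, f j = f 0 := fun f hf ↦ by
    rw [Fin.sum_univ_succ]; simp [hf]
  have h2 : ∀ f : Fin (q + 3) → ℂ, f 0 = 0 → f (Fin.succ 0) = 0 → ∑ j, f j = ∑ j : Fin (q + 1),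
    f j.succ.succ := fun f hf hf' ↦ by
    rw [Fin.sum_univ_succ, Fin.sum_univ_succ]
    rw [hf, hf', zero_add, zero_add]
  rw [h1 _ (by simp [h]), h1 _ (by simp [h'])]
  have h3 : ∀ i : Fin (q + 2), ∑ j : Fin (q + 3), (-1) ^ (j : ℕ) *
      (w ![r i, (Fin.cons e (Fin.cons e' (i.removeNth r) : Fin (q + 2) → V) : Fin (q + 3) → V) j] *
        a (j.removeNth (Fin.cons e (Fin.cons e' (i.removeNth r) : Fin (q + 2) → V) :
          Fin (q + 3) → V))) = ∑ j : Fin (q + 1), (-1) ^ (j : ℕ) *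
            (w ![r i, i.removeNth r j] * (c * b (j.removeNth (i.removeNth r)))) := by
    intro i
    rw [h2 _ (by simp [g]) (by
      rw [Fin.cons_succ, Fin.cons_zero, g', zero_mul, mul_zero])]
    refine Finset.sum_congr rfl fun j _ ↦ ?_
    rw [Fin.cons_succ, Fin.cons_succ, removeNth_succ_cons, removeNth_succ_cons,
      hab (j.removeNth (i.removeNth r)) (fun i ↦ ⟨_, rfl⟩)]
    simp [pow_succ]
  simp only [h3]
  simp only [Fin.cons_zero, removeNth_zero_cons, two_form_swap w e e', Fin.val_zero, Fin.val_succ,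
    Finset.mul_sum, pow_succ, pow_zero]
  rw [mul_add, mul_add, ← add_assoc]
  congr 1
  · ring
  · rw [Finset.mul_sum]
    refine Finset.sum_congr rfl fun i _ ↦ ?_
    rw [Finset.mul_sum]
    refine Finset.sum_congr rfl fun j _ ↦ ?_
    ring

/-- Contracting `w ^ (k + 1)` with `e` gives `k + 1` times the product of the one-form `w (e, ·)`
with `w ^ k`; orthogonality leaves only its value on `e'`. All evaluations of powers on orthogonal
frames iterate this. -/
lemma wedgePow_succ_cons_cons (w : V [⋀^Fin 2]→L[ℝ] ℂ) (e e' : V) (k : ℕ)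
    (r : Fin (2 * k) → V) (h : ∀ i, w ![e, r i] = 0) (h' : ∀ i, w ![e', r i] = 0) :
    wedgePow w (k + 1) (Fin.cons e (Fin.cons e' r) : Fin (2 * k + 1 + 1) → V) =
      (k + 1) * w ![e, e'] * wedgePow w k r := by
  have g : ∀ i, w ![r i, e] = 0 := fun i ↦ by rw [two_form_swap, h, neg_zero]
  have g' : ∀ i, w ![r i, e'] = 0 := fun i ↦ by rw [two_form_swap, h', neg_zero]
  induction k with
  | zero =>
    change wedge (wedgePow w 0) w (Fin.cons e (Fin.cons e' r) : Fin (2 * 0 + 1 + 1) → V) = _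
    rw [wedge_two_apply]
    simp only [Fin.sum_univ_succ, Fin.cons_zero, Fin.cons_succ, removeNth_zero_cons,
      removeNth_succ_cons]
    simp [wedgePow, two_form_swap w e e']
    ring
  | succ k ih =>
    change wedge (wedgePow w (k + 1)) w
      (Fin.cons e (Fin.cons e' r) : Fin (2 * (k + 1) + 1 + 1) → V) = _
    rw [wedge_two_cons_cons (q := 2 * k) (wedgePow w (k + 1)) (wedgePow w k) w e e'
      ((k + 1) * w ![e, e']) r h h']
    · change _ + _ * wedgePow w (k + 1) r = _
      push_cast
      ring
    · intro s hs
      have h1 : ∀ i, w ![e, s i] = 0 := fun i ↦ by obtain ⟨j, hj⟩ := hs i; rw [hj, h]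
      have h2 : ∀ i, w ![e', s i] = 0 := fun i ↦ by obtain ⟨j, hj⟩ := hs i; rw [hj, h']
      exact ih s h1 h2 (fun i ↦ by rw [two_form_swap, h1, neg_zero])
        (fun i ↦ by rw [two_form_swap, h2, neg_zero])
end WedgeAlgebra

section Split
variable {V : Type*} [AddCommGroup V] [Module ℝ V] [TopologicalSpace V]

lemma sign_smul_comp_perm {p : ℕ} (a : V [⋀^Fin p]→L[ℝ] ℂ) (u : Fin p → V)
    (τ : Equiv.Perm (Fin p)) :
    (Equiv.Perm.sign τ : ℤ) • a (fun j ↦ u (τ j)) = a u := by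
  have := a.map_perm u τ
  change a (fun j ↦ u (τ j)) = _ at this
  rw [this, Units.smul_def, smul_smul]
  simp [← Units.val_mul, Int.units_mul_self]

/-- A permutation that mixes the two blocks feeds some `y j` to `b` and contributes nothing. The `q!
p!` block-preserving ones contribute equally. -/
lemma wedge_append {p q : ℕ} (b : V [⋀^Fin q]→L[ℝ] ℂ) (a : V [⋀^Fin p]→L[ℝ] ℂ)
    (x : Fin q → V) (y : Fin p → V) (hb : ∀ u : Fin q → V, (∃ i j, u i = y j) → b u = 0) :
    wedge b a (Fin.append x y) = b x * a y := by
  refine mul_left_cancel₀ (factorial_mul_ne_zero q p) ?_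
  rw [wedge_apply_factorial, ← Fintype.sum_of_injective _
    (Equiv.Perm.sumCongrHom_injective (α := Fin q) (β := Fin p)) (fun _ ↦ b x * a y)]
  · simp [Fintype.card_perm]
  · intro σ hσ
    have : ∃ i j, σ (.inl i) = .inr j := by
      by_contra! hcon
      refine hσ (Equiv.Perm.mem_sumCongrHom_range_of_perm_mapsTo_inl ?_)
      rintro _ ⟨i, rfl⟩
      rcases h : σ (.inl i) with j | j
      · exact ⟨j, rfl⟩
      · exact absurd h (hcon i j)
    obtain ⟨i, j, hij⟩ := this
    rw [hb _ ⟨i, j, by simp [hij]⟩]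
    simp
  · rintro ⟨σ, τ⟩
    rw [← sign_smul_comp_perm b x σ, ← sign_smul_comp_perm a y τ]
    simp [Equiv.Perm.sumCongrHom, mul_assoc, mul_left_comm]

end Split

section MultilinearAux
variable {V G : Type*} [AddCommGroup V] [Module ℝ V] [AddCommGroup G] [Module ℝ G]

/-- Expand `f (r + s)`: each term other than `f r` has some `s i` in slot `i`. -/
lemma MultilinearMap.map_add_eq_of_update_eq_zero {ι : Type*} [Fintype ι] [DecidableEq ι]
    (f : MultilinearMap ℝ (fun _ : ι ↦ V) G) (r s : ι → V)
    (h : ∀ v i, f (Function.update v i (s i)) = 0) : f (r + s) = f r := by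
  rw [MultilinearMap.map_add_univ, Finset.sum_eq_single Finset.univ]
  · simp
  · intro S _ hS
    obtain ⟨i, hi⟩ : ∃ i, i ∉ S := by
      by_contra! hcon
      exact hS (Finset.eq_univ_iff_forall.2 hcon)
    rw [← h (S.piecewise r s) i]
    congr 1
    symm
    rw [Function.update_eq_self_iff]
    simp [hi]
  · simp

end MultilinearAux

/-! ### Complex tuples as real tuples -/

section Pairs
variable {V W : Type*} [NormedAddCommGroup V] [NormedSpace ℂ V] [NormedAddCommGroup W]
  [NormedSpace ℂ W]

/-- The tuple `v₀, i v₀, v₁, i v₁, …`. -/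
def pairs : {k : ℕ} → (Fin k → V) → Fin (2 * k) → V
  | 0, _ => Fin.elim0
  | k + 1, v => (Fin.cons (v 0) (Fin.cons (Complex.I • v 0) (pairs (Fin.tail v))) :
      Fin (2 * k + 1 + 1) → V)

lemma pairs_forall {p : V → Prop} {k : ℕ} (v : Fin k → V)
    (h : ∀ j, p (v j) ∧ p (Complex.I • v j)) : ∀ i, p (pairs v i) := by
  induction k with
  | zero => exact fun i ↦ i.elim0
  | succ k ih =>
    intro i
    refine Fin.cases (n := 2 * k + 1) (motive := fun i ↦ p (pairs v i)) ?_ (fun i ↦ ?_) i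
    · exact (h 0).1
    · refine Fin.cases (n := 2 * k) (motive := fun i ↦ p (pairs v (Fin.succ i)))
        ?_ (fun i ↦ ?_) i
      · exact (h 0).2
      · exact ih (Fin.tail v) (fun j ↦ h j.succ) i

lemma pairs_add {k : ℕ} (u v : Fin k → V) : pairs (u + v) = pairs u + pairs v := by
  induction k with
  | zero => ext i; exact i.elim0
  | succ k ih =>
    ext i
    refine Fin.cases (n := 2 * k + 1) (motive := fun i ↦ pairs (u + v) i = (pairs u + pairs v) i)
      rfl (fun i ↦ ?_) i
    refine Fin.cases (n := 2 * k)
      (motive := fun i ↦ pairs (u + v) (Fin.succ i) = (pairs u + pairs v) (Fin.succ i))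
        ?_ (fun i ↦ ?_) i
    · exact smul_add _ _ _
    · exact congrFun (ih (Fin.tail u) (Fin.tail v)) i

lemma map_pairs {k : ℕ} (L : V →L[ℂ] W) (v : Fin k → V) (i : Fin (2 * k)) :
    L (pairs v i) = pairs (fun j ↦ L (v j)) i := by
  induction k with
  | zero => exact i.elim0
  | succ k ih =>
    refine Fin.cases (n := 2 * k + 1) (motive := fun i ↦ L (pairs v i) =
      pairs (fun j ↦ L (v j)) i) rfl (fun i ↦ ?_) i
    refine Fin.cases (n := 2 * k) (motive := fun i ↦ L (pairs v (Fin.succ i)) =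
      pairs (fun j ↦ L (v j)) (Fin.succ i)) ?_ (fun i ↦ ?_) i
    · exact map_smul L _ _
    · exact ih (Fin.tail v) i

/-- The real coefficients of `v j` and `i v j` make up one complex coefficient. The last clause is
what transfers independence from ℂ to ℝ. -/
lemma sum_smul_pairs {k : ℕ} (c : Fin (2 * k) → ℝ) (v : Fin k → V) :
    ∃ d : Fin k → ℂ, ∑ i, c i • pairs v i = ∑ j, d j • v j ∧ (d = 0 → c = 0) := by
  induction k with
  | zero => exact ⟨Fin.elim0, by simp, fun _ ↦ by ext i; exact i.elim0⟩
  | succ k ih =>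
    obtain ⟨d, hd, hd'⟩ := ih (fun i ↦ c (Fin.succ (n := 2 * k + 1) (Fin.succ i))) (Fin.tail v)
    refine ⟨Fin.cons (c (0 : Fin (2 * k + 1 + 1)) +
      c (Fin.succ (n := 2 * k + 1) 0) * Complex.I) d, ?_, fun h ↦ ?_⟩
    · have h1 := Fin.sum_univ_succ (n := 2 * k + 1) (fun i ↦ c i • pairs v i)
      have h2 := Fin.sum_univ_succ (n := 2 * k)
        (fun i ↦ c (Fin.succ (n := 2 * k + 1) i) • pairs v (Fin.succ (n := 2 * k + 1) i))
      refine h1.trans ?_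
      rw [h2, Fin.sum_univ_succ]
      change _ + (_ + ∑ i, c (Fin.succ (n := 2 * k + 1) (Fin.succ i)) • pairs (Fin.tail v) i) = _
      rw [hd, ← add_assoc]
      congr 1
      change c (0 : Fin (2 * k + 1 + 1)) • v 0 + c (Fin.succ (n := 2 * k + 1) 0) •
        (Complex.I • v 0) = _
      rw [Fin.cons_zero, add_smul, mul_smul, Complex.coe_smul, Complex.coe_smul]
    · have h0 := congrFun h 0
      have h1 : d = 0 := by
        ext j; simpa using congrFun h j.succ
      have h2 := hd' h1
      simp only [Fin.cons_zero, Pi.zero_apply, Complex.ext_iff] at h0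
      simp at h0
      ext i
      refine Fin.cases (n := 2 * k + 1) (motive := fun i ↦ c i = 0) h0.1 (fun i ↦ ?_) i
      refine Fin.cases (n := 2 * k) (motive := fun i ↦ c (Fin.succ (n := 2 * k + 1) i) = 0)
        h0.2 (fun i ↦ ?_) i
      exact congrFun h2 i

lemma linearIndependent_pairs {k : ℕ} {v : Fin k → V} (hv : LinearIndependent ℂ v) :
    LinearIndependent ℝ (pairs v) := by
  rw [Fintype.linearIndependent_iff] at hv ⊢
  intro c hc
  obtain ⟨d, hd, hd'⟩ := sum_smul_pairs c v
  have := hv d (hd.symm.trans hc)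
  exact congrFun (hd' (funext this))

end Pairs

/-! ### Positive forms of type (1, 1) and their powers -/

section Positive
variable {V : Type*} [NormedAddCommGroup V] [NormedSpace ℂ V]

/-- A real strictly positive form of type `(1, 1)` on a complex vector space. -/
structure IsPositiveForm (w : V [⋀^Fin 2]→L[ℝ] ℂ) : Prop where
  real : ∀ u v, (w ![u, v]).im = 0
  type_one_one : ∀ u v, w ![Complex.I • u, Complex.I • v] = w ![u, v]
  pos : ∀ v, v ≠ 0 → 0 < (w ![v, Complex.I • v]).re

/-- A two-form as a linear map of its second argument. -/
def twoFormLeft (w : V [⋀^Fin 2]→L[ℝ] ℂ) (u : V) : V →ₗ[ℝ] ℂ :=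
  w.toMultilinearMap.toLinearMap ![u, 0] 1

lemma twoFormLeft_apply (w : V [⋀^Fin 2]→L[ℝ] ℂ) (u v : V) : twoFormLeft w u v = w ![u, v] := by
  change w (Function.update ![u, 0] 1 v) = _
  congr 1
  ext i
  fin_cases i <;> simp

lemma IsPositiveForm.im_eq_zero {w : V [⋀^Fin 2]→L[ℝ] ℂ} (hw : IsPositiveForm w)
    (v : Fin 2 → V) : (w v).im = 0 := by
  convert hw.real (v 0) (v 1) using 3
  ext i
  fin_cases i <;> rfl

lemma two_form_I_right {w : V [⋀^Fin 2]→L[ℝ] ℂ} 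
    (hw : ∀ u v, w ![Complex.I • u, Complex.I • v] = w ![u, v]) (u v : V) :
    w ![u, Complex.I • v] = - w ![Complex.I • u, v] := by
  rw [← hw u, smul_smul, Complex.I_mul_I, neg_one_smul, ← twoFormLeft_apply, ← twoFormLeft_apply,
    map_neg]

/-- Once `e` and `e'` occupy two slots of an alternating form, the other arguments matter only
modulo their span. -/
lemma cons_cons_add_eq {k : ℕ} (f : V [⋀^Fin (k + 1 + 1)]→L[ℝ] ℂ) (e e' : V) (r s : Fin k → V)
    (hs : ∀ i, s i ∈ Submodule.span ℝ {e, e'}) :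
    f (Fin.cons e (Fin.cons e' (r + s) : Fin (k + 1) → V)) =
      f (Fin.cons e (Fin.cons e' r : Fin (k + 1) → V)) := by
  refine MultilinearMap.map_add_eq_of_update_eq_zero
    ((f.curryLeft e).curryLeft e').toMultilinearMap r s fun v i ↦ ?_
  have key : ∀ x : V, f (Fin.cons e (Fin.cons e' (Function.update v i x) : Fin (k + 1) → V)) =
      ((f.curryLeft e).curryLeft e').toMultilinearMap.toLinearMap v i x := fun _ ↦ rfl
  change f (Fin.cons e (Fin.cons e' (Function.update v i (s i)) : Fin (k + 1) → V)) = 0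
  rw [key, ← LinearMap.mem_ker]
  refine Submodule.span_le.2 ?_ (hs i)
  rintro x (rfl | rfl)
  · rw [SetLike.mem_coe, LinearMap.mem_ker, ← key]
    exact f.map_eq_zero_of_eq _ (i := 0) (j := i.succ.succ) (by simp)
      (Fin.succ_ne_zero _).symm
  · rw [SetLike.mem_coe, LinearMap.mem_ker, ← key]
    exact f.map_eq_zero_of_eq _ (i := Fin.succ 0) (j := i.succ.succ)
      (by rw [Fin.cons_succ, Fin.cons_succ]; simp)
      (by simp [Fin.ext_iff])

/-- One Gram–Schmidt step for the Hermitian form of `w`: replace the later vectors by their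
projections orthogonal to `e = v 0`. This changes neither the value nor independence, and the value
then splits as `(k + 1) w (e, i e)` times a value of `w ^ k`. -/
lemma wedgePow_pairs_pos {w : V [⋀^Fin 2]→L[ℝ] ℂ} (hw : IsPositiveForm w) {k : ℕ}
    {v : Fin k → V} (hv : LinearIndependent ℂ v) : 0 < (wedgePow w k (pairs v)).re := by
  induction k with
  | zero => simp [wedgePow]
  | succ k ih =>
    set e := v 0 with he
    have he0 : e ≠ 0 := hv.ne_zero 0
    have hpos := hw.pos e he0
    set h := (w ![e, Complex.I • e]).re with hh
    have hreal : w ![e, Complex.I • e] = (h : ℂ) := by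
      apply Complex.ext <;> simp [hh, hw.real]
    -- The complex coefficient solves the two real equations `w (e, u j) = 0` and `w (i e, u j) =
    -- 0`, using `w (e, i e) = h` and `w (i e, e) = -h`.
    set c : Fin k → ℂ := fun j ↦ (((w ![Complex.I • e, v j.succ]).re / h : ℝ) : ℂ) +
      ((-(w ![e, v j.succ]).re / h : ℝ) : ℂ) * Complex.I with hc
    set u : Fin k → V := Fin.tail v + fun j ↦ c j • e with hu
    have hexp : ∀ j, c j • e = ((w ![Complex.I • e, v j.succ]).re / h) • e +
        (-(w ![e, v j.succ]).re / h) • (Complex.I • e) := fun j ↦ by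
      rw [hc, add_smul, mul_smul, Complex.coe_smul, Complex.coe_smul]
    have hh0 : (h : ℂ) ≠ 0 := by exact_mod_cast hpos.ne'
    have hre : ∀ x y : V, w ![x, y] = ((w ![x, y]).re : ℂ) := fun x y ↦ by
      apply Complex.ext <;> simp [hw.real]
    have hswap : w ![Complex.I • e, e] = -(h : ℂ) := by rw [two_form_swap, hreal]
    have h1 : ∀ j, w ![e, u j] = 0 := fun j ↦ by
      rw [← twoFormLeft_apply, hu, Pi.add_apply, hexp, map_add, map_add, map_smul, map_smul]
      simp only [twoFormLeft_apply, two_form_self, hreal, Fin.tail]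
      rw [hre e (v j.succ)]
      simp only [smul_zero, zero_add, Complex.real_smul, Complex.ofReal_div, Complex.ofReal_neg,
        Complex.ofReal_re]
      field_simp
      ring
    have h2 : ∀ j, w ![Complex.I • e, u j] = 0 := fun j ↦ by
      rw [← twoFormLeft_apply, hu, Pi.add_apply, hexp, map_add, map_add, map_smul, map_smul]
      simp only [twoFormLeft_apply, two_form_self, hswap, Fin.tail]
      rw [hre (Complex.I • e) (v j.succ)]
      simp only [smul_zero, add_zero, Complex.real_smul, Complex.ofReal_div, 
        Complex.ofReal_re]
      field_simp
      ring
    have hind : LinearIndependent ℂ u := by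
      rw [Fintype.linearIndependent_iff] at hv ⊢
      intro g hg
      have := hv (Fin.cons (∑ j, g j * c j) g) (by
        rw [Fin.sum_univ_succ, Fin.cons_zero, ← hg]
        simp only [Fin.cons_succ, hu, Pi.add_apply, smul_add, Finset.sum_add_distrib, smul_smul,
          Fin.tail, ← Finset.sum_smul]
        rw [add_comm])
      intro j
      exact this j.succ
    have heq : wedgePow w (k + 1) (pairs v) = wedgePow w (k + 1)
        (Fin.cons e (Fin.cons (Complex.I • e) (pairs u)) : Fin (2 * k + 1 + 1) → V) := by
      rw [hu, pairs_add]
      refine (cons_cons_add_eq (k := 2 * k) (wedgePow w (k + 1)) e (Complex.I • e) _ _ ?_).symm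
      refine pairs_forall _ fun j ↦ ⟨?_, ?_⟩
      · rw [hexp]
        exact Submodule.add_mem _ (Submodule.smul_mem _ _ (Submodule.subset_span (by simp)))
          (Submodule.smul_mem _ _ (Submodule.subset_span (by simp)))
      · rw [hexp, smul_add, smul_comm Complex.I, smul_comm Complex.I, smul_smul Complex.I,
          Complex.I_mul_I, neg_one_smul]
        exact Submodule.add_mem _ (Submodule.smul_mem _ _ (Submodule.subset_span (by simp)))
          (Submodule.smul_mem _ _ (Submodule.neg_mem _ (Submodule.subset_span (by simp))))
    rw [heq, wedgePow_succ_cons_cons, hreal]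
    · rw [mul_assoc, ← Complex.ofReal_natCast, ← Complex.ofReal_one, ← Complex.ofReal_add,
        Complex.re_ofReal_mul, Complex.re_ofReal_mul]
      have := ih hind
      positivity
    · exact pairs_forall (p := fun x ↦ w ![e, x] = 0) u fun j ↦ ⟨h1 j, by
        rw [two_form_I_right hw.type_one_one, h2, neg_zero]⟩
    · refine pairs_forall (p := fun x ↦ w ![Complex.I • e, x] = 0) u fun j ↦ ⟨h2 j, ?_⟩
      rw [hw.type_one_one, h1]

end Positive

section FiniteDim
variable {V : Type*} [NormedAddCommGroup V] [NormedSpace ℝ V] [FiniteDimensional ℝ V]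

instance finiteDimensional_continuousAlternatingMap (k : ℕ) :
    FiniteDimensional ℝ (V [⋀^Fin k]→L[ℝ] ℂ) :=
  FiniteDimensional.of_injective
    ({ toFun := fun f ↦ f.toMultilinearMap
       map_add' := fun _ _ ↦ rfl
       map_smul' := fun _ _ ↦ rfl } :
      (V [⋀^Fin k]→L[ℝ] ℂ) →ₗ[ℝ] MultilinearMap ℝ (fun _ : Fin k ↦ V) ℂ)
    (fun f g h ↦ by ext v; exact congrArg (fun m ↦ m v) h)

/-- The exterior product as a continuous bilinear map. -/
def wedgeL (V : Type*) [NormedAddCommGroup V] [NormedSpace ℝ V] [FiniteDimensional ℝ V]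
    (p q : ℕ) : (V [⋀^Fin p]→L[ℝ] ℂ) →L[ℝ] (V [⋀^Fin q]→L[ℝ] ℂ) →L[ℝ] V [⋀^Fin (p + q)]→L[ℝ] ℂ :=
  LinearMap.toContinuousLinearMap
    { toFun := fun a ↦ LinearMap.toContinuousLinearMap
        { toFun := fun b ↦ wedge a b
          map_add' := wedge_add_right a
          map_smul' := fun c b ↦ wedge_smul_right c a b }
      map_add' := fun a a' ↦ by ext1 b; exact wedge_add_left a a' b
      map_smul' := fun c a ↦ by ext1 b; exact wedge_smul_left c a b }

lemma contDiff_wedgePow (k : ℕ) {n : WithTop ℕ∞} :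
    ContDiff ℝ n (fun w : V [⋀^Fin 2]→L[ℝ] ℂ ↦ wedgePow w k) := by
  induction k with
  | zero => exact contDiff_const
  | succ k ih =>
    exact ((wedgeL V (2 * k) 2).contDiff.comp ih).clm_apply contDiff_id

end FiniteDim

section Homogeneous
variable {V : Type*} [AddCommGroup V] [Module ℝ V] [TopologicalSpace V]

lemma wedgePow_smul (c : ℝ) (w : V [⋀^Fin 2]→L[ℝ] ℂ) (k : ℕ) :
    wedgePow (c • w) k = c ^ k • wedgePow w k := by
  induction k with
  | zero => simp [wedgePow]
  | succ k ih =>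
    rw [wedgePow, ih, wedge_smul_left, wedge_smul_right, smul_smul, ← pow_succ]
    rfl

end Homogeneous

/-! ### Exterior multiplication by real one-forms -/

section ExteriorByOneForm
variable {V : Type*} [NormedAddCommGroup V] [NormedSpace ℝ V]

/-- The exterior product `ξ ∧ a` with a real one-form. -/
def oneWedge {k : ℕ} (ξ : V →L[ℝ] ℝ) (a : V [⋀^Fin k]→L[ℝ] ℂ) : V [⋀^Fin (k + 1)]→L[ℝ] ℂ :=
  ContinuousAlternatingMap.alternatizeUncurryFinCLM ℝ V ℂ
    (ContinuousLinearMap.smulRightL ℝ V _ ξ a)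

lemma oneWedge_apply {k : ℕ} (ξ : V →L[ℝ] ℝ) (a : V [⋀^Fin k]→L[ℝ] ℂ) (v : Fin (k + 1) → V) :
    oneWedge ξ a v = ∑ i : Fin (k + 1), (-1) ^ (i : ℕ) * (ξ (v i) * a (i.removeNth v)) := by
  rw [oneWedge, ContinuousAlternatingMap.alternatizeUncurryFinCLM_apply,
    ContinuousAlternatingMap.alternatizeUncurryFin_apply]
  refine Finset.sum_congr rfl fun i _ ↦ ?_
  simp

lemma oneWedge_add_left {k : ℕ} (ξ η : V →L[ℝ] ℝ) (a : V [⋀^Fin k]→L[ℝ] ℂ) :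
    oneWedge (ξ + η) a = oneWedge ξ a + oneWedge η a := by
  simp only [oneWedge, map_add, add_apply]

lemma oneWedge_smul_left {k : ℕ} (c : ℝ) (ξ : V →L[ℝ] ℝ) (a : V [⋀^Fin k]→L[ℝ] ℂ) :
    oneWedge (c • ξ) a = c • oneWedge ξ a := by
  simp only [oneWedge, map_smul, smul_apply]

lemma oneWedge_add_right {k : ℕ} (ξ : V →L[ℝ] ℝ) (a b : V [⋀^Fin k]→L[ℝ] ℂ) :
    oneWedge ξ (a + b) = oneWedge ξ a + oneWedge ξ b := by
  simp only [oneWedge, map_add]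

lemma oneWedge_smul_right {k : ℕ} (c : ℝ) (ξ : V →L[ℝ] ℝ) (a : V [⋀^Fin k]→L[ℝ] ℂ) :
    oneWedge ξ (c • a) = c • oneWedge ξ a := by
  simp only [oneWedge, map_smul]

/-- The twofold product alternates the symmetric bilinear expression `ξ x ξ y a`, and a symmetric
expression alternates to zero. -/
lemma oneWedge_self {k : ℕ} (ξ : V →L[ℝ] ℝ) (a : V [⋀^Fin k]→L[ℝ] ℂ) :
    oneWedge ξ (oneWedge ξ a) = 0 := by
  have := ContinuousAlternatingMap.alternatizeUncurryFin_alternatizeUncurryFinCLM_comp_of_symmetric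
    (𝕜 := ℝ) (E := V) (F := ℂ) (n := k)
    (f := (ContinuousLinearMap.smulRightL ℝ V _ ξ (ContinuousLinearMap.smulRightL ℝ V _ ξ a)))
    (fun x y ↦ by
      simp [smul_smul, mul_comm])
  refine Eq.trans ?_ this
  rw [oneWedge, ContinuousAlternatingMap.alternatizeUncurryFinCLM_apply]
  congr 1
  ext x v
  simp [oneWedge]

lemma oneWedge_swap {k : ℕ} (ξ η : V →L[ℝ] ℝ) (a : V [⋀^Fin k]→L[ℝ] ℂ) :
    oneWedge ξ (oneWedge η a) = - oneWedge η (oneWedge ξ a) := by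
  have := oneWedge_self (ξ + η) a
  simp only [oneWedge_add_left, oneWedge_add_right, oneWedge_self, zero_add, add_zero] at this
  exact eq_neg_of_add_eq_zero_right this

lemma oneWedge_comp {k : ℕ} (ξ : V →L[ℝ] ℝ) (a : V [⋀^Fin k]→L[ℝ] ℂ) (L : V →L[ℝ] V) :
    oneWedge (ξ.comp L) (a.compContinuousLinearMap L) =
      (oneWedge ξ a).compContinuousLinearMap L := by
  ext v
  rw [ContinuousAlternatingMap.compContinuousLinearMap_apply, oneWedge_apply, oneWedge_apply]
  rfl

lemma oneWedge_cons {k : ℕ} (ξ : V →L[ℝ] ℝ) (a : V [⋀^Fin k]→L[ℝ] ℂ) (x : V) (r : Fin k → V)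
    (h : ∀ i, ξ (r i) = 0) :
    oneWedge ξ a (Fin.cons x r : Fin (k + 1) → V) = ξ x * a r := by
  rw [oneWedge_apply, Fin.sum_univ_succ]
  simp [h]

lemma oneWedge_cons_eq_zero {k : ℕ} (ξ : V →L[ℝ] ℝ) (a : V [⋀^Fin (k + 1)]→L[ℝ] ℂ) (x : V)
    (r : Fin (k + 1) → V) (h : ξ x = 0)
    (ha : ∀ i, a (Fin.cons x (Fin.removeNth i r) : Fin (k + 1) → V) = 0) :
    oneWedge ξ a (Fin.cons x r : Fin (k + 2) → V) = 0 := by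
  rw [oneWedge_apply, Fin.sum_univ_succ]
  simp [removeNth_succ_cons, h, ha]

/-- Below the top degree there is a vector `u` outside the span of the arguments `v`. A functional
`ξ` vanishing on `v` but not on `u` gives `(ξ ∧ a) (u, v) = ξ u * a v`. -/
lemma eq_zero_of_oneWedge_eq_zero [FiniteDimensional ℝ V] {k : ℕ} (hk : k < Module.finrank ℝ V)
    (a : V [⋀^Fin k]→L[ℝ] ℂ) (h : ∀ ξ : V →L[ℝ] ℝ, oneWedge ξ a = 0) : a = 0 := by
  ext v
  have hne : Submodule.span ℝ (Set.range v) ≠ ⊤ := by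
    intro htop
    have := finrank_range_le_card (R := ℝ) v
    rw [Set.finrank, htop, finrank_top, Fintype.card_fin] at this
    omega
  obtain ⟨u, hu⟩ : ∃ u, u ∉ Submodule.span ℝ (Set.range v) := by
    by_contra! hcon
    exact hne (eq_top_iff.2 fun x _ ↦ hcon x)
  obtain ⟨f, hf, hf'⟩ := Submodule.exists_le_ker_of_notMem hu
  have := congrArg (fun b ↦ b (Fin.cons u v : Fin (k + 1) → V))
    (h (LinearMap.toContinuousLinearMap f))
  rw [oneWedge_cons _ _ _ _ (fun i ↦ ?_)] at this
  · have h2 : f u ≠ 0 := hf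
    simpa [h2] using this
  · exact hf' (Submodule.subset_span ⟨i, rfl⟩)

end ExteriorByOneForm

/-! ### Forms of codegree two as real bilinear forms -/

section Hermitian

lemma alternating_eq_det_smul {W ι : Type*} [AddCommGroup W] [Module ℝ W] [Fintype ι]
    [DecidableEq ι] (B : Module.Basis ι ℝ W) (η : W [⋀^ι]→ₗ[ℝ] ℂ) (v : ι → W) :
    η v = B.det v • η B := by
  have : η = (LinearMap.toSpanSingleton ℝ ℂ (η B)).compAlternatingMap B.det := by
    refine Module.Basis.ext_alternating B fun u hu ↦ ?_
    let σ : Equiv.Perm ι := Equiv.ofBijective u (Finite.injective_iff_bijective.1 hu)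
    have h1 : η (fun i ↦ B (u i)) = η (B ∘ σ) := rfl
    have h2 : B.det (fun i ↦ B (u i)) = B.det (B ∘ σ) := rfl
    rw [LinearMap.compAlternatingMap_apply, h1, h2, AlternatingMap.map_perm,
      AlternatingMap.map_perm, Module.Basis.det_self]
    rcases Int.units_eq_one_or (Equiv.Perm.sign σ) with h | h <;> simp [h]
  conv_lhs => rw [this]
  simp

lemma alternating_map_comp {W ι : Type*} [AddCommGroup W] [Module ℝ W] [Fintype ι]
    [DecidableEq ι] (B : Module.Basis ι ℝ W) (η : W [⋀^ι]→ₗ[ℝ] ℂ) (L : W →ₗ[ℝ] W) (v : ι → W) :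
    η (fun i ↦ L (v i)) = LinearMap.det L • η v := by
  rw [alternating_eq_det_smul B η v, alternating_eq_det_smul B η, smul_smul]
  congr 1
  exact Module.Basis.det_comp B L v

/-- The real basis `b₀, i b₀, b₁, i b₁, …` of a complex vector space with basis `b`. -/
def pairsBasis {W : Type*} [NormedAddCommGroup W] [NormedSpace ℂ W] {m : ℕ}
    (b : Module.Basis (Fin (m + 1)) ℂ W) : Module.Basis (Fin (2 * (m + 1))) ℝ W :=
  haveI : Nonempty (Fin (2 * (m + 1))) := ⟨⟨0, by omega⟩⟩
  basisOfLinearIndependentOfCardEqFinrank (linearIndependent_pairs b.linearIndependent) (by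
    rw [Fintype.card_fin, ← Module.finrank_mul_finrank ℝ ℂ W, Complex.finrank_real_complex,
      Module.finrank_eq_card_basis b, Fintype.card_fin])

lemma coe_pairsBasis {W : Type*} [NormedAddCommGroup W] [NormedSpace ℂ W] {m : ℕ}
    (b : Module.Basis (Fin (m + 1)) ℂ W) : ⇑(pairsBasis b) = pairs b := by
  simp [pairsBasis]

/-- A top form scales by the real determinant, which for a complex-linear map is the squared modulus
of the complex one. -/
lemma top_form_map_pairs {W : Type*} [NormedAddCommGroup W] [NormedSpace ℂ W] {m : ℕ}
    (b : Module.Basis (Fin (m + 1)) ℂ W) (η : W [⋀^Fin (2 * (m + 1))]→L[ℝ] ℂ) (L : W →ₗ[ℂ] W) :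
    η (fun i ↦ L (pairs b i)) = Complex.normSq (LinearMap.det L) • η (pairs b) := by
  have h := alternating_map_comp (pairsBasis b) η.toAlternatingMap (L.restrictScalars ℝ) (pairs b)
  have : Module.Free ℂ W := Module.Free.of_basis b
  rw [LinearMap.det_restrictScalars, Algebra.norm_complex_apply] at h
  exact h

variable {V : Type*} [NormedAddCommGroup V] [InnerProductSpace ℂ V]

/-- The change of basis is unitary, so its real determinant is one. Hence top forms can be evaluated
on any orthonormal frame, in particular on one adapted to a given vector. -/
lemma top_form_pairs_eq {m : ℕ} (b e : OrthonormalBasis (Fin (m + 1)) ℂ V)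
    (η : V [⋀^Fin (2 * (m + 1))]→L[ℝ] ℂ) : η (pairs e) = η (pairs b) := by
  have : FiniteDimensional ℂ V := b.toBasis.finiteDimensional_of_finite
  set L : V →ₗ[ℂ] V := b.toBasis.constr ℂ e with hL
  have h := top_form_map_pairs b.toBasis η L
  have hdet : Complex.normSq (LinearMap.det L) = 1 := by
    have h1 := Module.Basis.det_comp b.toBasis L b.toBasis
    rw [Module.Basis.det_self, mul_one] at h1
    have h2 : L ∘ b.toBasis = e := by
      ext i
      simp [hL]
    rw [← h1, h2, Complex.normSq_eq_norm_sq, OrthonormalBasis.det_to_matrix_orthonormalBasis]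
    simp
  have h3 : (fun i ↦ L (pairs b.toBasis i)) = pairs e := by
    ext i
    have := map_pairs (LinearMap.toContinuousLinearMap L) b.toBasis i
    refine this.trans ?_
    congr 1
    ext j
    simp [hL]
  rw [hdet, one_smul, h3] at h
  simpa using h

/-- The real part of the inner product. -/
def rin (u v : V) : ℝ := (inner ℂ u v).re

/-- The real-linear functional `v ↦ Re ⟪u, v⟫`. -/
def rinL (u : V) : V →L[ℝ] ℝ := Complex.reCLM.comp ((innerSL ℂ u).restrictScalars ℝ)

lemma rinL_apply (u v : V) : rinL u v = rin u v := rfl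

lemma rin_comm (u v : V) : rin u v = rin v u := by
  rw [rin, rin, ← inner_conj_symm, Complex.conj_re]

lemma rin_add_left (u u' v : V) : rin (u + u') v = rin u v + rin u' v := by
  simp [rin]

lemma rin_add_right (u v v' : V) : rin u (v + v') = rin u v + rin u v' := by
  simp [rin]

lemma rin_smul_left (c : ℝ) (u v : V) : rin (c • u) v = c * rin u v := by
  rw [← Complex.coe_smul, rin, inner_smul_left]
  simp [rin]

lemma rin_smul_right (c : ℝ) (u v : V) : rin u (c • v) = c * rin u v := by
  rw [rin_comm, rin_smul_left, rin_comm]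

lemma rin_I_left (u v : V) : rin (Complex.I • u) v = - rin u (Complex.I • v) := by
  rw [rin, rin, inner_smul_left, inner_smul_right]
  simp

lemma rin_neg_right (u v : V) : rin u (-v) = - rin u v := by
  simp [rin]

lemma rin_I_I (u v : V) : rin (Complex.I • u) (Complex.I • v) = rin u v := by
  rw [rin_I_left, smul_smul, Complex.I_mul_I, neg_one_smul, rin_neg_right, neg_neg]

lemma rin_self_I (u : V) : rin u (Complex.I • u) = 0 := by
  have h := rin_I_left u u
  rw [rin_comm] at h
  linarith

lemma rin_self_pos {u : V} (hu : u ≠ 0) : 0 < rin u u := by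
  have := inner_self_eq_norm_sq (𝕜 := ℂ) u
  change rin u u = _ at this
  rw [this]
  positivity

lemma rin_ext {u u' : V} (h : ∀ v, rin u v = rin u' v) : u = u' := by
  by_contra hne
  have h1 := rin_self_pos (sub_ne_zero.2 hne)
  have h2 : rin (u - u') (u - u') = rin u (u - u') - rin u' (u - u') := by
    rw [rin, inner_sub_left, Complex.sub_re, rin, rin]
  rw [h2, h, sub_self] at h1
  exact lt_irrefl _ h1

lemma sum_pairs {G : Type*} [AddCommMonoid G] {k : ℕ} (v : Fin k → V) (f : V → G) :
    ∑ i, f (pairs v i) = ∑ j, (f (v j) + f (Complex.I • v j)) := by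
  induction k with
  | zero => simp
  | succ k ih =>
    have h1 := Fin.sum_univ_succ (n := 2 * k + 1) (fun i ↦ f (pairs v i))
    have h2 := Fin.sum_univ_succ (n := 2 * k) (fun i ↦ f (pairs v (Fin.succ (n := 2 * k + 1) i)))
    refine h1.trans ?_
    rw [h2, Fin.sum_univ_succ, ← add_assoc]
    congr 1
    exact ih (Fin.tail v)

lemma sum_rin_smul_pairs {m : ℕ} (b : OrthonormalBasis (Fin m) ℂ V) (v : V) :
    ∑ i, rin (pairs b i) v • pairs b i = v := by
  rw [sum_pairs b (fun x ↦ rin x v • x)]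
  conv_rhs => rw [← b.sum_repr' v]
  refine Finset.sum_congr rfl fun j _ ↦ ?_
  have : (inner ℂ (b j) v : ℂ) = (rin (b j) v : ℂ) + (rin (Complex.I • b j) v : ℂ) * Complex.I := by
    apply Complex.ext
    · simp [rin]
    · simp [rin]
  rw [this, add_smul, mul_smul, Complex.coe_smul, Complex.coe_smul]

/-- The operator `T` with `Re ⟪T u, v⟫ = B (u, i v)`. -/
def opOfBilin {m : ℕ} (b : OrthonormalBasis (Fin m) ℂ V) (B : V →ₗ[ℝ] V →ₗ[ℝ] ℝ) : V →ₗ[ℝ] V where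
  toFun u := ∑ i, B u (Complex.I • pairs b i) • pairs b i
  map_add' u u' := by simp [add_smul, Finset.sum_add_distrib]
  map_smul' c u := by simp [mul_smul, Finset.smul_sum]

lemma rin_opOfBilin {m : ℕ} (b : OrthonormalBasis (Fin m) ℂ V) (B : V →ₗ[ℝ] V →ₗ[ℝ] ℝ)
    (u v : V) : rin (opOfBilin b B u) v = B u (Complex.I • v) := by
  conv_rhs => rw [← sum_rin_smul_pairs b v, Finset.smul_sum, map_sum]
  have : rin (opOfBilin b B u) v = rinL v (opOfBilin b B u) := rin_comm _ _
  rw [this]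
  change rinL v (∑ i, B u (Complex.I • pairs b i) • pairs b i) = _
  rw [map_sum]
  refine Finset.sum_congr rfl fun i _ ↦ ?_
  rw [smul_comm Complex.I, (rinL v).map_smul, (B u).map_smul, rinL_apply, rin_comm, smul_eq_mul, smul_eq_mul,
    mul_comm]

/-- The real bilinear form `(u, v) ↦ u♭ ∧ v♭ ∧ Ω`, the top form being evaluated on the standard
basis. -/
def coBilin {k : ℕ} (b : Fin (k + 1) → V) (Ω : V [⋀^Fin (2 * k)]→L[ℝ] ℂ) :
    V →ₗ[ℝ] V →ₗ[ℝ] ℝ :=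
  LinearMap.mk₂ ℝ (fun u v ↦ (oneWedge (rinL u) (oneWedge (rinL v) Ω) (pairs b)).re)
    (fun u u' v ↦ by
      rw [show rinL (u + u') = rinL u + rinL u' from ContinuousLinearMap.ext (rin_add_left u u'),
        oneWedge_add_left]; rfl)
    (fun c u v ↦ by
      rw [show rinL (c • u) = c • rinL u from ContinuousLinearMap.ext (rin_smul_left c u),
        oneWedge_smul_left]; simp)
    (fun u v v' ↦ by
      rw [show rinL (v + v') = rinL v + rinL v' from ContinuousLinearMap.ext (rin_add_left v v'),
        oneWedge_add_left, oneWedge_add_right]; rfl)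
    (fun c u v ↦ by
      rw [show rinL (c • v) = c • rinL v from ContinuousLinearMap.ext (rin_smul_left c v),
        oneWedge_smul_left, oneWedge_smul_right]; simp)

lemma coBilin_apply {k : ℕ} (b : Fin (k + 1) → V) (Ω : V [⋀^Fin (2 * k)]→L[ℝ] ℂ) (u v : V) :
    coBilin b Ω u v = (oneWedge (rinL u) (oneWedge (rinL v) Ω) (pairs b)).re := rfl

lemma coBilin_swap {k : ℕ} (b : Fin (k + 1) → V) (Ω : V [⋀^Fin (2 * k)]→L[ℝ] ℂ) (u v : V) :
    coBilin b Ω v u = - coBilin b Ω u v := by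
  rw [coBilin_apply, coBilin_apply, oneWedge_swap]
  rfl

lemma coBilin_basis {k : ℕ} (b e : OrthonormalBasis (Fin (k + 1)) ℂ V)
    (Ω : V [⋀^Fin (2 * k)]→L[ℝ] ℂ) : coBilin e Ω = coBilin b Ω := by
  ext u v
  rw [coBilin_apply, coBilin_apply]
  exact congrArg Complex.re (top_form_pairs_eq b e _)

/-- The dual covector of `i u` is minus that of `u` composed with `i`, so the two signs cancel. What
is left is a top form pulled back by `i`, whose real determinant is one. -/
lemma coBilin_I_I {k : ℕ} (b : OrthonormalBasis (Fin (k + 1)) ℂ V)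
    (Ω : V [⋀^Fin (2 * k)]→L[ℝ] ℂ) (hΩ : Ω.compContinuousLinearMap (mulI V) = Ω) (u v : V) :
    coBilin b Ω (Complex.I • u) (Complex.I • v) = coBilin b Ω u v := by
  have h1 : ∀ u : V, rinL (Complex.I • u) = (-1 : ℝ) • (rinL u).comp (mulI V) := fun u ↦ by
    ext v
    simp [rinL_apply, rin_I_left, mulI]
  rw [coBilin_apply, coBilin_apply, h1, h1, oneWedge_smul_left, oneWedge_smul_left,
    oneWedge_smul_right, smul_smul]
  conv_lhs => rw [← hΩ]
  rw [oneWedge_comp, oneWedge_comp]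
  rw [neg_one_mul, neg_neg, one_smul]
  have h := top_form_map_pairs b.toBasis (oneWedge (rinL u) (oneWedge (rinL v) Ω))
    (Complex.I • LinearMap.id)
  have hdet : Complex.normSq (LinearMap.det (Complex.I • (LinearMap.id : V →ₗ[ℂ] V))) = 1 := by
    simp [LinearMap.det_smul]
  rw [hdet, one_smul] at h
  simp only [OrthonormalBasis.coe_toBasis] at h
  rw [← h]
  rfl

lemma pairs_succ_eq {k : ℕ} (v : Fin (k + 1) → V) : pairs v =
    (Fin.cons (v 0) (Fin.cons (Complex.I • v 0) (pairs (Fin.tail v))) :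
      Fin (2 * k + 1 + 1) → V) := rfl

lemma OrthonormalBasis.rin_tail {k : ℕ} (e : OrthonormalBasis (Fin (k + 1)) ℂ V) (i : Fin (2 * k)) :
    rin (e 0) (pairs (Fin.tail e) i) = 0 ∧ rin (Complex.I • e 0) (pairs (Fin.tail e) i) = 0 := by
  have h : ∀ j : Fin k, inner ℂ (e 0) (e j.succ) = (0 : ℂ) := fun j ↦
    e.orthonormal.2 (Fin.succ_ne_zero j).symm
  refine pairs_forall (p := fun x ↦ rin (e 0) x = 0 ∧ rin (Complex.I • e 0) x = 0) _
    (fun j ↦ ⟨⟨?_, ?_⟩, ?_, ?_⟩) i <;> simp [rin, Fin.tail, h]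

lemma OrthonormalBasis.rin_self {k : ℕ} (e : OrthonormalBasis (Fin k) ℂ V) (j : Fin k) :
    rin (e j) (e j) = 1 := by
  simp [rin, e.norm_eq_one]

/-- The covectors dual to `e 0` and `i e 0` use up the first two slots and vanish on the rest. Thus
the quadratic form attached to `Ω` takes at a unit vector the value of `Ω` on its orthogonal
complement. -/
lemma coBilin_eq_apply_tail {k : ℕ} (e : OrthonormalBasis (Fin (k + 1)) ℂ V)
    (Ω : V [⋀^Fin (2 * k)]→L[ℝ] ℂ) :
    coBilin e Ω (e 0) (Complex.I • e 0) = (Ω (pairs (Fin.tail e))).re := by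
  have h0 : rin (e 0) (e 0) = 1 := OrthonormalBasis.rin_self e 0
  rw [coBilin_apply, pairs_succ_eq, oneWedge_cons (k := 2 * k + 1), oneWedge_cons (k := 2 * k),
    rinL_apply, rinL_apply, rin_I_I, h0]
  · simp
  · exact fun i ↦ (OrthonormalBasis.rin_tail e i).2
  · refine Fin.cases ?_ fun i ↦ ?_
    · exact rin_self_I _
    · exact (OrthonormalBasis.rin_tail e i).1

/-- Only the component of `u` along `i e 0` contributes. For the remaining part `u'`, the power of
`w` would have to take `i e 0`, which is `w`-orthogonal to all its other arguments. This makes `e 0`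
an eigenvector of the operator of the power. -/
lemma coBilin_wedgePow_eq {k : ℕ} (e : OrthonormalBasis (Fin (k + 2)) ℂ V)
    (w : V [⋀^Fin 2]→L[ℝ] ℂ) (hw : ∀ i, w ![Complex.I • e 0, pairs (Fin.tail e) i] = 0) (u : V) :
    coBilin e (wedgePow w (k + 1)) (e 0) u =
      rin (Complex.I • e 0) u * (wedgePow w (k + 1) (pairs (Fin.tail e))).re := by
  set a := rin (Complex.I • e 0) u with ha
  have h0 : rin (e 0) (e 0) = 1 := OrthonormalBasis.rin_self e 0
  set u' := u - a • (Complex.I • e 0) with hu'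
  have h1 : rin u' (Complex.I • e 0) = 0 := by
    rw [hu', sub_eq_add_neg, ← neg_smul, rin_add_left, rin_smul_left, rin_I_I, h0,
      rin_comm u, ← ha]
    ring
  have hu : u = a • (Complex.I • e 0) + u' := by rw [hu']; abel
  have h2 : coBilin e (wedgePow w (k + 1)) (e 0) u' = 0 := by
    rw [coBilin_apply, pairs_succ_eq, oneWedge_cons (k := 2 * (k + 1) + 1)]
    · have := oneWedge_cons_eq_zero (k := 2 * k + 1) (rinL u') (wedgePow w (k + 1))
        (Complex.I • e 0) (pairs (Fin.tail e)) h1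
        (fun i ↦ wedgePow_succ_cons_eq_zero w _ k _ fun j ↦ hw _)
      change (_ * oneWedge (rinL u') (wedgePow w (k + 1)) (Fin.cons (Complex.I • e 0)
        (pairs (Fin.tail e)) : Fin (2 * k + 1 + 2) → V)).re = 0
      rw [this]
      simp
    · refine Fin.cases ?_ fun i ↦ ?_
      · exact rin_self_I _
      · exact (OrthonormalBasis.rin_tail e i).1
  rw [hu, map_add, map_smul, h2, coBilin_eq_apply_tail]
  simp

end Hermitian

/-! ### Positive operators and the forms they represent -/

section PositiveOperators
variable {V : Type*} [NormedAddCommGroup V] [InnerProductSpace ℂ V]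

/-- A complex-linear positive definite self-adjoint operator, as a real-linear operator. -/
structure IsPosOp (S : V →L[ℝ] V) : Prop where
  map_I : ∀ u, S (Complex.I • u) = Complex.I • S u
  symm : ∀ u v, rin (S u) v = rin u (S v)
  pos : ∀ u, u ≠ 0 → 0 < rin (S u) u

lemma continuous_rin : Continuous fun p : V × V ↦ rin p.1 p.2 :=
  Complex.continuous_re.comp (continuous_fst.inner continuous_snd)

/-- The two-form `(u, v) ↦ - Re ⟪S u, i v⟫`, antisymmetrised. -/
def opForm (S : V →L[ℝ] V) : V [⋀^Fin 2]→L[ℝ] ℂ where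
  toFun v := ((-(1 / 2) * (rin (S (v 0)) (Complex.I • v 1) - rin (S (v 1)) (Complex.I • v 0)) : ℝ) :
    ℂ)
  map_update_add' v i x y := by
    rw [← Complex.ofReal_add]
    congr 1
    fin_cases i
    · simp [rin_add_left, rin_add_right, smul_add]
      ring
    · simp [rin_add_left, rin_add_right, smul_add]
      ring
  map_update_smul' v i c x := by
    rw [Complex.real_smul, ← Complex.ofReal_mul]
    congr 1
    fin_cases i
    · simp [rin_smul_left, rin_smul_right, smul_comm Complex.I c]
      ring
    · simp [rin_smul_left, rin_smul_right, smul_comm Complex.I c]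
      ring
  map_eq_zero_of_eq' v i j h hij := by
    have : v 0 = v 1 := by
      fin_cases i <;> fin_cases j <;> simp_all
    simp [this]
  cont := by
    have h1 : Continuous fun v : Fin 2 → V ↦ rin (S (v 0)) (Complex.I • v 1) :=
      continuous_rin.comp (by fun_prop : Continuous fun v : Fin 2 → V ↦
        (S (v 0), Complex.I • v 1))
    have h2 : Continuous fun v : Fin 2 → V ↦ rin (S (v 1)) (Complex.I • v 0) :=
      continuous_rin.comp (by fun_prop : Continuous fun v : Fin 2 → V ↦
        (S (v 1), Complex.I • v 0))
    exact Complex.continuous_ofReal.comp (continuous_const.mul (h1.sub h2))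

lemma opForm_apply (S : V →L[ℝ] V) (u v : V) : opForm S ![u, v] =
    ((-(1 / 2) * (rin (S u) (Complex.I • v) - rin (S v) (Complex.I • u)) : ℝ) : ℂ) := rfl

lemma IsPosOp.opForm_apply {S : V →L[ℝ] V} (hS : IsPosOp S) (u v : V) :
    opForm S ![u, v] = ((- rin (S u) (Complex.I • v) : ℝ) : ℂ) := by
  rw [StronglyGauduchon.opForm_apply]
  congr 1
  rw [hS.symm v, hS.map_I, rin_comm v, rin_I_left]
  ring

lemma opForm_add (S T : V →L[ℝ] V) : opForm (S + T) = opForm S + opForm T := by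
  ext v
  change ((_ : ℝ) : ℂ) = ((_ : ℝ) : ℂ) + ((_ : ℝ) : ℂ)
  rw [← Complex.ofReal_add]
  congr 1
  simp [rin_add_left]
  ring

lemma opForm_smul (c : ℝ) (S : V →L[ℝ] V) : opForm (c • S) = c • opForm S := by
  ext v
  change ((_ : ℝ) : ℂ) = c • ((_ : ℝ) : ℂ)
  rw [Complex.real_smul, ← Complex.ofReal_mul]
  congr 1
  simp [rin_smul_left]
  ring

lemma IsPosOp.isPositiveForm {S : V →L[ℝ] V} (hS : IsPosOp S) : IsPositiveForm (opForm S) where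
  real u v := Complex.ofReal_im _
  type_one_one u v := by rw [hS.opForm_apply, hS.opForm_apply, hS.map_I, rin_I_I]
  pos v hv := by
    rw [hS.opForm_apply, smul_smul, Complex.I_mul_I, neg_one_smul, rin_neg_right, neg_neg,
      Complex.ofReal_re]
    exact hS.pos v hv

/-- The operator of a positive form. -/
lemma IsPositiveForm.exists_isPosOp {m : ℕ} (b : OrthonormalBasis (Fin m) ℂ V)
    {w : V [⋀^Fin 2]→L[ℝ] ℂ} (hw : IsPositiveForm w) : ∃ S : V →L[ℝ] V, IsPosOp S ∧ opForm S = w := by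
  have : FiniteDimensional ℂ V := b.toBasis.finiteDimensional_of_finite
  have hadd : ∀ u u' v, w ![u + u', v] = w ![u, v] + w ![u', v] := fun u u' v ↦ by
    rw [two_form_swap, ← twoFormLeft_apply, map_add, twoFormLeft_apply, twoFormLeft_apply,
      two_form_swap w u v, two_form_swap w u' v]
    ring
  have hsmul : ∀ (c : ℝ) u v, w ![c • u, v] = c • w ![u, v] := fun c u v ↦ by
    rw [two_form_swap, ← twoFormLeft_apply, map_smul, twoFormLeft_apply,
      two_form_swap w u v, smul_neg, neg_neg]
  set B : V →ₗ[ℝ] V →ₗ[ℝ] ℝ := LinearMap.mk₂ ℝ (fun u v ↦ (w ![u, v]).re)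
    (fun u u' v ↦ by rw [hadd]; rfl) (fun c u v ↦ by rw [hsmul]; simp)
    (fun u v v' ↦ by
      rw [← twoFormLeft_apply, map_add, twoFormLeft_apply, twoFormLeft_apply, Complex.add_re])
    (fun c u v ↦ by rw [← twoFormLeft_apply, map_smul, twoFormLeft_apply]; simp) with hB
  have hBa : ∀ u v, B u v = (w ![u, v]).re := fun u v ↦ rfl
  set S : V →L[ℝ] V := LinearMap.toContinuousLinearMap (opOfBilin b B) with hS
  have hrin : ∀ u v, rin (S u) v = (w ![u, Complex.I • v]).re := fun u v ↦ rin_opOfBilin b B u v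
  have hw' := two_form_I_right hw.type_one_one
  have hpos : IsPosOp S := by
    refine ⟨fun u ↦ rin_ext fun v ↦ ?_, fun u v ↦ ?_, fun u hu ↦ ?_⟩
    · rw [hrin, hw.type_one_one, rin_I_left, hrin, smul_smul, Complex.I_mul_I, neg_one_smul,
        ← twoFormLeft_apply w u (-v), map_neg, Complex.neg_re, neg_neg, twoFormLeft_apply]
    · rw [rin_comm u, hrin, hrin, hw', two_form_swap, neg_neg]
    · rw [hrin]
      exact hw.pos u hu
  refine ⟨S, hpos, ?_⟩
  ext v
  obtain ⟨x, y, rfl⟩ : ∃ x y, v = ![x, y] := ⟨v 0, v 1, by ext i; fin_cases i <;> rfl⟩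
  rw [hpos.opForm_apply, hrin, smul_smul, Complex.I_mul_I, neg_one_smul, ← twoFormLeft_apply,
    map_neg, twoFormLeft_apply]
  apply Complex.ext
  · simp
  · simp [hw.real]

/-- A real-linear operator commuting with `i` as a complex-linear operator. -/
def complexify (S : V →ₗ[ℝ] V) (h : ∀ u, S (Complex.I • u) = Complex.I • S u) : V →ₗ[ℂ] V where
  toFun := S
  map_add' := S.map_add
  map_smul' c u := by
    conv_lhs => rw [← Complex.re_add_im c]
    simp only [RingHom.id_apply]
    rw [add_smul, mul_smul, Complex.coe_smul, Complex.coe_smul, S.map_add, S.map_smul, S.map_smul,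
      h]
    conv_rhs => rw [← Complex.re_add_im c]
    rw [add_smul, mul_smul, Complex.coe_smul, Complex.coe_smul]

lemma IsPosOp.exists_eigenbasis {k : ℕ} {S : V →L[ℝ] V} (hS : IsPosOp S)
    (b : OrthonormalBasis (Fin k) ℂ V) : ∃ (e : OrthonormalBasis (Fin k) ℂ V) (l : Fin k → ℝ),
      (∀ j, 0 < l j) ∧ ∀ j, S (e j) = l j • e j := by
  have : FiniteDimensional ℂ V := b.toBasis.finiteDimensional_of_finite
  have hsymm : (complexify S.toLinearMap hS.map_I).IsSymmetric := by
    intro u v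
    apply Complex.ext
    · exact hS.symm u v
    · have h1 := hS.symm (Complex.I • u) v
      rw [hS.map_I] at h1
      have : ∀ x y : V, rin (Complex.I • x) y = (inner ℂ x y).im := fun x y ↦ by
        simp [rin]
      rw [this, this] at h1
      exact h1
  have hn : Module.finrank ℂ V = k := by
    rw [Module.finrank_eq_card_basis b.toBasis, Fintype.card_fin]
  have heig : ∀ j, S (hsymm.eigenvectorBasis hn j) =
      hsymm.eigenvalues hn j • hsymm.eigenvectorBasis hn j := fun j ↦ by
    rw [← Complex.coe_smul]
    exact hsymm.apply_eigenvectorBasis hn j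
  refine ⟨hsymm.eigenvectorBasis hn, hsymm.eigenvalues hn, fun j ↦ ?_, heig⟩
  have hne : hsymm.eigenvectorBasis hn j ≠ 0 :=
    (hsymm.eigenvectorBasis hn).orthonormal.ne_zero j
  have := hS.pos _ hne
  rw [heig, rin_smul_left, OrthonormalBasis.rin_self, mul_one] at this
  exact this

lemma wedgePow_pairs_of_orthogonal (w : V [⋀^Fin 2]→L[ℝ] ℂ) {k : ℕ} (v : Fin k → V)
    (l : Fin k → ℝ) (hl : ∀ j, w ![v j, Complex.I • v j] = (l j : ℂ))
    (h : ∀ i j, i ≠ j → w ![v i, v j] = 0) (h' : ∀ i j, i ≠ j → w ![v i, Complex.I • v j] = 0)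
    (hw : ∀ u v, w ![Complex.I • u, Complex.I • v] = w ![u, v]) :
    wedgePow w k (pairs v) = ((k.factorial * ∏ j, l j : ℝ) : ℂ) := by
  induction k with
  | zero => simp [wedgePow]
  | succ k ih =>
    rw [pairs_succ_eq, wedgePow_succ_cons_cons, ih (Fin.tail v) (Fin.tail l) (fun j ↦ hl _)
      (fun i j hij ↦ h _ _ (by simpa using hij)) (fun i j hij ↦ h' _ _ (by simpa using hij)), hl 0]
    · rw [Fin.prod_univ_succ, Nat.factorial_succ]
      simp only [Fin.tail]
      push_cast
      ring
    · exact pairs_forall (p := fun x ↦ w ![v 0, x] = 0) _ fun j ↦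
        ⟨h 0 j.succ (Fin.succ_ne_zero j).symm, h' 0 j.succ (Fin.succ_ne_zero j).symm⟩
    · refine pairs_forall (p := fun x ↦ w ![Complex.I • v 0, x] = 0) _ fun j ↦ ⟨?_, ?_⟩
      · have := two_form_I_right hw (v 0) (v j.succ)
        rw [h' 0 j.succ (Fin.succ_ne_zero j).symm] at this
        exact neg_eq_zero.1 this.symm
      · rw [hw]
        exact h 0 j.succ (Fin.succ_ne_zero j).symm

/-- The operator of the form `coBilin`. -/
def coOp {k : ℕ} (b : OrthonormalBasis (Fin (k + 1)) ℂ V) (Ω : V [⋀^Fin (2 * k)]→L[ℝ] ℂ) :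
    V →L[ℝ] V :=
  haveI : FiniteDimensional ℂ V := b.toBasis.finiteDimensional_of_finite
  LinearMap.toContinuousLinearMap (opOfBilin b (coBilin b Ω))

lemma rin_coOp {k : ℕ} (b : OrthonormalBasis (Fin (k + 1)) ℂ V) (Ω : V [⋀^Fin (2 * k)]→L[ℝ] ℂ)
    (u v : V) : rin (coOp b Ω u) v = coBilin b Ω u (Complex.I • v) := rin_opOfBilin b _ u v

lemma coOp_map_I {k : ℕ} (b : OrthonormalBasis (Fin (k + 1)) ℂ V) (Ω : V [⋀^Fin (2 * k)]→L[ℝ] ℂ)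
    (hΩ : Ω.compContinuousLinearMap (mulI V) = Ω) (u : V) :
    coOp b Ω (Complex.I • u) = Complex.I • coOp b Ω u := by
  refine rin_ext fun v ↦ ?_
  rw [rin_coOp, coBilin_I_I _ _ hΩ, rin_I_left, rin_coOp, smul_smul, Complex.I_mul_I, neg_one_smul,
    map_neg, neg_neg]

lemma coOp_symm {k : ℕ} (b : OrthonormalBasis (Fin (k + 1)) ℂ V) (Ω : V [⋀^Fin (2 * k)]→L[ℝ] ℂ)
    (hΩ : Ω.compContinuousLinearMap (mulI V) = Ω) (u v : V) :
    rin (coOp b Ω u) v = rin u (coOp b Ω v) := by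
  rw [rin_comm u, rin_coOp, rin_coOp, ← coBilin_I_I b Ω hΩ v, smul_smul, Complex.I_mul_I,
    neg_one_smul, map_neg, coBilin_swap b Ω u, neg_neg]

lemma exists_orthonormalBasis_apply_zero {k : ℕ} (b : OrthonormalBasis (Fin (k + 1)) ℂ V) (u : V)
    (hu : ‖u‖ = 1) : ∃ e : OrthonormalBasis (Fin (k + 1)) ℂ V, e 0 = u := by
  have : FiniteDimensional ℂ V := b.toBasis.finiteDimensional_of_finite
  obtain ⟨e, he⟩ := Orthonormal.exists_orthonormalBasis_extension_of_card_eq (𝕜 := ℂ)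
    (ι := Fin (k + 1)) (v := fun _ ↦ u) (s := {0})
    (Module.finrank_eq_card_basis b.toBasis) (by
      refine ⟨fun _ ↦ hu, fun i j hij ↦ absurd (Subsingleton.elim i j) hij⟩)
  exact ⟨e, he 0 rfl⟩

/-- Complete the normalised `u` to an orthonormal basis; then the quadratic form at `u` is a
positive multiple of the value of `Ω` on a complex frame of the complement. -/
lemma isPosOp_coOp {k : ℕ} (b : OrthonormalBasis (Fin (k + 1)) ℂ V)
    (Ω : V [⋀^Fin (2 * k)]→L[ℝ] ℂ) (hΩ : Ω.compContinuousLinearMap (mulI V) = Ω)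
    (hpos : ∀ v : Fin k → V, LinearIndependent ℂ v → 0 < (Ω (pairs v)).re) :
    IsPosOp (coOp b Ω) := by
  refine ⟨coOp_map_I b Ω hΩ, coOp_symm b Ω hΩ, fun u hu ↦ ?_⟩
  obtain ⟨e, he⟩ := exists_orthonormalBasis_apply_zero b ((‖u‖⁻¹ : ℝ) • u) (by
    rw [norm_smul, norm_inv, norm_norm, inv_mul_cancel₀ (norm_ne_zero_iff.2 hu)])
  have h1 : 0 < coBilin b Ω (e 0) (Complex.I • e 0) := by
    rw [← coBilin_basis b e, coBilin_eq_apply_tail]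
    refine hpos _ ?_
    exact e.orthonormal.linearIndependent.comp Fin.succ (Fin.succ_injective _)
  have h2 : u = ‖u‖ • e 0 := by
    rw [he, smul_smul, mul_inv_cancel₀ (norm_ne_zero_iff.2 hu), one_smul]
  rw [rin_coOp, h2, smul_comm Complex.I, (coBilin b Ω _).map_smul, (coBilin b Ω).map_smul,
    LinearMap.smul_apply, smul_eq_mul, smul_eq_mul]
  have := norm_pos_iff.2 hu
  positivity

end PositiveOperators

/-! ### The root of a codegree-two form -/

section Root
variable {V : Type*} [NormedAddCommGroup V] [InnerProductSpace ℂ V]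

/-- Cofactors: on an eigenvector of `S` with eigenvalue `l j`, the operator of the power is `(k +
1)!` times the product of the other eigenvalues. Composing with `S` restores the full product, so `C
= (k + 1)! det S` for every `j`. -/
lemma exists_coOp_wedgePow_opForm {k : ℕ} (b : OrthonormalBasis (Fin (k + 2)) ℂ V)
    {S : V →L[ℝ] V} (hS : IsPosOp S) :
    ∃ C : ℝ, 0 < C ∧ ∀ u, coOp b (wedgePow (opForm S) (k + 1)) (S u) = C • u := by
  obtain ⟨e, l, hl, he⟩ := hS.exists_eigenbasis b
  set w := opForm S with hw
  have hpos := hS.isPositiveForm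
  have hJ : (wedgePow w (k + 1)).compContinuousLinearMap (mulI V) = wedgePow w (k + 1) := by
    rw [← wedgePow_compContinuousLinearMap]
    congr 1
    ext v
    obtain ⟨x, y, rfl⟩ : ∃ x y, v = ![x, y] := ⟨v 0, v 1, by ext i; fin_cases i <;> rfl⟩
    rw [← hpos.type_one_one x y, ContinuousAlternatingMap.compContinuousLinearMap_apply]
    congr 1
    ext i
    fin_cases i <;> rfl
  have horth : ∀ i j, i ≠ j → rin (e i) (e j) = 0 := fun i j hij ↦ by
    simp [rin, e.orthonormal.2 hij]
  have horth' : ∀ i j, rin (e i) (Complex.I • e j) = 0 := fun i j ↦ by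
    rcases eq_or_ne i j with rfl | hij
    · exact rin_self_I _
    · simp [rin, e.orthonormal.2 hij]
  have hw1 : ∀ i v, w ![e i, v] = ((- (l i * rin (e i) (Complex.I • v)) : ℝ) : ℂ) := fun i v ↦ by
    rw [hS.opForm_apply, he, rin_smul_left]
  have hw2 : ∀ i j, i ≠ j → w ![e i, e j] = 0 := fun i j _ ↦ by rw [hw1, horth']; simp
  have hw3 : ∀ i j, i ≠ j → w ![e i, Complex.I • e j] = 0 := fun i j hij ↦ by
    rw [hw1, smul_smul, Complex.I_mul_I, neg_one_smul, rin_neg_right, horth i j hij]; simp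
  have hw4 : ∀ i, w ![e i, Complex.I • e i] = (l i : ℂ) := fun i ↦ by
    rw [hw1, smul_smul, Complex.I_mul_I, neg_one_smul, rin_neg_right, OrthonormalBasis.rin_self]
    simp
  refine ⟨(k + 1).factorial * ∏ j, l j, by
    have := Finset.prod_pos (s := Finset.univ) fun j _ ↦ hl j
    positivity, ?_⟩
  set T := coOp b (wedgePow w (k + 1)) with hT
  have hTI : ∀ u, T (Complex.I • u) = Complex.I • T u := coOp_map_I b _ hJ
  have key : ∀ j, T (S (e j)) = ((k + 1).factorial * ∏ j, l j : ℝ) • e j := by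
    intro j
    -- The eigenvector `e j` is moved to index `0`, the place distinguished by
    -- `coBilin_wedgePow_eq`.
    set σ : Equiv.Perm (Fin (k + 2)) := Equiv.swap 0 j with hσ
    set e' := e.reindex σ with he'
    have he'a : ∀ i, e' i = e (σ i) := fun i ↦ by
      rw [he', OrthonormalBasis.reindex_apply, hσ, Equiv.symm_swap]
    have he0 : e' 0 = e j := by rw [he'a, hσ, Equiv.swap_apply_left]
    have hne : ∀ i : Fin (k + 1), σ 0 ≠ σ i.succ := fun i h ↦
      Fin.succ_ne_zero i (σ.injective h).symm
    have hval : wedgePow w (k + 1) (pairs (Fin.tail e')) =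
        (((k + 1).factorial * ∏ i : Fin (k + 1), l (σ i.succ) : ℝ) : ℂ) := by
      refine wedgePow_pairs_of_orthogonal w (Fin.tail e') (fun i ↦ l (σ i.succ)) (fun i ↦ ?_)
        (fun i i' h ↦ ?_) (fun i i' h ↦ ?_) hpos.type_one_one
      · rw [Fin.tail, he'a, hw4]
      · rw [Fin.tail, Fin.tail, he'a, he'a]
        exact hw2 _ _ fun h' ↦ h (Fin.succ_injective _ (σ.injective h'))
      · rw [Fin.tail, Fin.tail, he'a, he'a]
        exact hw3 _ _ fun h' ↦ h (Fin.succ_injective _ (σ.injective h'))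
    have hprod : ∏ i, l i = l j * ∏ i : Fin (k + 1), l (σ i.succ) := by
      rw [← Equiv.prod_comp σ, Fin.prod_univ_succ, hσ, Equiv.swap_apply_left]
    have h1 : ∀ v, rin (T (e j)) v =
        ((k + 1).factorial * ∏ i : Fin (k + 1), l (σ i.succ)) * rin (e j) v := by
      intro v
      rw [hT, rin_coOp, ← coBilin_basis b e', ← he0, coBilin_wedgePow_eq, hval, rin_I_I,
        Complex.ofReal_re, mul_comm]
      refine pairs_forall (p := fun x ↦ w ![Complex.I • e' 0, x] = 0) _ fun i ↦ ⟨?_, ?_⟩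
      · have := two_form_I_right hpos.type_one_one (e' 0) (Fin.tail e' i)
        rw [Fin.tail, he'a, he'a, hw3 _ _ (hne i)] at this
        rw [Fin.tail, he'a, he'a]
        exact neg_eq_zero.1 this.symm
      · rw [hpos.type_one_one, Fin.tail, he'a, he'a]
        exact hw2 _ _ (hne i)
    have h2 : T (e j) = ((k + 1).factorial * ∏ i : Fin (k + 1), l (σ i.succ) : ℝ) • e j :=
      rin_ext fun v ↦ by rw [h1, rin_smul_left]
    rw [he, T.map_smul, h2, smul_smul, hprod]
    congr 1
    ring
  intro u
  have hI : ∀ u, (T.comp S).toLinearMap (Complex.I • u) = Complex.I • (T.comp S).toLinearMap u :=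
    fun u ↦ by
      change T (S (Complex.I • u)) = Complex.I • T (S u)
      rw [hS.map_I, hTI]
  have := e.toBasis.ext (f₁ := complexify (T.comp S).toLinearMap hI)
    (f₂ := (((k + 1).factorial * ∏ j, l j : ℝ) : ℂ) • LinearMap.id) fun j ↦ by
      rw [OrthonormalBasis.coe_toBasis]
      refine (key j).trans ?_
      rw [LinearMap.smul_apply, Complex.coe_smul]
      rfl
  have h3 := LinearMap.congr_fun this u
  rw [LinearMap.smul_apply, Complex.coe_smul] at h3
  exact h3

lemma oneWedge_im {k : ℕ} (ξ : V →L[ℝ] ℝ) (a : V [⋀^Fin k]→L[ℝ] ℂ) (ha : ∀ v, (a v).im = 0)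
    (v : Fin (k + 1) → V) : (oneWedge ξ a v).im = 0 := by
  rw [oneWedge_apply, Complex.im_sum]
  refine Finset.sum_eq_zero fun i _ ↦ ?_
  rw [show ((-1 : ℂ) ^ (i : ℕ)) = (((-1 : ℝ) ^ (i : ℕ) : ℝ) : ℂ) by push_cast; rfl,
    Complex.im_ofReal_mul, Complex.im_ofReal_mul, ha, mul_zero, mul_zero]

/-- Two wedge factors lift a form of degree `2 k` to the top degree `2 k + 2`, and
`eq_zero_of_oneWedge_eq_zero` removes them one after the other. Reality is needed because `coBilin`
records only real parts. -/
lemma eq_of_coBilin_eq {k : ℕ} (b : OrthonormalBasis (Fin (k + 1)) ℂ V)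
    {Ω Ω' : V [⋀^Fin (2 * k)]→L[ℝ] ℂ} (hΩ : ∀ v, (Ω v).im = 0) (hΩ' : ∀ v, (Ω' v).im = 0)
    (h : coBilin b Ω = coBilin b Ω') : Ω = Ω' := by
  have : FiniteDimensional ℂ V := b.toBasis.finiteDimensional_of_finite
  have hdim : Module.finrank ℝ V = 2 * (k + 1) := by
    rw [Module.finrank_eq_card_basis (pairsBasis b.toBasis), Fintype.card_fin]
  have hsurj : ∀ ξ : V →L[ℝ] ℝ, ∃ u, rinL u = ξ := fun ξ ↦ by
    refine ⟨∑ i, ξ (pairs b i) • pairs b i, ContinuousLinearMap.ext fun v ↦ ?_⟩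
    conv_rhs => rw [← sum_rin_smul_pairs b v, map_sum]
    rw [rinL_apply, rin_comm, ← rinL_apply, map_sum]
    refine Finset.sum_congr rfl fun i _ ↦ ?_
    rw [(rinL v).map_smul, ξ.map_smul, rinL_apply, rin_comm, smul_eq_mul, smul_eq_mul, mul_comm]
  rw [← sub_eq_zero]
  refine eq_zero_of_oneWedge_eq_zero (by omega) _ fun ξ ↦ ?_
  refine eq_zero_of_oneWedge_eq_zero (by omega) _ fun η ↦ ?_
  obtain ⟨u, rfl⟩ := hsurj ξ
  obtain ⟨v, rfl⟩ := hsurj η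
  have h0 : oneWedge (rinL v) (oneWedge (rinL u) (Ω - Ω')) (pairs b) = 0 := by
    rw [sub_eq_add_neg, ← neg_one_smul ℝ, oneWedge_add_right, oneWedge_smul_right,
      oneWedge_add_right, oneWedge_smul_right]
    have h1 := LinearMap.congr_fun (LinearMap.congr_fun h v) u
    rw [coBilin_apply, coBilin_apply] at h1
    have h2 := oneWedge_im (rinL v) _ (oneWedge_im (rinL u) Ω hΩ) (pairs b)
    have h3 := oneWedge_im (rinL v) _ (oneWedge_im (rinL u) Ω' hΩ') (pairs b)
    rw [ContinuousAlternatingMap.add_apply, ContinuousAlternatingMap.smul_apply, neg_one_smul,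
      Complex.ext h1 (h2.trans h3.symm), add_neg_cancel]
  ext x
  have h4 := alternating_eq_det_smul (pairsBasis b.toBasis)
    (oneWedge (rinL v) (oneWedge (rinL u) (Ω - Ω'))).toAlternatingMap x
  rw [coe_pairsBasis, OrthonormalBasis.coe_toBasis] at h4
  refine h4.trans ?_
  change _ • oneWedge (rinL v) (oneWedge (rinL u) (Ω - Ω')) (pairs b) = 0
  rw [h0, smul_zero]

end Root

section Copositive
variable {V : Type*} [NormedAddCommGroup V] [NormedSpace ℂ V]

/-- A real form of type `(k, k)` which is strictly positive on complex subspaces of dimension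
`k`. -/
structure IsCopositive {k : ℕ} (Ω : V [⋀^Fin (2 * k)]→L[ℝ] ℂ) : Prop where
  real : ∀ v, (Ω v).im = 0
  map_I : Ω.compContinuousLinearMap (mulI V) = Ω
  pos : ∀ v : Fin k → V, LinearIndependent ℂ v → 0 < (Ω (pairs v)).re

lemma IsPositiveForm.comp_mulI {w : V [⋀^Fin 2]→L[ℝ] ℂ} (hw : IsPositiveForm w) :
    w.compContinuousLinearMap (mulI V) = w := by
  ext v
  obtain ⟨x, y, rfl⟩ : ∃ x y, v = ![x, y] := ⟨v 0, v 1, by ext i; fin_cases i <;> rfl⟩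
  rw [← hw.type_one_one x y, ContinuousAlternatingMap.compContinuousLinearMap_apply]
  congr 1
  ext i
  fin_cases i <;> rfl

lemma IsPositiveForm.isCopositive {w : V [⋀^Fin 2]→L[ℝ] ℂ} (hw : IsPositiveForm w) (k : ℕ) :
    IsCopositive (wedgePow w k) where
  real := wedgePow_im w hw.im_eq_zero k
  map_I := by rw [← wedgePow_compContinuousLinearMap, hw.comp_mulI]
  pos _ hv := wedgePow_pairs_pos hw hv

lemma IsPositiveForm.smul {w : V [⋀^Fin 2]→L[ℝ] ℂ} (hw : IsPositiveForm w) {c : ℝ} (hc : 0 < c) :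
    IsPositiveForm (c • w) where
  real u v := by
    rw [ContinuousAlternatingMap.smul_apply, Complex.smul_im, hw.real, smul_zero]
  type_one_one u v := by
    rw [ContinuousAlternatingMap.smul_apply, ContinuousAlternatingMap.smul_apply, hw.type_one_one]
  pos v hv := by
    rw [ContinuousAlternatingMap.smul_apply, Complex.smul_re]
    exact mul_pos hc (hw.pos v hv)

lemma IsPositiveForm.comp {W : Type*} [NormedAddCommGroup W] [NormedSpace ℂ W]
    {w : V [⋀^Fin 2]→L[ℝ] ℂ} (hw : IsPositiveForm w) (L : W →L[ℂ] V)
    (hL : Function.Injective L) :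
    IsPositiveForm (w.compContinuousLinearMap (L.restrictScalars ℝ)) := by
  have h : ∀ u v, w.compContinuousLinearMap (L.restrictScalars ℝ) ![u, v] = w ![L u, L v] :=
    fun u v ↦ by
      rw [ContinuousAlternatingMap.compContinuousLinearMap_apply]
      congr 1
      ext i
      fin_cases i <;> rfl
  refine ⟨fun u v ↦ ?_, fun u v ↦ ?_, fun v hv ↦ ?_⟩
  · rw [h, hw.real]
  · rw [h, h, map_smul, map_smul, hw.type_one_one]
  · rw [h, map_smul]
    exact hw.pos _ ((map_ne_zero_iff L hL).2 hv)

lemma IsCopositive.comp {W : Type*} [NormedAddCommGroup W] [NormedSpace ℂ W] {k : ℕ}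
    {Ω : V [⋀^Fin (2 * k)]→L[ℝ] ℂ} (h : IsCopositive Ω) (L : W →L[ℂ] V)
    (hL : Function.Injective L) :
    IsCopositive (Ω.compContinuousLinearMap (L.restrictScalars ℝ)) where
  real v := h.real _
  map_I := by
    conv_rhs => rw [← h.map_I]
    ext v
    rw [ContinuousAlternatingMap.compContinuousLinearMap_apply,
      ContinuousAlternatingMap.compContinuousLinearMap_apply,
      ContinuousAlternatingMap.compContinuousLinearMap_apply,
      ContinuousAlternatingMap.compContinuousLinearMap_apply]
    congr 1
    ext i
    exact L.map_smul _ _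
  pos v hv := by
    have := h.pos (fun j ↦ L (v j)) (hv.map' L.toLinearMap (LinearMap.ker_eq_bot.2 hL))
    rw [ContinuousAlternatingMap.compContinuousLinearMap_apply]
    convert this using 3
    ext i
    exact map_pairs L v i

end Copositive

section Root
variable {V : Type*} [NormedAddCommGroup V] [InnerProductSpace ℂ V]

lemma coBilin_add {k : ℕ} (b : Fin (k + 1) → V) (Ω Ω' : V [⋀^Fin (2 * k)]→L[ℝ] ℂ) (u v : V) :
    coBilin b (Ω + Ω') u v = coBilin b Ω u v + coBilin b Ω' u v := by
  rw [coBilin_apply, oneWedge_add_right, oneWedge_add_right]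
  rfl

lemma coBilin_smul {k : ℕ} (b : Fin (k + 1) → V) (c : ℝ) (Ω : V [⋀^Fin (2 * k)]→L[ℝ] ℂ) (u v : V) :
    coBilin b (c • Ω) u v = c * coBilin b Ω u v := by
  rw [coBilin_apply, oneWedge_smul_right, oneWedge_smul_right,
    ContinuousAlternatingMap.smul_apply, Complex.smul_re]
  rfl

/-- `coOp` as a continuous linear map. -/
def coOpL {k : ℕ} (b : OrthonormalBasis (Fin (k + 1)) ℂ V) :
    (V [⋀^Fin (2 * k)]→L[ℝ] ℂ) →L[ℝ] V →L[ℝ] V :=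
  haveI : FiniteDimensional ℂ V := b.toBasis.finiteDimensional_of_finite
  LinearMap.toContinuousLinearMap
    { toFun := coOp b
      map_add' := fun Ω Ω' ↦ ContinuousLinearMap.ext fun u ↦ rin_ext fun v ↦ by
        rw [rin_coOp, coBilin_add, _root_.add_apply, rin_add_left, rin_coOp, rin_coOp]
      map_smul' := fun c Ω ↦ ContinuousLinearMap.ext fun u ↦ rin_ext fun v ↦ by
        rw [rin_coOp, coBilin_smul, RingHom.id_apply, _root_.smul_apply, rin_smul_left, rin_coOp] }

/-- `opForm` as a continuous linear map. -/
def opFormL (V : Type*) [NormedAddCommGroup V] [InnerProductSpace ℂ V] [FiniteDimensional ℂ V] :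
    (V →L[ℝ] V) →L[ℝ] V [⋀^Fin 2]→L[ℝ] ℂ :=
  LinearMap.toContinuousLinearMap
    { toFun := opForm
      map_add' := opForm_add
      map_smul' := opForm_smul }

lemma IsPosOp.isUnit [FiniteDimensional ℂ V] {T : V →L[ℝ] V} (hT : IsPosOp T) : IsUnit T := by
  have hinj : Function.Injective T.toLinearMap := by
    rw [← LinearMap.ker_eq_bot, LinearMap.ker_eq_bot']
    intro u hu
    by_contra hne
    have := hT.pos u hne
    rw [show T u = 0 from hu] at this
    simp [rin] at this
  let e := (LinearEquiv.ofInjectiveEndo T.toLinearMap hinj).toContinuousLinearEquiv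
  exact ⟨ContinuousLinearEquiv.toUnit e, by ext; rfl⟩

lemma IsPosOp.inverse [FiniteDimensional ℂ V] {T : V →L[ℝ] V} (hT : IsPosOp T) :
    IsPosOp (Ring.inverse T) := by
  have h1 : ∀ u, T (Ring.inverse T u) = u := fun u ↦
    congrArg (fun f : V →L[ℝ] V ↦ f u) (Ring.mul_inverse_cancel T hT.isUnit)
  have h2 : ∀ u, Ring.inverse T (T u) = u := fun u ↦
    congrArg (fun f : V →L[ℝ] V ↦ f u) (Ring.inverse_mul_cancel T hT.isUnit)
  refine ⟨fun u ↦ ?_, fun u v ↦ ?_, fun u hu ↦ ?_⟩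
  · conv_lhs => rw [← h1 u, ← hT.map_I, h2]
  · conv_lhs => rw [← h1 v, ← hT.symm, h1]
  · have hne : Ring.inverse T u ≠ 0 := fun h ↦ hu (by rw [← h1 u, h, map_zero])
    have := hT.pos _ hne
    rwa [h1, rin_comm] at this

/-- With `T` the operator of `Ω` and `S = T⁻¹`, the cofactor identity says that the power of the
form of `S` has operator `C T`. Forms of codegree two are determined by their operators. -/
lemma exists_wedgePow_inverse_coOp {k : ℕ} (b : OrthonormalBasis (Fin (k + 2)) ℂ V)
    {Ω : V [⋀^Fin (2 * (k + 1))]→L[ℝ] ℂ} (h : IsCopositive Ω) :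
    ∃ C : ℝ, 0 < C ∧ wedgePow (opForm (Ring.inverse (coOp b Ω))) (k + 1) = C • Ω := by
  have : FiniteDimensional ℂ V := b.toBasis.finiteDimensional_of_finite
  have hT := isPosOp_coOp b Ω h.map_I h.pos
  obtain ⟨C, hC, hC'⟩ := exists_coOp_wedgePow_opForm b hT.inverse
  refine ⟨C, hC, eq_of_coBilin_eq b (hT.inverse.isPositiveForm.isCopositive _).real
    (fun v ↦ by rw [ContinuousAlternatingMap.smul_apply, Complex.smul_im, h.real, smul_zero]) ?_⟩
  have h2 : ∀ u, Ring.inverse (coOp b Ω) (coOp b Ω u) = u := fun u ↦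
    congrArg (fun f : V →L[ℝ] V ↦ f u) (Ring.inverse_mul_cancel _ hT.isUnit)
  ext u v
  have h3 := hC' (coOp b Ω u)
  rw [h2] at h3
  have h4 := congrArg (fun x ↦ rin x (-(Complex.I • v))) h3
  simp only [rin_coOp, rin_smul_left] at h4
  rw [smul_neg, smul_smul, Complex.I_mul_I, neg_one_smul, neg_neg] at h4
  rw [h4, coBilin_smul]

lemma inverse_coOp_wedgePow {k : ℕ} (b : OrthonormalBasis (Fin (k + 2)) ℂ V)
    {S : V →L[ℝ] V} (hS : IsPosOp S) :
    ∃ C : ℝ, 0 < C ∧ Ring.inverse (coOp b (wedgePow (opForm S) (k + 1))) = C • S := by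
  have : FiniteDimensional ℂ V := b.toBasis.finiteDimensional_of_finite
  have h := hS.isPositiveForm.isCopositive (k + 1)
  have hT := isPosOp_coOp b _ h.map_I h.pos
  obtain ⟨C, hC, hC'⟩ := exists_coOp_wedgePow_opForm b hS
  refine ⟨C⁻¹, inv_pos.2 hC, ContinuousLinearMap.ext fun u ↦ ?_⟩
  set T := coOp b (wedgePow (opForm S) (k + 1))
  have h2 : ∀ u, Ring.inverse T (T u) = u := fun u ↦
    congrArg (fun f : V →L[ℝ] V ↦ f u) (Ring.inverse_mul_cancel _ hT.isUnit)
  have h3 := congrArg (fun x ↦ Ring.inverse T x) (hC' u)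
  rw [h2, (Ring.inverse T).map_smul] at h3
  rw [_root_.smul_apply, h3, smul_smul, inv_mul_cancel₀ hC.ne', one_smul]

/-- The `(k + 1)`-st root of a form of degree `2 k + 2` on a space of dimension `k + 2`. -/
def innerRoot {k : ℕ} (b : OrthonormalBasis (Fin (k + 2)) ℂ V)
    (Ω : V [⋀^Fin (2 * (k + 1))]→L[ℝ] ℂ) : V [⋀^Fin 2]→L[ℝ] ℂ :=
  ((Ω (pairs (Fin.tail b))).re /
    (wedgePow (opForm (Ring.inverse (coOp b Ω))) (k + 1) (pairs (Fin.tail b))).re) ^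
      ((k + 1 : ℝ)⁻¹) • opForm (Ring.inverse (coOp b Ω))

lemma OrthonormalBasis.linearIndependent_tail {k : ℕ} (b : OrthonormalBasis (Fin (k + 2)) ℂ V) :
    LinearIndependent ℂ (Fin.tail b) :=
  b.orthonormal.linearIndependent.comp Fin.succ (Fin.succ_injective _)

/-- Here the inverse operator is `C S` for some `C > 0`, so the quotient in the definition is `C⁻¹ ^
(k + 1)` and its root cancels `C`. One tuple suffices to read off the quotient since the two forms
are proportional. In particular roots are unique. -/
lemma innerRoot_wedgePow {k : ℕ} (b : OrthonormalBasis (Fin (k + 2)) ℂ V)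
    {w : V [⋀^Fin 2]→L[ℝ] ℂ} (hw : IsPositiveForm w) : innerRoot b (wedgePow w (k + 1)) = w := by
  obtain ⟨S, hS, rfl⟩ := hw.exists_isPosOp b
  obtain ⟨C, hC, hC'⟩ := inverse_coOp_wedgePow b hS
  have hpos := (hw.isCopositive (k + 1)).pos _ (OrthonormalBasis.linearIndependent_tail b)
  rw [innerRoot, hC', opForm_smul, wedgePow_smul, ContinuousAlternatingMap.smul_apply,
    Complex.smul_re, smul_eq_mul, smul_smul]
  set a := (wedgePow (opForm S) (k + 1) (pairs (Fin.tail b))).re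
  have h1 : a / (C ^ (k + 1) * a) = (C⁻¹) ^ (k + 1) := by
    rw [inv_pow]
    field_simp
  have h2 := Real.pow_rpow_inv_natCast (inv_pos.2 hC).le (Nat.succ_ne_zero k)
  rw [Nat.cast_succ] at h2
  rw [h1, h2, inv_mul_cancel₀ hC.ne', one_smul]

/-- Near a copositive form the operator stays invertible and the quotient stays nonzero, so the
formula is smooth in all directions of the space of forms, not only inside the cone. -/
lemma contDiffAt_innerRoot {k : ℕ} (b : OrthonormalBasis (Fin (k + 2)) ℂ V)
    {Ω : V [⋀^Fin (2 * (k + 1))]→L[ℝ] ℂ} (h : IsCopositive Ω) :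
    ContDiffAt ℝ ∞ (innerRoot b) Ω := by
  have : FiniteDimensional ℂ V := b.toBasis.finiteDimensional_of_finite
  have : CompleteSpace V := FiniteDimensional.complete ℂ V
  have hT := isPosOp_coOp b _ h.map_I h.pos
  have h1 : ContDiffAt ℝ ∞ (fun Ω ↦ Ring.inverse (coOp b Ω)) Ω := by
    have h0 : ContDiffAt ℝ ∞ Ring.inverse (coOp b Ω) := by
      obtain ⟨x, hx⟩ := hT.isUnit
      rw [← hx]
      exact contDiffAt_ringInverse ℝ x
    exact h0.comp Ω (coOpL b).contDiff.contDiffAt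
  have h2 : ContDiffAt ℝ ∞ (fun Ω ↦ opForm (Ring.inverse (coOp b Ω))) Ω :=
    (opFormL V).contDiff.contDiffAt.comp Ω h1
  have heval : ContDiff ℝ ∞ (fun a : V [⋀^Fin (2 * (k + 1))]→L[ℝ] ℂ ↦
      (a (pairs (Fin.tail b))).re) :=
    Complex.reCLM.contDiff.comp
      (ContinuousAlternatingMap.apply ℝ V ℂ (pairs (Fin.tail b))).contDiff
  have h3 : ContDiffAt ℝ ∞ (fun Ω ↦
      (wedgePow (opForm (Ring.inverse (coOp b Ω))) (k + 1) (pairs (Fin.tail b))).re) Ω :=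
    heval.contDiffAt.comp Ω ((contDiff_wedgePow (k + 1)).contDiffAt.comp Ω h2)
  have hind := OrthonormalBasis.linearIndependent_tail b
  have hp1 := h.pos _ hind
  have hp2 := (hT.inverse.isPositiveForm.isCopositive (k + 1)).pos _ hind
  exact ((heval.contDiffAt.div h3 hp2.ne').rpow_const_of_ne (div_pos hp1 hp2).ne').smul h2

lemma exists_wedgePow_eq {k : ℕ} (b : OrthonormalBasis (Fin (k + 2)) ℂ V)
    {Ω : V [⋀^Fin (2 * (k + 1))]→L[ℝ] ℂ} (h : IsCopositive Ω) :
    ∃ w, IsPositiveForm w ∧ wedgePow w (k + 1) = Ω := by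
  have : FiniteDimensional ℂ V := b.toBasis.finiteDimensional_of_finite
  have hT := isPosOp_coOp b _ h.map_I h.pos
  obtain ⟨C, hC, hC'⟩ := exists_wedgePow_inverse_coOp b h
  refine ⟨(C⁻¹) ^ ((k + 1 : ℝ)⁻¹) • opForm (Ring.inverse (coOp b Ω)),
    hT.inverse.isPositiveForm.smul (by positivity), ?_⟩
  have h2 := Real.rpow_inv_natCast_pow (inv_pos.2 hC).le (Nat.succ_ne_zero k)
  rw [Nat.cast_succ] at h2
  rw [wedgePow_smul, h2, hC', smul_smul, inv_mul_cancel₀ hC.ne', one_smul]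

end Root

/-- A linear isomorphism with Euclidean space supplies the Hermitian structure. `Φ` depends on this
choice, but by the first and third clauses its values on copositive forms do not. -/
theorem exists_root {F : Type*} [NormedAddCommGroup F] [NormedSpace ℂ F] [FiniteDimensional ℂ F]
    {k : ℕ} (hk : Module.finrank ℂ F = k + 2) :
    ∃ Φ : (F [⋀^Fin (2 * (k + 1))]→L[ℝ] ℂ) → F [⋀^Fin 2]→L[ℝ] ℂ,
      (∀ w, IsPositiveForm w → Φ (wedgePow w (k + 1)) = w) ∧
      (∀ Ω, IsCopositive Ω → ContDiffAt ℝ ∞ Φ Ω) ∧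
      ∀ Ω : F [⋀^Fin (2 * (k + 1))]→L[ℝ] ℂ, IsCopositive Ω →
        ∃ w, IsPositiveForm w ∧ wedgePow w (k + 1) = Ω := by
  let L : F ≃L[ℂ] EuclideanSpace ℂ (Fin (k + 2)) :=
    ContinuousLinearEquiv.ofFinrankEq (by rw [hk, finrank_euclideanSpace_fin])
  let b := EuclideanSpace.basisFun (Fin (k + 2)) ℂ
  let A := (L : F →L[ℂ] EuclideanSpace ℂ (Fin (k + 2))).restrictScalars ℝ
  let A' := (L.symm : EuclideanSpace ℂ (Fin (k + 2)) →L[ℂ] F).restrictScalars ℝ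
  have h1 : ∀ {m : ℕ} (a : F [⋀^Fin m]→L[ℝ] ℂ),
      (a.compContinuousLinearMap A').compContinuousLinearMap A = a := fun a ↦ by
    ext v
    simp [A, A', Function.comp_def]
  refine ⟨fun Ω ↦ (innerRoot b (Ω.compContinuousLinearMap A')).compContinuousLinearMap A,
    fun w hw ↦ ?_, fun Ω hΩ ↦ ?_, fun Ω hΩ ↦ ?_⟩
  · beta_reduce
    rw [← wedgePow_compContinuousLinearMap, innerRoot_wedgePow b (hw.comp _ L.symm.injective), h1]
  · exact (ContinuousAlternatingMap.compContinuousLinearMapCLM A).contDiff.contDiffAt.comp Ω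
      ((contDiffAt_innerRoot b (hΩ.comp _ L.symm.injective)).comp Ω
        (ContinuousAlternatingMap.compContinuousLinearMapCLM A').contDiff.contDiffAt)
  · obtain ⟨w, hw, hw'⟩ := exists_wedgePow_eq b (hΩ.comp (L.symm : _ →L[ℂ] F) L.symm.injective)
    refine ⟨w.compContinuousLinearMap A, hw.comp _ L.injective, ?_⟩
    rw [wedgePow_compContinuousLinearMap, hw']
    exact h1 Ω

/-! ### The operators ∂ and ∂̄ in coordinates -/

section FlatCalculus
variable {E E' : Type*} [NormedAddCommGroup E] [NormedSpace ℂ E]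
  [NormedAddCommGroup E'] [NormedSpace ℂ E']

/-- The operator `½ (D + c D ∘ i)`, alternatised; it is `∂` for `c = - i` and `∂̄` for `c = i`. -/
def flatD (c : ℂ) {k : ℕ} (a : E → E [⋀^Fin k]→L[ℝ] ℂ) (y : E) : E [⋀^Fin (k + 1)]→L[ℝ] ℂ :=
  .alternatizeUncurryFin ((1 / 2 : ℂ) • (fderiv ℝ a y + c • (fderiv ℝ a y).comp (mulI E)))

lemma flatDel_eq {k : ℕ} (a : E → E [⋀^Fin k]→L[ℝ] ℂ) : flatDel a = flatD (-Complex.I) a := by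
  ext1 y
  rw [flatDel, flatD, linearPart]
  congr 1
  ext u v
  change (1 / 2 : ℂ) * (fderiv ℝ a y u v - Complex.I * fderiv ℝ a y (mulI E u) v) =
    1 / 2 * (fderiv ℝ a y u v + -Complex.I * fderiv ℝ a y (mulI E u) v)
  ring

/-- The operator on linear maps underlying `flatD`. -/
def symbolD (E : Type*) [NormedAddCommGroup E] [NormedSpace ℂ E] (c : ℂ) (k : ℕ) :
    (E →L[ℝ] E [⋀^Fin k]→L[ℝ] ℂ) →ₗ[ℝ] E [⋀^Fin (k + 1)]→L[ℝ] ℂ where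
  toFun L := .alternatizeUncurryFin ((1 / 2 : ℂ) • (L + c • L.comp (mulI E)))
  map_add' L L' := by
    rw [← ContinuousAlternatingMap.alternatizeUncurryFin_add]
    congr 1
    ext u v
    change (1 / 2 : ℂ) * (L u v + L' u v + c * (L (mulI E u) v + L' (mulI E u) v)) =
      1 / 2 * (L u v + c * L (mulI E u) v) + 1 / 2 * (L' u v + c * L' (mulI E u) v)
    ring
  map_smul' r L := by
    rw [RingHom.id_apply, ← ContinuousAlternatingMap.alternatizeUncurryFin_smul]
    congr 1
    ext u v
    change (1 / 2 : ℂ) * (r • L u v + c * r • L (mulI E u) v) =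
      r • (1 / 2 * (L u v + c * L (mulI E u) v))
    simp only [Complex.real_smul]
    ring

lemma flatD_eq_symbolD (c : ℂ) {k : ℕ} (a : E → E [⋀^Fin k]→L[ℝ] ℂ) (y : E) :
    flatD c a y = symbolD E c k (fderiv ℝ a y) := rfl

lemma symbolD_apply (c : ℂ) {k : ℕ} (L : E →L[ℝ] E [⋀^Fin k]→L[ℝ] ℂ) (v : Fin (k + 1) → E) :
    symbolD E c k L v = ∑ i : Fin (k + 1), (-1) ^ (i : ℕ) *
      (1 / 2 * (L (v i) (i.removeNth v) + c * L (Complex.I • v i) (i.removeNth v))) := by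
  change ContinuousAlternatingMap.alternatizeUncurryFin _ v = _
  rw [ContinuousAlternatingMap.alternatizeUncurryFin_apply]
  refine Finset.sum_congr rfl fun i _ ↦ ?_
  rw [zsmul_eq_mul]
  push_cast
  rfl

lemma symbolD_comp (c : ℂ) {k : ℕ} (L : E →L[ℝ] E [⋀^Fin k]→L[ℝ] ℂ) (A : E' →L[ℂ] E) :
    symbolD E' c k ((ContinuousAlternatingMap.compContinuousLinearMapCLM
      (A.restrictScalars ℝ)).comp (L.comp (A.restrictScalars ℝ))) =
      (symbolD E c k L).compContinuousLinearMap (A.restrictScalars ℝ) := by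
  ext v
  rw [ContinuousAlternatingMap.compContinuousLinearMap_apply, symbolD_apply, symbolD_apply]
  refine Finset.sum_congr rfl fun i _ ↦ ?_
  have h : A (Complex.I • v i) = Complex.I • A (v i) := A.map_smul _ _
  change _ * (1 / 2 * (L (A (v i)) _ + c * L (A (Complex.I • v i)) _)) = _
  rw [h]
  rfl

/-- `h` stands for the second derivative of a holomorphic map: it is symmetric and `i` may be moved
between its arguments, so `h` composed with `i` is symmetric as well. Both halves of the operator
then alternate to zero. -/
lemma symbolD_fderivComp (c : ℂ) {k : ℕ} (a : E [⋀^Fin k]→L[ℝ] ℂ) (A : E' →L[ℝ] E)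
    (h : E' →L[ℝ] E' →L[ℝ] E) (hsymm : ∀ u v, h u v = h v u)
    (hI : ∀ u v, h (Complex.I • u) v = h u (Complex.I • v)) :
    symbolD E' c k ((a.fderivCompContinuousLinearMap A).comp h) = 0 := by
  have h1 := ContinuousAlternatingMap.alternatizeUncurryFin_fderivCompContinuousLinearMap_eq_zero
    a A hsymm
  have h2 := ContinuousAlternatingMap.alternatizeUncurryFin_fderivCompContinuousLinearMap_eq_zero
    a A (h := h.comp (mulI E')) fun u v ↦ by
      change h (Complex.I • u) v = h (Complex.I • v) u
      rw [hI, hsymm]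
  ext v
  have e1 := congrArg (fun b ↦ b v) h1
  have e2 := congrArg (fun b ↦ b v) h2
  simp only [ContinuousAlternatingMap.alternatizeUncurryFin_apply, zsmul_eq_mul] at e1 e2
  push_cast at e1 e2
  rw [symbolD_apply]
  change _ = (0 : ℂ) at e1 e2 ⊢
  refine Eq.trans ?_ ((congrArg₂ (fun x y : ℂ ↦ 1 / 2 * (x + c * y)) e1 e2).trans (by simp))
  rw [Finset.mul_sum, ← Finset.sum_add_distrib, Finset.mul_sum]
  refine Finset.sum_congr rfl fun i _ ↦ ?_
  change _ * (1 / 2 * (a.fderivCompContinuousLinearMap A (h (v i)) _ + c *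
    a.fderivCompContinuousLinearMap A (h (Complex.I • v i)) _)) = 1 / 2 * (_ *
    a.fderivCompContinuousLinearMap A (h (v i)) _ + c * (_ *
    a.fderivCompContinuousLinearMap A (h (Complex.I • v i)) _))
  ring

lemma flatD_congr (c : ℂ) {k : ℕ} {a b : E → E [⋀^Fin k]→L[ℝ] ℂ} {x : E} (h : a =ᶠ[𝓝 x] b) :
    flatD c a x = flatD c b x := by
  rw [flatD_eq_symbolD, flatD_eq_symbolD, h.fderiv_eq]

/-- Differentiating the pullback gives a term with the derivative of `a`, which transforms correctly
because `fderiv ℂ φ x` commutes with `i`, and a term with the second derivative of `φ`, which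
alternates to zero. -/
theorem flatD_pullback (c : ℂ) {k : ℕ} {a : E → E [⋀^Fin k]→L[ℝ] ℂ} {φ : E' → E} {x : E'}
    (ha : DifferentiableAt ℝ a (φ x)) (hφ : ContDiffAt ℂ ω φ x) :
    flatD c (fun y ↦ (a (φ y)).compContinuousLinearMap ((fderiv ℂ φ y).restrictScalars ℝ)) x =
      (flatD c a (φ x)).compContinuousLinearMap ((fderiv ℂ φ x).restrictScalars ℝ) := by
  have h1 : HasFDerivAt φ ((fderiv ℂ φ x).restrictScalars ℝ) x :=
    (hφ.differentiableAt (by simp)).hasFDerivAt.restrictScalars ℝ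
  have h2 : HasFDerivAt (fderiv ℂ φ) (fderiv ℂ (fderiv ℂ φ) x) x :=
    ((hφ.fderiv_right (m := 1) le_top).differentiableAt one_ne_zero).hasFDerivAt
  have hsymm : IsSymmSndFDerivAt ℂ φ x := hφ.isSymmSndFDerivAt (by simp)
  have h3 : HasFDerivAt (fun y ↦ (fderiv ℂ φ y).restrictScalars ℝ)
      ((ContinuousLinearMap.restrictScalarsL ℂ E' E ℝ ℝ).comp
        ((fderiv ℂ (fderiv ℂ φ) x).restrictScalars ℝ)) x :=
    (ContinuousLinearMap.restrictScalarsL ℂ E' E ℝ ℝ).hasFDerivAt.comp x (h2.restrictScalars ℝ)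
  have h4 := (ha.hasFDerivAt.comp x h1).continuousAlternatingMapCompContinuousLinearMap h3
  rw [flatD_eq_symbolD, flatD_eq_symbolD]
  have h5 : fderiv ℝ (fun y ↦ (a (φ y)).compContinuousLinearMap
    ((fderiv ℂ φ y).restrictScalars ℝ)) x = _ := h4.fderiv
  rw [h5, map_add, symbolD_comp, symbolD_fderivComp, add_zero]
  · exact fun u v ↦ hsymm u v
  · intro u v
    change fderiv ℂ (fderiv ℂ φ) x (Complex.I • u) v = fderiv ℂ (fderiv ℂ φ) x u (Complex.I • v)
    rw [map_smul, map_smul]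
    rfl

end FlatCalculus

section Smoothness
variable {E : Type*} [NormedAddCommGroup E] [NormedSpace ℝ E]
  {W : Type*} [NormedAddCommGroup W] [NormedSpace ℝ W]
  {V : Type*} [NormedAddCommGroup V] [NormedSpace ℝ V]

lemma contDiffAt_alternating_iff [FiniteDimensional ℝ V] {k : ℕ} {f : E → V [⋀^Fin k]→L[ℝ] ℂ} {x : E} {n : WithTop ℕ∞} :
    ContDiffAt ℝ n f x ↔ ∀ v, ContDiffAt ℝ n (fun y ↦ f y v) x := by
  refine ⟨fun h v ↦ (ContinuousAlternatingMap.apply ℝ V ℂ v).contDiff.contDiffAt.comp x h,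
    fun h ↦ ?_⟩
  let B := Module.finBasis ℝ V
  let T : (V [⋀^Fin k]→L[ℝ] ℂ) →ₗ[ℝ] (Fin k → Fin (Module.finrank ℝ V)) → ℂ :=
    LinearMap.pi fun s ↦ (ContinuousAlternatingMap.apply ℝ V ℂ (fun i ↦ B (s i))).toLinearMap
  have hT : LinearMap.ker T = ⊥ := by
    rw [LinearMap.ker_eq_bot']
    intro a ha
    have : a.toMultilinearMap = 0 :=
      Module.Basis.ext_multilinear (fun _ ↦ B) fun s ↦ congrFun ha s
    ext v
    exact congrArg (fun b ↦ b v) this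
  obtain ⟨L, hL⟩ := T.exists_leftInverse_of_injective hT
  have h1 : f = fun y ↦ LinearMap.toContinuousLinearMap L (fun s ↦ f y (fun i ↦ B (s i))) := by
    ext1 y
    exact (LinearMap.congr_fun hL (f y)).symm
  rw [h1]
  exact (LinearMap.toContinuousLinearMap L).contDiff.contDiffAt.comp x
    (contDiffAt_pi.2 fun s ↦ h _)

lemma ContDiffAt.compContinuousLinearMap_alternating [FiniteDimensional ℝ W] {k : ℕ}
    {a : E → V [⋀^Fin k]→L[ℝ] ℂ}
    {A : E → W →L[ℝ] V} {x : E} {n : WithTop ℕ∞} (ha : ContDiffAt ℝ n a x)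
    (hA : ContDiffAt ℝ n A x) :
    ContDiffAt ℝ n (fun y ↦ (a y).compContinuousLinearMap (A y)) x := by
  rw [contDiffAt_alternating_iff]
  intro v
  have h1 : ContDiffAt ℝ n (fun y ↦
      ContinuousMultilinearMap.compContinuousLinearMapContinuousMultilinear ℝ
        (fun _ : Fin k ↦ W) (fun _ ↦ V) ℂ (fun _ ↦ A y)) x :=
    ContDiffAt.comp x (ContinuousMultilinearMap.contDiff _).contDiffAt
      (contDiffAt_pi.2 fun _ ↦ hA)
  have h2 : ContDiffAt ℝ n (fun y ↦ ContinuousAlternatingMap.toContinuousMultilinearMapCLM ℝ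
      (a y)) x := (ContinuousLinearMap.contDiff _).contDiffAt.comp x ha
  exact (ContinuousMultilinearMap.apply ℝ (fun _ : Fin k ↦ W) ℂ v).contDiff.contDiffAt.comp x
    (h1.clm_apply h2)

end Smoothness

section FlatCalculus
variable {E E' : Type*} [NormedAddCommGroup E] [NormedSpace ℂ E]
  [NormedAddCommGroup E'] [NormedSpace ℂ E'] [FiniteDimensional ℂ E']

lemma contDiffAt_pullback {k : ℕ} {a : E → E [⋀^Fin k]→L[ℝ] ℂ} {φ : E' → E} {x : E'}
    (ha : ContDiffAt ℝ ∞ a (φ x)) (hφ : ContDiffAt ℂ ω φ x) :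
    ContDiffAt ℝ ∞
      (fun y ↦ (a (φ y)).compContinuousLinearMap ((fderiv ℂ φ y).restrictScalars ℝ)) x := by
  have h1 : ContDiffAt ℝ ∞ φ x := (hφ.restrict_scalars ℝ).of_le le_top
  have h2 : ContDiffAt ℂ ω (fderiv ℂ φ) x := hφ.fderiv_right (m := ω) le_top
  exact ContDiffAt.compContinuousLinearMap_alternating (ha.comp x h1)
    ((ContinuousLinearMap.restrictScalarsL ℂ E' E ℝ ℝ).contDiff.contDiffAt.comp x
      ((h2.restrict_scalars ℝ).of_le le_top))

lemma contDiffAt_flatD [FiniteDimensional ℂ E] (c : ℂ) {k : ℕ} {a : E → E [⋀^Fin k]→L[ℝ] ℂ} {x : E}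
    (ha : ContDiffAt ℝ ∞ a x) : ContDiffAt ℝ ∞ (flatD c a) x := by
  have h : flatD c a = LinearMap.toContinuousLinearMap (symbolD E c k) ∘ fderiv ℝ a := rfl
  rw [h]
  exact (ContinuousLinearMap.contDiff _).contDiffAt.comp x (ha.fderiv_right (m := ∞) le_rfl)

end FlatCalculus

/-! ### Forms on complex manifolds -/

section Forms
variable {E : Type*} [NormedAddCommGroup E] [NormedSpace ℂ E]
  {E' : Type*} [NormedAddCommGroup E'] [NormedSpace ℂ E']
  {E'' : Type*} [NormedAddCommGroup E''] [NormedSpace ℂ E'']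
  {M : Type*} [TopologicalSpace M] [ChartedSpace E M]
  {X : Type*} [TopologicalSpace X] [ChartedSpace E' X]
  {Y : Type*} [TopologicalSpace Y] [ChartedSpace E'' Y]

/-- Forms on a manifold, with the tangent spaces identified with the model space. -/
abbrev Form (E : Type*) [NormedAddCommGroup E] [NormedSpace ℂ E] (M : Type*) (k : ℕ) : Type _ :=
  M → E [⋀^Fin k]→L[ℝ] ℂ

/-- The derivative of a map of manifolds, with the tangent spaces identified with the models. -/
def tderiv (E' E : Type*) [NormedAddCommGroup E] [NormedSpace ℂ E] [NormedAddCommGroup E']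
    [NormedSpace ℂ E'] {M : Type*} [TopologicalSpace M] [ChartedSpace E M]
    {X : Type*} [TopologicalSpace X] [ChartedSpace E' X] (ψ : X → M) (x : X) : E' →L[ℂ] E :=
  mfderiv 𝓘(ℂ, E') 𝓘(ℂ, E) ψ x

lemma tderiv_congr {ψ ψ' : X → M} {x : X} (h : ψ =ᶠ[𝓝 x] ψ') :
    tderiv E' E ψ x = tderiv E' E ψ' x := h.mfderiv_eq

lemma tderiv_comp {ψ : X → M} {φ : Y → X} (y : Y)
    (hψ : MDifferentiableAt 𝓘(ℂ, E') 𝓘(ℂ, E) ψ (φ y))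
    (hφ : MDifferentiableAt 𝓘(ℂ, E'') 𝓘(ℂ, E') φ y) :
    tderiv E'' E (ψ ∘ φ) y = (tderiv E' E ψ (φ y)).comp (tderiv E'' E' φ y) :=
  mfderiv_comp y hψ hφ

lemma tderiv_flat (φ : E' → E) (y : E') : tderiv E' E φ y = fderiv ℂ φ y := mfderiv_eq_fderiv

lemma tderiv_id (x : M) : tderiv E E (id : M → M) x = ContinuousLinearMap.id ℂ E := mfderiv_id

/-- The pullback of a form. -/
def pull (E' : Type*) [NormedAddCommGroup E'] [NormedSpace ℂ E'] {X : Type*} [TopologicalSpace X]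
    [ChartedSpace E' X] (ψ : X → M) {k : ℕ} (a : Form E M k) : Form E' X k := fun x ↦
  (a (ψ x)).compContinuousLinearMap ((tderiv E' E ψ x).restrictScalars ℝ)

/-- The coordinate expression of a form in the preferred chart at a point. -/
def coord {k : ℕ} (a : Form E M k) (x : M) : Form E E k := pull E (extChartAt 𝓘(ℂ, E) x).symm a

/-- The operators `∂` (for `c = - i`) and `∂̄` (for `c = i`) on a manifold. -/
def dc (c : ℂ) {k : ℕ} (a : Form E M k) : Form E M (k + 1) := fun x ↦
  (flatD c (coord a x) (extChartAt 𝓘(ℂ, E) x x)).compContinuousLinearMap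
    ((tderiv E E (extChartAt 𝓘(ℂ, E) x) x).restrictScalars ℝ)

/-- Smoothness of a form near a point. -/
def SmoothAt {k : ℕ} (a : Form E M k) (x : M) : Prop :=
  ContDiffAt ℝ ∞ (coord a x) (extChartAt 𝓘(ℂ, E) x x)

lemma pull_apply {ψ : X → M} {k : ℕ} (a : Form E M k) (x : X) :
    pull E' ψ a x = (a (ψ x)).compContinuousLinearMap ((tderiv E' E ψ x).restrictScalars ℝ) := rfl

lemma pull_apply_congr {ψ ψ' : X → M} {k : ℕ} (a : Form E M k) {x : X}
    (h : ψ =ᶠ[𝓝 x] ψ') : pull E' ψ a x = pull E' ψ' a x := by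
  rw [pull_apply, pull_apply, tderiv_congr h, h.eq_of_nhds]

lemma pull_comp_apply {ψ : X → M} {φ : Y → X} {k : ℕ} (a : Form E M k) {y : Y}
    (hψ : MDifferentiableAt 𝓘(ℂ, E') 𝓘(ℂ, E) ψ (φ y))
    (hφ : MDifferentiableAt 𝓘(ℂ, E'') 𝓘(ℂ, E') φ y) :
    pull E'' (ψ ∘ φ) a y = pull E'' φ (pull E' ψ a) y := by
  rw [pull_apply, tderiv_comp y hψ hφ]
  rfl

lemma pull_form_congr {ψ : X → M} {k : ℕ} {a b : Form E M k} {x : X}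
    (h : a (ψ x) = b (ψ x)) : pull E' ψ a x = pull E' ψ b x := by
  rw [pull_apply, pull_apply, h]

lemma pull_eq_self {k : ℕ} (a : Form E M k) {ψ : M → M} {x : M}
    (h : ψ =ᶠ[𝓝 x] id) : pull E ψ a x = a x := by
  rw [pull_apply_congr a h, pull_apply, tderiv_id]
  rfl

lemma pull_flat {k : ℕ} (φ : E' → E) (a : Form E E k) (y : E') :
    pull E' φ a y = (a (φ y)).compContinuousLinearMap ((fderiv ℂ φ y).restrictScalars ℝ) := by
  rw [pull_apply, tderiv_flat]

lemma coord_flat {k : ℕ} (a : Form E E k) (x : E) : coord a x = a := by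
  funext y
  rw [coord]
  simp only [mfld_simps]
  exact pull_eq_self a Filter.EventuallyEq.rfl

lemma dc_flat (c : ℂ) {k : ℕ} (a : Form E E k) : dc c a = flatD c a := by
  funext x
  rw [dc, coord_flat]
  exact pull_eq_self (flatD c a) (ψ := extChartAt 𝓘(ℂ, E) x) (by simp; rfl)

lemma smoothAt_flat {k : ℕ} (a : Form E E k) (x : E) : SmoothAt a x ↔ ContDiffAt ℝ ∞ a x := by
  rw [SmoothAt, coord_flat]
  rfl

lemma chart_expression_apply (ψ : X → M) (x : X) :
    (extChartAt 𝓘(ℂ, E) (ψ x) ∘ ψ ∘ (extChartAt 𝓘(ℂ, E') x).symm) (extChartAt 𝓘(ℂ, E') x x) =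
      extChartAt 𝓘(ℂ, E) (ψ x) (ψ x) := by
  simp only [Function.comp_apply, extChartAt_to_inv]

lemma contDiffAt_chart_expression {ψ : X → M} {x : X}
    (hψ : ContMDiffAt 𝓘(ℂ, E') 𝓘(ℂ, E) ω ψ x) :
    ContDiffAt ℂ ω (extChartAt 𝓘(ℂ, E) (ψ x) ∘ ψ ∘ (extChartAt 𝓘(ℂ, E') x).symm)
      (extChartAt 𝓘(ℂ, E') x x) := by
  have := (contMDiffAt_iff.1 hψ).2
  rwa [modelWithCornersSelf_coe, Set.range_id, contDiffWithinAt_univ] at this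

lemma coord_add {k : ℕ} (a b : Form E M k) (x : M) : coord (a + b) x = coord a x + coord b x := rfl

lemma coord_congr {k : ℕ} {a b : Form E M k} {x : M} (h : a =ᶠ[𝓝 x] b) :
    coord a x =ᶠ[𝓝 (extChartAt 𝓘(ℂ, E) x x)] coord b x := by
  have ht := (continuousAt_extChartAt_symm (I := 𝓘(ℂ, E)) x).tendsto
  rw [extChartAt_to_inv] at ht
  filter_upwards [ht.eventually h] with y hy
  exact pull_form_congr hy

lemma SmoothAt.congr {k : ℕ} {a b : Form E M k} {x : M} (ha : SmoothAt a x) (h : b =ᶠ[𝓝 x] a) :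
    SmoothAt b x :=
  ContDiffAt.congr_of_eventuallyEq ha (coord_congr h)

lemma dc_congr (c : ℂ) {k : ℕ} {a b : Form E M k} {x : M} (h : a =ᶠ[𝓝 x] b) :
    dc c a x = dc c b x := by
  rw [dc, dc, flatD_congr c (coord_congr h)]

lemma SmoothAt.add {k : ℕ} {a b : Form E M k} {x : M} (ha : SmoothAt a x) (hb : SmoothAt b x) :
    SmoothAt (a + b) x :=
  ContDiffAt.add ha hb

lemma dc_add (c : ℂ) {k : ℕ} {a b : Form E M k} {x : M} (ha : SmoothAt a x) (hb : SmoothAt b x) :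
    dc c (a + b) x = dc c a x + dc c b x := by
  rw [dc, coord_add, flatD_eq_symbolD, fderiv_add (ContDiffAt.differentiableAt ha (by simp))
    (ContDiffAt.differentiableAt hb (by simp)), map_add]
  rfl

lemma smoothAt_zero {k : ℕ} (x : M) : SmoothAt (0 : Form E M k) x := by
  have h : coord (0 : Form E M k) x = fun _ ↦ 0 := rfl
  rw [SmoothAt, h]
  exact contDiffAt_const

lemma dc_zero (c : ℂ) {k : ℕ} (x : M) : dc c (0 : Form E M k) x = 0 := by
  have h : coord (0 : Form E M k) x = fun _ ↦ 0 := rfl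
  rw [dc, h, flatD_eq_symbolD]
  simp only [fderiv_fun_const, Pi.zero_apply, map_zero]
  rfl

lemma SmoothAt.sum {ι : Type*} (s : Finset ι) {k : ℕ} {a : ι → Form E M k} {x : M}
    (ha : ∀ i ∈ s, SmoothAt (a i) x) : SmoothAt (∑ i ∈ s, a i) x := by
  classical
  induction s using Finset.induction_on with
  | empty => exact smoothAt_zero x
  | insert i s hi ih =>
    rw [Finset.sum_insert hi]
    exact (ha i (Finset.mem_insert_self i s)).add
      (ih fun j hj ↦ ha j (Finset.mem_insert_of_mem hj))

lemma dc_sum (c : ℂ) {ι : Type*} (s : Finset ι) {k : ℕ} {a : ι → Form E M k} {x : M}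
    (ha : ∀ i ∈ s, SmoothAt (a i) x) : dc c (∑ i ∈ s, a i) x = ∑ i ∈ s, dc c (a i) x := by
  classical
  induction s using Finset.induction_on with
  | empty => exact dc_zero c x
  | insert i s hi ih =>
    have h := fun j hj ↦ ha j (Finset.mem_insert_of_mem hj)
    rw [Finset.sum_insert hi, Finset.sum_insert hi,
      dc_add c (ha i (Finset.mem_insert_self i s)) (SmoothAt.sum s h), ih h]

variable [IsManifold 𝓘(ℂ, E) ω M] [IsManifold 𝓘(ℂ, E') ω X]

lemma contMDiffAt_extChartAt_symm {x : M} {y : E} (hy : y ∈ (extChartAt 𝓘(ℂ, E) x).target) :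
    ContMDiffAt 𝓘(ℂ, E) 𝓘(ℂ, E) ω (extChartAt 𝓘(ℂ, E) x).symm y :=
  (contMDiffOn_extChartAt_symm x).contMDiffAt ((isOpen_extChartAt_target x).mem_nhds hy)

lemma coord_pull_eventuallyEq {ψ : X → M} {k : ℕ} (a : Form E M k) {x : X}
    (hψ : ContMDiffAt 𝓘(ℂ, E') 𝓘(ℂ, E) ω ψ x) :
    coord (pull E' ψ a) x =ᶠ[𝓝 (extChartAt 𝓘(ℂ, E') x x)] fun y ↦
      (coord a (ψ x)
        ((extChartAt 𝓘(ℂ, E) (ψ x) ∘ ψ ∘ (extChartAt 𝓘(ℂ, E') x).symm) y)).compContinuousLinearMap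
        ((fderiv ℂ (extChartAt 𝓘(ℂ, E) (ψ x) ∘ ψ ∘ (extChartAt 𝓘(ℂ, E') x).symm)
          y).restrictScalars ℝ) := by
  have hc : ContinuousAt (extChartAt 𝓘(ℂ, E') x).symm (extChartAt 𝓘(ℂ, E') x x) :=
    continuousAt_extChartAt_symm x
  have ht : Filter.Tendsto (extChartAt 𝓘(ℂ, E') x).symm (𝓝 (extChartAt 𝓘(ℂ, E') x x)) (𝓝 x) := by
    have := hc.tendsto
    rwa [extChartAt_to_inv] at this
  have h1 : ∀ᶠ z in 𝓝 x, ContMDiffAt 𝓘(ℂ, E') 𝓘(ℂ, E) ω ψ z ∧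
      ψ z ∈ (extChartAt 𝓘(ℂ, E) (ψ x)).source :=
    (contMDiffAt_iff_contMDiffAt_nhds (by simp) |>.1 hψ).and (hψ.continuousAt.eventually
      (extChartAt_source_mem_nhds (I := 𝓘(ℂ, E)) (ψ x)))
  filter_upwards [(ht.eventually h1).eventually_nhds, extChartAt_target_mem_nhds x] with y hy hyt
  have hs := contMDiffAt_extChartAt_symm hyt
  have hy0 := hy.self_of_nhds
  have hψy := hy0.1.mdifferentiableAt (by simp)
  have hsy := hs.mdifferentiableAt (by simp)
  have h2 : MDifferentiableAt 𝓘(ℂ, E) 𝓘(ℂ, E) (extChartAt 𝓘(ℂ, E) (ψ x))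
      (ψ ((extChartAt 𝓘(ℂ, E') x).symm y)) :=
    mdifferentiableAt_extChartAt (by simpa using hy0.2)
  have h3 : MDifferentiableAt 𝓘(ℂ, E) 𝓘(ℂ, E) (extChartAt 𝓘(ℂ, E) (ψ x)).symm
      (extChartAt 𝓘(ℂ, E) (ψ x) (ψ ((extChartAt 𝓘(ℂ, E') x).symm y))) :=
    (contMDiffAt_extChartAt_symm ((extChartAt 𝓘(ℂ, E) (ψ x)).map_source hy0.2)).mdifferentiableAt
      (by simp)
  have h4 : (ψ ∘ (extChartAt 𝓘(ℂ, E') x).symm) =ᶠ[𝓝 y] (extChartAt 𝓘(ℂ, E) (ψ x)).symm ∘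
      (extChartAt 𝓘(ℂ, E) (ψ x) ∘ ψ ∘ (extChartAt 𝓘(ℂ, E') x).symm) :=
    hy.mono fun z hz ↦ ((extChartAt 𝓘(ℂ, E) (ψ x)).left_inv hz.2).symm
  rw [coord, ← pull_comp_apply a hψy hsy, pull_apply_congr a h4,
    pull_comp_apply (X := E) (φ := extChartAt 𝓘(ℂ, E) (ψ x) ∘ ψ ∘ (extChartAt 𝓘(ℂ, E') x).symm) a h3
    (h2.comp y (hψy.comp y hsy)), pull_flat]
  rfl

/-- In the preferred charts at `x` and `ψ x` this is `flatD_pullback` for the chart expression of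
`ψ`. Applied to inverse charts, it shows that operators defined pointwise by varying charts can be
computed in a single one. -/
theorem dc_pull (c : ℂ) {ψ : X → M} {k : ℕ} {a : Form E M k} {x : X}
    (ha : SmoothAt a (ψ x)) (hψ : ContMDiffAt 𝓘(ℂ, E') 𝓘(ℂ, E) ω ψ x) :
    dc c (pull E' ψ a) x = pull E' ψ (dc c a) x := by
  have h1 := contDiffAt_chart_expression hψ
  have ha' : DifferentiableAt ℝ (coord a (ψ x))
    ((extChartAt 𝓘(ℂ, E) (ψ x) ∘ ψ ∘ (extChartAt 𝓘(ℂ, E') x).symm) (extChartAt 𝓘(ℂ, E') x x)) := by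
    rw [chart_expression_apply]
    exact ContDiffAt.differentiableAt ha (by simp)
  have h2 : MDifferentiableAt 𝓘(ℂ, E) 𝓘(ℂ, E) (extChartAt 𝓘(ℂ, E) (ψ x)) (ψ x) :=
    mdifferentiableAt_extChartAt (mem_chart_source _ _)
  have h3 : MDifferentiableAt 𝓘(ℂ, E') 𝓘(ℂ, E') (extChartAt 𝓘(ℂ, E') x) x :=
    mdifferentiableAt_extChartAt (mem_chart_source _ _)
  rw [dc, flatD_congr c (coord_pull_eventuallyEq a hψ), flatD_pullback c ha' h1,
    chart_expression_apply, pull_apply, dc]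
  ext v
  simp only [ContinuousAlternatingMap.compContinuousLinearMap_apply]
  have h5 : (extChartAt 𝓘(ℂ, E) (ψ x) ∘ ψ ∘ (extChartAt 𝓘(ℂ, E') x).symm) ∘
      extChartAt 𝓘(ℂ, E') x =ᶠ[𝓝 x] extChartAt 𝓘(ℂ, E) (ψ x) ∘ ψ := by
    filter_upwards [extChartAt_source_mem_nhds (I := 𝓘(ℂ, E')) x] with z hz
    simp only [Function.comp_apply, (extChartAt 𝓘(ℂ, E') x).left_inv hz]
  have h6 := tderiv_congr (E' := E') (E := E) h5
  rw [tderiv_comp (ψ := extChartAt 𝓘(ℂ, E) (ψ x)) x h2 (hψ.mdifferentiableAt (by simp)),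
    tderiv_comp (E' := E')
      (ψ := extChartAt 𝓘(ℂ, E) (ψ x) ∘ ψ ∘ (extChartAt 𝓘(ℂ, E') x).symm) x
      (h1.differentiableAt (by simp)).mdifferentiableAt h3, tderiv_flat] at h6
  congr 1
  funext i
  exact congrArg (fun L : E' →L[ℂ] E ↦ L (v i)) h6

theorem SmoothAt.pull [FiniteDimensional ℂ E'] {ψ : X → M} {k : ℕ} {a : Form E M k} {x : X}
    (ha : SmoothAt a (ψ x)) (hψ : ContMDiffAt 𝓘(ℂ, E') 𝓘(ℂ, E) ω ψ x) :
    SmoothAt (pull E' ψ a) x := by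
  refine ContDiffAt.congr_of_eventuallyEq ?_ (coord_pull_eventuallyEq a hψ)
  refine contDiffAt_pullback ?_ (contDiffAt_chart_expression hψ)
  rw [chart_expression_apply]
  exact ha

variable [FiniteDimensional ℂ E]

lemma contDiffAt_coord {k : ℕ} {a : Form E M k} (ha : ∀ x, SmoothAt a x) {x : M} {y : E}
    (hy : y ∈ (extChartAt 𝓘(ℂ, E) x).target) : ContDiffAt ℝ ∞ (coord a x) y :=
  (smoothAt_flat _ _).1 ((ha _).pull (contMDiffAt_extChartAt_symm hy))

/-- Near `x` the value at each point is defined with that point's own chart. Pulling back along the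
inverse chart at `x` identifies the coordinate expression with `flatD` of a smooth one. -/
lemma smoothAt_dc (c : ℂ) {k : ℕ} {a : Form E M k} (ha : ∀ x, SmoothAt a x) (x : M) :
    SmoothAt (dc c a) x := by
  refine (contDiffAt_flatD c (ha x)).congr_of_eventuallyEq ?_
  filter_upwards [extChartAt_target_mem_nhds (I := 𝓘(ℂ, E)) x] with y hy
  have := dc_pull c (ha _) (contMDiffAt_extChartAt_symm hy)
  rw [dc_flat] at this
  exact this.symm

variable (E M) in
theorem isStronglyGauduchon_iff : IsStronglyGauduchon 𝓘(ℂ, E) M ↔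
    ∃ w : Form E M 2, (∀ x, SmoothAt w x) ∧ (∀ x, IsPositiveForm (w x)) ∧
      ∃ α : Form E M (2 * (Module.finrank ℂ E - 1)), (∀ x, SmoothAt α x) ∧
        dc (-Complex.I) (fun x ↦ wedgePow (w x) (Module.finrank ℂ E - 1)) = dc Complex.I α := by
  have hsm : ∀ {k : ℕ} (a : Form E M k), CForm.IsSmooth 𝓘(ℂ, E) (M := M) a ↔ ∀ x, SmoothAt a x := by
    refine fun a ↦ ⟨fun h x ↦ ?_, fun h x y hy ↦ ?_⟩
    · exact (h x).contDiffAt (extChartAt_target_mem_nhds x)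
    · exact (contDiffAt_coord h hy).contDiffWithinAt
  have hdel : ∀ {k : ℕ} (a : Form E M k), CForm.del 𝓘(ℂ, E) (M := M) a = dc (-Complex.I) a := by
    intro k a
    funext x
    exact congrArg (fun η : Form E E (k + 1) ↦
      (η (extChartAt 𝓘(ℂ, E) x x)).compContinuousLinearMap
        ((tderiv E E (extChartAt 𝓘(ℂ, E) x) x).restrictScalars ℝ)) (flatDel_eq (coord a x))
  constructor
  · rintro ⟨w, hw, α, hα, h⟩
    exact ⟨w, (hsm w).1 hw.smooth, fun x ↦ ⟨hw.real x, hw.type_one_one x, hw.pos x⟩, α,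
      (hsm α).1 hα, (hdel _).symm.trans h⟩
  · rintro ⟨w, hw, hpos, α, hα, h⟩
    refine ⟨w, ⟨(hsm w).2 hw, fun x ↦ (hpos x).real, fun x ↦ (hpos x).type_one_one,
      fun x ↦ (hpos x).pos⟩, α, (hsm α).2 hα, (hdel _).trans h⟩

end Forms

/-! ### Contraction with a frame -/

section Contraction
variable {F W : Type*} [NormedAddCommGroup F] [NormedSpace ℝ F] [NormedAddCommGroup W]
  [NormedSpace ℝ W]

lemma append_update_right {X : Type*} {s k : ℕ} (x : Fin s → X) (u : Fin k → X) (i : Fin k) (z : X) :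
    Fin.append x (Function.update u i z) = Function.update (Fin.append x u) (Fin.natAdd s i) z := by
  funext j
  refine Fin.addCases (fun j ↦ ?_) (fun j ↦ ?_) j
  · rw [Fin.append_left, Function.update_of_ne, Fin.append_left]
    simp [Fin.ext_iff]
    omega
  · rw [Fin.append_right]
    rcases eq_or_ne j i with rfl | h
    · simp
    · rw [Function.update_of_ne h, Function.update_of_ne, Fin.append_right]
      simpa [Fin.ext_iff] using h

/-- The form obtained by inserting the vectors `R` into the first slots, pulled back by `A`. -/
def contrFun {s k q : ℕ} (h : q = s + k) (R : Fin s → W) (A : F →L[ℝ] W) (a : W [⋀^Fin q]→L[ℝ] ℂ) :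
    F [⋀^Fin k]→L[ℝ] ℂ where
  toFun u := a (Fin.append R (A ∘ u) ∘ Fin.cast h)
  map_update_add' u i x y := by
    subst h
    rename_i inst
    obtain rfl : inst = instDecidableEqFin k := Subsingleton.elim _ _
    simp only [Fin.cast_refl, Function.comp_id, Function.comp_update, append_update_right, map_add]
    exact a.toMultilinearMap.map_update_add (Fin.append R (A ∘ u)) (Fin.natAdd s i) (A x) (A y)
  map_update_smul' u i c x := by
    subst h
    rename_i inst
    obtain rfl : inst = instDecidableEqFin k := Subsingleton.elim _ _
    simp only [Fin.cast_refl, Function.comp_id, Function.comp_update, append_update_right, map_smul]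
    exact a.toMultilinearMap.map_update_smul (Fin.append R (A ∘ u)) (Fin.natAdd s i) c (A x)
  map_eq_zero_of_eq' u i j hij hne := by
    subst h
    exact a.map_eq_zero_of_eq _ (i := Fin.natAdd s i) (j := Fin.natAdd s j)
      (by simp [Fin.append_right, hij]) (by simpa [Fin.ext_iff] using hne)
  cont := by
    subst h
    refine a.cont.comp (continuous_pi fun j ↦ ?_)
    refine Fin.addCases (fun j ↦ ?_) (fun j ↦ ?_) j
    · simp only [Function.comp_apply, Fin.cast_refl, id, Fin.append_left]
      exact continuous_const
    · simp only [Function.comp_apply, Fin.cast_refl, id, Fin.append_right]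
      fun_prop

lemma contrFun_apply {s k q : ℕ} (h : q = s + k) (R : Fin s → W) (A : F →L[ℝ] W)
    (a : W [⋀^Fin q]→L[ℝ] ℂ) (u : Fin k → F) :
    contrFun h R A a u = a (Fin.append R (A ∘ u) ∘ Fin.cast h) := rfl

/-- `contrFun` as a continuous linear map. -/
def contr [FiniteDimensional ℝ W] {s k q : ℕ} (h : q = s + k) (R : Fin s → W) (A : F →L[ℝ] W) :
    (W [⋀^Fin q]→L[ℝ] ℂ) →L[ℝ] F [⋀^Fin k]→L[ℝ] ℂ :=
  LinearMap.toContinuousLinearMap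
    { toFun := contrFun h R A
      map_add' := fun _ _ ↦ rfl
      map_smul' := fun _ _ ↦ rfl }

lemma removeNth_append_right {X : Type*} {s k : ℕ} (x : Fin s → X) (u : Fin (k + 1) → X)
    (j : Fin (k + 1)) :
    Fin.removeNth (n := s + k) (Fin.natAdd s j) (Fin.append (n := k + 1) x u) = Fin.append x (j.removeNth u) := by
  funext i
  refine Fin.addCases (fun i ↦ ?_) (fun i ↦ ?_) i
  · rw [Fin.append_left, Fin.removeNth]
    have : (Fin.succAbove (n := s + k) (Fin.natAdd s j) (Fin.castAdd k i)) =
        Fin.castAdd (k + 1) i := by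
      rw [Fin.succAbove_of_castSucc_lt]
      · rfl
      · simp [Fin.lt_def]
        omega
    rw [this, Fin.append_left]
  · rw [Fin.append_right, Fin.removeNth]
    have : (Fin.succAbove (n := s + k) (Fin.natAdd s j) (Fin.natAdd s i)) =
        Fin.natAdd s (j.succAbove i) := by
      simp only [Fin.succAbove, Fin.lt_def, Fin.ext_iff]
      simp only [Fin.val_castSucc, Fin.val_natAdd, add_lt_add_iff_left]
      split_ifs <;> simp; omega
    rw [this, Fin.append_right, Fin.removeNth]

end Contraction

section Cartan
variable {F W : Type*} [NormedAddCommGroup F] [NormedSpace ℝ F] [NormedAddCommGroup W]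
  [NormedSpace ℂ W]

/-- The alternating sum is split according to whether the direction of differentiation is a frame
vector or a free argument. For fibre integrals the first sum disappears by Stokes, for products by
parity. -/
lemma contrFun_symbolD (c : ℂ) {s k : ℕ} (R : Fin s → W) (A : F →L[ℝ] W)
    (L : W →L[ℝ] W [⋀^Fin (s + k)]→L[ℝ] ℂ) (u : Fin (k + 1) → F) :
    contrFun (k := k + 1) (q := s + k + 1) rfl R A (symbolD W c (s + k) L) u =
      (∑ j : Fin s, (-1) ^ (j : ℕ) * (1 / 2 * (L (R j)
          (Fin.removeNth (n := s + k) (Fin.castAdd (k + 1) j) (Fin.append (n := k + 1) R (A ∘ u))) +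
        c * L (Complex.I • R j)
          (Fin.removeNth (n := s + k) (Fin.castAdd (k + 1) j) (Fin.append (n := k + 1) R (A ∘ u)))))) +
      ∑ j : Fin (k + 1), (-1) ^ (s + j : ℕ) * (1 / 2 * (contrFun rfl R A (L (A (u j)))
          (j.removeNth u) + c * contrFun rfl R A (L (Complex.I • A (u j))) (j.removeNth u))) := by
  rw [contrFun_apply]
  have h := symbolD_apply c L (Fin.append (n := k + 1) R (A ∘ u))
  refine Eq.trans h ?_
  refine (Fin.sum_univ_add (a := s) (b := k + 1) _).trans ?_
  congr 1
  · refine Finset.sum_congr rfl fun j _ ↦ ?_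
    rw [Fin.append_left]
    rfl
  · refine Finset.sum_congr rfl fun j _ ↦ ?_
    rw [Fin.append_right, removeNth_append_right, contrFun_apply, contrFun_apply]
    rfl

end Cartan

/-! ### Integration over the fibre of a product -/

section FiberIntegral
open MeasureTheory Convolution

lemma exists_compact_snd {F G Z : Type*} [TopologicalSpace F] [TopologicalSpace G] [Zero Z]
    {f : F × G → Z} (hf : HasCompactSupport f) :
    ∃ k : Set G, IsCompact k ∧ ∀ p x, x ∉ k → (p, x) ∉ tsupport f := by
  refine ⟨Prod.snd '' tsupport f, hf.isCompact.image continuous_snd, fun p x hx hmem ↦ ?_⟩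
  exact hx ⟨(p, x), hmem, rfl⟩

lemma integrable_slice {F G Z : Type*} [NormedAddCommGroup F] [NormedAddCommGroup G]
    [MeasurableSpace G] [BorelSpace G] (μ : Measure G) [IsFiniteMeasureOnCompacts μ]
    [NormedAddCommGroup Z] {f : F × G → Z}
    (hf : Continuous f) (hc : HasCompactSupport f) (y : F) : Integrable (fun z ↦ f (y, z)) μ := by
  obtain ⟨k, hk, hk'⟩ := exists_compact_snd hc
  exact (hf.comp (by fun_prop)).integrable_of_hasCompactSupport
    (HasCompactSupport.intro hk fun z hz ↦
      image_eq_zero_of_notMem_tsupport (f := f) (hk' y z hz))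

variable {F G Z : Type*} [NormedAddCommGroup F] [NormedSpace ℝ F]
  [NormedAddCommGroup G] [NormedSpace ℝ G] [FiniteDimensional ℝ G] [MeasurableSpace G]
  [BorelSpace G] (μ : Measure G) [μ.IsAddHaarMeasure]
  [NormedAddCommGroup Z] [NormedSpace ℝ Z]

/-- Convolution with the constant one forgets the second variable. A fibre integral is thus a
convolution with a parameter, and regularity of such convolutions gives differentiation under the
integral. -/
lemma convolution_one {F : Type*} (g : F → G → Z) (q : F × G) :
    ((fun _ ↦ (1 : ℝ)) ⋆[ContinuousLinearMap.lsmul ℝ ℝ, μ] g q.1) q.2 = ∫ z, g q.1 z ∂μ := by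
  rw [convolution_def]
  simp only [ContinuousLinearMap.lsmul_apply, one_smul]
  exact integral_sub_left_eq_self (fun z ↦ g q.1 z) μ q.2

lemma contDiff_integral_snd {f : F × G → Z} (hf : ContDiff ℝ ∞ f) (hc : HasCompactSupport f) :
    ContDiff ℝ ∞ fun y ↦ ∫ z, f (y, z) ∂μ := by
  obtain ⟨k, hk, hk'⟩ := exists_compact_snd hc
  have h := contDiffOn_convolution_right_with_param (μ := μ) (n := ⊤) (f := fun _ : G ↦ (1 : ℝ))
    (ContinuousLinearMap.lsmul ℝ ℝ) (g := fun y z ↦ f (y, z)) (s := Set.univ) isOpen_univ hk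
    (fun p x _ hx ↦ image_eq_zero_of_notMem_tsupport (hk' p x hx)) (locallyIntegrable_const 1) hf.contDiffOn
  rw [Set.univ_prod_univ, contDiffOn_univ] at h
  have h2 := h.comp (contDiff_prodMk_left (𝕜 := ℝ) (n := ∞) (0 : G))
  have h3 : (fun y ↦ ∫ z, f (y, z) ∂μ) = (fun q : F × G ↦ ((fun _ ↦ (1 : ℝ))
      ⋆[ContinuousLinearMap.lsmul ℝ ℝ, μ] fun z ↦ f (q.1, z)) q.2) ∘ fun y ↦ (y, 0) :=
    funext fun y ↦ (convolution_one μ (fun y z ↦ f (y, z)) (y, 0)).symm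
  rw [h3]
  exact h2

/-- The convolution with one is a function of the first variable only, so its derivative factors
through the first projection. The case `v = 0` is Stokes' theorem on the fibre, the case `g = 0`
differentiation under the integral. -/
lemma integral_fderiv_snd {f : F × G → Z} (hf : ContDiff ℝ ∞ f) (hc : HasCompactSupport f)
    (y v : F) (g : G) :
    ∫ z, fderiv ℝ f (y, z) (v, g) ∂μ = fderiv ℝ (fun y ↦ ∫ z, f (y, z) ∂μ) y v := by
  obtain ⟨k, hk, hk'⟩ := exists_compact_snd hc
  have h := hasFDerivAt_convolution_right_with_param (μ := μ) (f := fun _ : G ↦ (1 : ℝ))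
    (ContinuousLinearMap.lsmul ℝ ℝ) (g := fun y z ↦ f (y, z)) (s := Set.univ) isOpen_univ hk
    (fun p x _ hx ↦ image_eq_zero_of_notMem_tsupport (hk' p x hx)) (locallyIntegrable_const 1)
    ((hf.of_le (by simp)).contDiffOn) (y, 0) trivial
  have h1 : (fun q : F × G ↦ ((fun _ ↦ (1 : ℝ)) ⋆[ContinuousLinearMap.lsmul ℝ ℝ, μ]
      fun z ↦ f (q.1, z)) q.2) = (fun y ↦ ∫ z, f (y, z) ∂μ) ∘ Prod.fst := by
    funext q
    exact convolution_one μ (fun y z ↦ f (y, z)) q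
  have h2 : HasFDerivAt (fun y ↦ ∫ z, f (y, z) ∂μ) (fderiv ℝ (fun y ↦ ∫ z, f (y, z) ∂μ) y) y :=
    ((contDiff_integral_snd μ hf hc).differentiable (by simp) y).hasFDerivAt
  have h3 := (HasFDerivAt.comp (f := (Prod.fst : F × G → F)) (y, (0 : G)) h2 hasFDerivAt_fst)
  rw [h1] at h
  have h4 := h.unique h3
  have h5 := congrArg (fun L : F × G →L[ℝ] Z ↦ L (v, g)) h4
  refine Eq.trans ?_ (h5.trans rfl)
  have hcd : HasCompactSupport fun z ↦ fderiv ℝ f (y, z) :=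
    HasCompactSupport.intro hk fun z hz ↦ fderiv_of_notMem_tsupport (𝕜 := ℝ) (hk' y z hz)
  rw [convolution_precompR_apply]
  · exact (convolution_one μ (fun y z ↦ fderiv ℝ f (y, z) (v, g)) (y, 0)).symm
  · exact locallyIntegrable_const 1
  · exact hcd
  · exact (hf.continuous_fderiv (by simp)).comp (by fun_prop)

variable {Z' : Type*} [NormedAddCommGroup Z'] [NormedSpace ℝ Z']

lemma integral_clm_fderiv {b : F × G → Z} (hb : ContDiff ℝ ∞ b) (hc : HasCompactSupport b)
    (y v : F) (g : G) (Λ : Z →L[ℝ] Z') :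
    ∫ z, Λ (fderiv ℝ b (y, z) (v, g)) ∂μ = fderiv ℝ (fun y ↦ ∫ z, Λ (b (y, z)) ∂μ) y v := by
  have h1 := integral_fderiv_snd μ (f := fun p ↦ Λ (b p)) (Λ.contDiff.comp hb)
    (hc.comp_left (map_zero _)) y v g
  rw [← h1]
  congr 1
  funext z
  have h2 : HasFDerivAt (fun p ↦ Λ (b p)) (Λ.comp (fderiv ℝ b (y, z))) (y, z) :=
    Λ.hasFDerivAt.comp (y, z) (hb.differentiable (by simp) (y, z)).hasFDerivAt
  rw [h2.fderiv]
  rfl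

omit [FiniteDimensional ℝ G] in
lemma integrable_clm_fderiv {b : F × G → Z} (hb : ContDiff ℝ ∞ b) (hc : HasCompactSupport b)
    (x : F × G) (y : F) (Λ : Z →L[ℝ] Z') : Integrable (fun z ↦ Λ (fderiv ℝ b (y, z) x)) μ := by
  have h1 : Continuous fun p ↦ Λ (fderiv ℝ b p x) :=
    Λ.continuous.comp ((hb.continuous_fderiv (by simp)).clm_apply continuous_const)
  have h2 : HasCompactSupport fun p ↦ Λ (fderiv ℝ b p x) :=
    HasCompactSupport.comp_left (f := fderiv ℝ b) (g := fun L : F × G →L[ℝ] Z ↦ Λ (L x))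
      (hc.fderiv ℝ) (by rw [zero_apply, map_zero])
  exact integrable_slice μ h1 h2 y

end FiberIntegral

section FiberForm
open MeasureTheory
variable {F G : Type*} [NormedAddCommGroup F] [NormedSpace ℂ F]
  [NormedAddCommGroup G] [NormedSpace ℂ G] [FiniteDimensional ℂ G] [MeasurableSpace G]
  [BorelSpace G] (μ : Measure G) [μ.IsAddHaarMeasure]

lemma integral_vertical_fderiv {q : ℕ} {b : Form (F × G) (F × G) q} (hb : ContDiff ℝ ∞ b)
    (hc : HasCompactSupport b) (y : F) (g : G) (w : Fin q → F × G) :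
    ∫ z, fderiv ℝ b (y, z) ((0 : F), g) w ∂μ = 0 := by
  have := integral_clm_fderiv μ hb hc y 0 g (ContinuousAlternatingMap.apply ℝ (F × G) ℂ w)
  rw [map_zero] at this
  exact this

variable [FiniteDimensional ℂ F]

/-- The fibre integral of a form on `F × G` over `G`, with respect to the frame `R` of `G`. -/
def fiberInt {s k q : ℕ} (h : q = s + k) (R : Fin s → G) (b : Form (F × G) (F × G) q) :
    Form F F k := fun y ↦
  ∫ z, contr h (fun j ↦ ((0 : F), R j)) (ContinuousLinearMap.inl ℝ F G) (b (y, z)) ∂μ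

lemma contDiff_fiberInt {s k q : ℕ} (h : q = s + k) (R : Fin s → G)
    {b : Form (F × G) (F × G) q} (hb : ContDiff ℝ ∞ b) (hc : HasCompactSupport b) :
    ContDiff ℝ ∞ (fiberInt μ h R b) :=
  contDiff_integral_snd μ (f := fun p ↦ contr h (fun j ↦ ((0 : F), R j))
    (ContinuousLinearMap.inl ℝ F G) (b p)) ((ContinuousLinearMap.contDiff _).comp hb)
    (hc.comp_left (map_zero _))

lemma fiberInt_apply {s k q : ℕ} (h : q = s + k) (R : Fin s → G)
    {b : Form (F × G) (F × G) q} (hb : Continuous b) (hc : HasCompactSupport b) (y : F)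
    (u : Fin k → F) : fiberInt μ h R b y u = ∫ z, b (y, z) (Fin.append (fun j ↦ ((0 : F), R j))
      (fun j ↦ (u j, (0 : G))) ∘ Fin.cast h) ∂μ := by
  have h1 : Integrable (fun z ↦ contr h (fun j ↦ ((0 : F), R j)) (ContinuousLinearMap.inl ℝ F G)
      (b (y, z))) μ :=
    integrable_slice μ (f := fun p ↦ contr h (fun j ↦ ((0 : F), R j))
      (ContinuousLinearMap.inl ℝ F G) (b p)) ((ContinuousLinearMap.continuous _).comp hb)
      (hc.comp_left (map_zero _)) y
  exact ((ContinuousAlternatingMap.apply ℝ F ℂ u).integral_comp_comm h1).symm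

lemma integral_contrFun_fderiv {s k : ℕ} (R : Fin s → G) {b : Form (F × G) (F × G) (s + k)}
    (hb : ContDiff ℝ ∞ b) (hc : HasCompactSupport b) (y x : F) (w : Fin k → F) :
    ∫ z, contrFun rfl (fun j ↦ ((0 : F), R j)) (ContinuousLinearMap.inl ℝ F G)
      (fderiv ℝ b (y, z) (ContinuousLinearMap.inl ℝ F G x)) w ∂μ =
        fderiv ℝ (fiberInt μ rfl R b) y x w := by
  have h1 := integral_clm_fderiv μ hb hc y x 0 ((ContinuousAlternatingMap.apply ℝ F ℂ w).comp
    (contr rfl (fun j ↦ ((0 : F), R j)) (ContinuousLinearMap.inl ℝ F G)))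
  have h2 : (fun y ↦ ∫ z, ((ContinuousAlternatingMap.apply ℝ F ℂ w).comp
      (contr rfl (fun j ↦ ((0 : F), R j)) (ContinuousLinearMap.inl ℝ F G)))
      (b (y, z)) ∂μ) = fun y ↦ fiberInt μ rfl R b y w := funext fun y ↦
    (fiberInt_apply μ rfl R hb.continuous hc y w).symm
  rw [h2] at h1
  have h3 : HasFDerivAt (fun y ↦ fiberInt μ rfl R b y w)
      ((ContinuousAlternatingMap.apply ℝ F ℂ w).comp (fderiv ℝ (fiberInt μ rfl R b) y)) y :=
    (ContinuousAlternatingMap.apply ℝ F ℂ w).hasFDerivAt.comp y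
      ((contDiff_fiberInt μ rfl R hb hc).differentiable (by simp) y).hasFDerivAt
  rw [h3.fderiv] at h1
  exact h1

/-- Derivatives in fibre directions integrate to zero by compact support, and those along the base
pass through the integral. Multiplication by `i` preserves both kinds of direction, so this applies
to both halves of the operator. The number `s` of frame vectors is even, hence there is no sign. -/
theorem flatD_fiberInt (c : ℂ) {s k q : ℕ} (h : q = s + k) (hs : Even s) (R : Fin s → G)
    {b : Form (F × G) (F × G) q} (hb : ContDiff ℝ ∞ b) (hc : HasCompactSupport b) :
    flatD c (fiberInt μ h R b) =
      fiberInt μ (q := q + 1) (k := k + 1) (congrArg Nat.succ h) R (flatD c b) := by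
  subst h
  funext y
  ext u
  have hcD : HasCompactSupport (flatD c b) :=
    (hc.fderiv ℝ).comp_left (g := symbolD (F × G) c (s + k)) (map_zero _)
  have hbD : Continuous (flatD c b) :=
    (contDiff_iff_contDiffAt.2 fun x ↦ contDiffAt_flatD c hb.contDiffAt).continuous
  have hv0 : ∀ (g : G), Complex.I • ((0 : F), g) = ((0 : F), Complex.I • g) := fun g ↦ by
    rw [Prod.smul_mk, smul_zero]
  have hh0 : ∀ (x : F), Complex.I • ContinuousLinearMap.inl ℝ F G x =
      ContinuousLinearMap.inl ℝ F G (Complex.I • x) := fun x ↦ by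
    simp
  rw [fiberInt_apply μ _ R hbD hcD]
  have e1 : ∀ z, flatD c b (y, z) (Fin.append (fun j ↦ ((0 : F), R j))
      (fun j ↦ (u j, (0 : G))) ∘ Fin.cast rfl) = _ :=
    fun z ↦ contrFun_symbolD c (fun j ↦ ((0 : F), R j)) (ContinuousLinearMap.inl ℝ F G)
      (fderiv ℝ b (y, z)) u
  refine Eq.trans ?_ (integral_congr_ae (Filter.Eventually.of_forall e1)).symm
  have hi1 : ∀ (x : F × G) (w : Fin (s + k) → F × G),
      Integrable (fun z ↦ fderiv ℝ b (y, z) x w) μ := fun x w ↦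
    integrable_clm_fderiv μ hb hc x y (ContinuousAlternatingMap.apply ℝ (F × G) ℂ w)
  have hi2 : ∀ (x : F × G) (w : Fin k → F), Integrable (fun z ↦
      contrFun rfl (fun j ↦ ((0 : F), R j)) (ContinuousLinearMap.inl ℝ F G) (fderiv ℝ b (y, z) x) w) μ := fun x w ↦
    integrable_clm_fderiv μ hb hc x y ((ContinuousAlternatingMap.apply ℝ F ℂ w).comp
      (contr rfl (fun j ↦ ((0 : F), R j)) (ContinuousLinearMap.inl ℝ F G)))
  simp only [hv0, hh0]
  rw [integral_add, integral_finsetSum, integral_finsetSum, Finset.sum_eq_zero, zero_add,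
    flatD_eq_symbolD, symbolD_apply]
  · refine Finset.sum_congr rfl fun j _ ↦ ?_
    rw [integral_const_mul, integral_const_mul, integral_add (hi2 _ _) ((hi2 _ _).const_mul c),
      integral_const_mul, integral_contrFun_fderiv μ R hb hc, integral_contrFun_fderiv μ R hb hc,
      pow_add, hs.neg_one_pow, one_mul]
  · intro j _
    rw [integral_const_mul, integral_const_mul, integral_add (hi1 _ _) ((hi1 _ _).const_mul c),
      integral_const_mul, integral_vertical_fderiv μ hb hc, integral_vertical_fderiv μ hb hc]
    simp
  · exact fun j _ ↦ (((hi2 _ _).add ((hi2 _ _).const_mul c)).const_mul _).const_mul _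
  · exact fun j _ ↦ (((hi1 _ _).add ((hi1 _ _).const_mul c)).const_mul _).const_mul _
  · exact integrable_finsetSum _ fun j _ ↦
      (((hi1 _ _).add ((hi1 _ _).const_mul c)).const_mul _).const_mul _
  · exact integrable_finsetSum _ fun j _ ↦
      (((hi2 _ _).add ((hi2 _ _).const_mul c)).const_mul _).const_mul _

end FiberForm

/-! ### Push-forward in one fibre chart -/

section FiberChart
open MeasureTheory
variable {E : Type*} [NormedAddCommGroup E] [NormedSpace ℂ E]
  {F : Type*} [NormedAddCommGroup F] [NormedSpace ℂ F]
  {M : Type*} [TopologicalSpace M] [ChartedSpace E M]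
  {N : Type*} [TopologicalSpace N] [ChartedSpace F N]

/-- A pair of holomorphic charts in which a map is the projection `F × G → F`. -/
structure FiberChart (E F G : Type*) [NormedAddCommGroup E] [NormedSpace ℂ E]
    [NormedAddCommGroup F] [NormedSpace ℂ F] [NormedAddCommGroup G] [NormedSpace ℂ G]
    {M : Type*} [TopologicalSpace M] [ChartedSpace E M]
    {N : Type*} [TopologicalSpace N] [ChartedSpace F N] (f : M → N) where
  dom : OpenPartialHomeomorph M (F × G)
  cod : OpenPartialHomeomorph N F
  contMDiffOn_dom : ContMDiffOn 𝓘(ℂ, E) 𝓘(ℂ, F × G) ω dom dom.source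
  contMDiffOn_dom_symm : ContMDiffOn 𝓘(ℂ, F × G) 𝓘(ℂ, E) ω dom.symm dom.target
  contMDiffOn_cod : ContMDiffOn 𝓘(ℂ, F) 𝓘(ℂ, F) ω cod cod.source
  contMDiffOn_cod_symm : ContMDiffOn 𝓘(ℂ, F) 𝓘(ℂ, F) ω cod.symm cod.target
  map_mem : ∀ x ∈ dom.source, f x ∈ cod.source
  cod_map : ∀ x ∈ dom.source, cod (f x) = (dom x).1

lemma exists_fiberChart [IsManifold 𝓘(ℂ, E) ω M] [IsManifold 𝓘(ℂ, F) ω N]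
    {G : Type*} [NormedAddCommGroup G] [NormedSpace ℂ G] {f : M → N} {x : M}
    (h : Manifold.IsSubmersionAtOfComplement G 𝓘(ℂ, E) 𝓘(ℂ, F) ω f x) :
    ∃ φ : FiberChart E F G f, x ∈ φ.dom.source := by
  have h1 := contMDiffOn_of_mem_maximalAtlas h.domChart_mem_maximalAtlas
  have h2 := contMDiffOn_symm_of_mem_maximalAtlas h.domChart_mem_maximalAtlas
  refine ⟨{ dom := h.domChart.trans h.equiv.toHomeomorph.toOpenPartialHomeomorph
            cod := h.codChart
            contMDiffOn_dom := ?_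
            contMDiffOn_dom_symm := ?_
            contMDiffOn_cod := contMDiffOn_of_mem_maximalAtlas h.codChart_mem_maximalAtlas
            contMDiffOn_cod_symm := contMDiffOn_symm_of_mem_maximalAtlas
              h.codChart_mem_maximalAtlas
            map_mem := fun z hz ↦ h.source_subset_preimage_source (by simpa using hz)
            cod_map := fun z hz ↦ ?_ }, ?_⟩
  · have hs : (h.domChart.trans h.equiv.toHomeomorph.toOpenPartialHomeomorph).source =
      h.domChart.source := by simp
    rw [hs]
    exact (h.equiv : E →L[ℂ] F × G).contDiff.contMDiff.comp_contMDiffOn h1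
  · intro p hp
    have hp' : h.equiv.symm p ∈ h.domChart.target := by simpa using hp
    have h3 : ContMDiffAt 𝓘(ℂ, E) 𝓘(ℂ, E) ω h.domChart.symm (h.equiv.symm p) :=
      h2.contMDiffAt (h.domChart.open_target.mem_nhds hp')
    exact (ContMDiffAt.comp (g := h.domChart.symm) (f := h.equiv.symm) p h3
      (h.equiv.symm : F × G →L[ℂ] E).contDiff.contMDiff.contMDiffAt).contMDiffWithinAt
  · have hz' : z ∈ h.domChart.source := by simpa using hz
    have h3 := h.writtenInCharts (show h.domChart z ∈ (h.domChart.extend 𝓘(ℂ, E)).target by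
      simpa using h.domChart.map_source hz')
    simpa [hz'] using h3
  · simpa using h.mem_domChart_source

variable {G : Type*} [NormedAddCommGroup G] [NormedSpace ℂ G]

namespace FiberChart
variable {f : M → N} (φ : FiberChart E F G f)

lemma contMDiffAt_dom {x : M} (hx : x ∈ φ.dom.source) :
    ContMDiffAt 𝓘(ℂ, E) 𝓘(ℂ, F × G) ω φ.dom x :=
  φ.contMDiffOn_dom.contMDiffAt (φ.dom.open_source.mem_nhds hx)

lemma contMDiffAt_dom_symm {p : F × G} (hp : p ∈ φ.dom.target) :
    ContMDiffAt 𝓘(ℂ, F × G) 𝓘(ℂ, E) ω φ.dom.symm p :=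
  φ.contMDiffOn_dom_symm.contMDiffAt (φ.dom.open_target.mem_nhds hp)

lemma contMDiffAt_cod {y : N} (hy : y ∈ φ.cod.source) : ContMDiffAt 𝓘(ℂ, F) 𝓘(ℂ, F) ω φ.cod y :=
  φ.contMDiffOn_cod.contMDiffAt (φ.cod.open_source.mem_nhds hy)

lemma contMDiffAt_cod_symm {y : F} (hy : y ∈ φ.cod.target) :
    ContMDiffAt 𝓘(ℂ, F) 𝓘(ℂ, F) ω φ.cod.symm y :=
  φ.contMDiffOn_cod_symm.contMDiffAt (φ.cod.open_target.mem_nhds hy)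

lemma map_dom_symm {p : F × G} (hp : p ∈ φ.dom.target) {y : N} (hy : y ∈ φ.cod.source)
    (h : p.1 = φ.cod y) : f (φ.dom.symm p) = y := by
  have hs := φ.dom.map_target hp
  refine φ.cod.injOn (φ.map_mem _ hs) hy ?_
  rw [φ.cod_map _ hs, φ.dom.right_inv hp, h]

open Classical in
/-- The coordinate expression of a form in the domain of a fibre chart, extended by zero. -/
def expr {q : ℕ} (a : Form E M q) : Form (F × G) (F × G) q := fun p ↦
  if p ∈ φ.dom.target then pull (F × G) φ.dom.symm a p else 0

lemma expr_of_mem {q : ℕ} (a : Form E M q) {p : F × G} (hp : p ∈ φ.dom.target) :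
    φ.expr a p = pull (F × G) φ.dom.symm a p := if_pos hp

lemma expr_eq_zero {q : ℕ} {a : Form E M q} {p : F × G}
    (h : p ∈ φ.dom.target → a (φ.dom.symm p) = 0) : φ.expr a p = 0 := by
  by_cases hp : p ∈ φ.dom.target
  · rw [expr_of_mem _ _ hp, pull_apply, h hp]
    rfl
  · exact if_neg hp

lemma expr_eventuallyEq {q : ℕ} (a : Form E M q) {p : F × G} (hp : p ∈ φ.dom.target) :
    φ.expr a =ᶠ[𝓝 p] pull (F × G) φ.dom.symm a := by
  filter_upwards [φ.dom.open_target.mem_nhds hp] with p' hp'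
  exact φ.expr_of_mem a hp'

variable {K : Set M} {q : ℕ} {a : Form E M q}

/-- The image of `K` in the chart is compact, hence closed, and lies in the target. So the
coordinate expression vanishes near every point outside the target, and extension by zero keeps it
smooth. -/
lemma expr_eventuallyEq_zero (hK : IsCompact K) (hKs : K ⊆ φ.dom.source)
    (ha : ∀ x ∉ K, a x = 0) {p : F × G} (hp : p ∉ φ.dom.target) : φ.expr a =ᶠ[𝓝 p] 0 := by
  have hc : IsClosed (φ.dom '' K) := (hK.image_of_continuousOn
    (φ.dom.continuousOn.mono hKs)).isClosed
  have hp' : p ∉ φ.dom '' K := by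
    rintro ⟨x, hx, rfl⟩
    exact hp (φ.dom.map_source (hKs hx))
  filter_upwards [hc.isOpen_compl.mem_nhds hp'] with p' hp''
  refine φ.expr_eq_zero fun ht ↦ ha _ fun hmem ↦ hp'' ⟨_, hmem, φ.dom.right_inv ht⟩

lemma hasCompactSupport_expr (hK : IsCompact K) (hKs : K ⊆ φ.dom.source)
    (ha : ∀ x ∉ K, a x = 0) : HasCompactSupport (φ.expr a) :=
  HasCompactSupport.intro (hK.image_of_continuousOn (φ.dom.continuousOn.mono hKs)) fun _ hp ↦
    φ.expr_eq_zero fun ht ↦ ha _ fun hmem ↦ hp ⟨_, hmem, φ.dom.right_inv ht⟩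

variable [FiniteDimensional ℂ F] [FiniteDimensional ℂ G] [IsManifold 𝓘(ℂ, E) ω M]

lemma contDiff_expr (hK : IsCompact K) (hKs : K ⊆ φ.dom.source)
    (ha : ∀ x ∉ K, a x = 0) (hs : ∀ x, SmoothAt a x) : ContDiff ℝ ∞ (φ.expr a) := by
  refine contDiff_iff_contDiffAt.2 fun p ↦ ?_
  by_cases hp : p ∈ φ.dom.target
  · refine ContDiffAt.congr_of_eventuallyEq ?_ (φ.expr_eventuallyEq a hp)
    exact (smoothAt_flat _ _).1 ((hs _).pull (φ.contMDiffAt_dom_symm hp))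
  · exact contDiffAt_const.congr_of_eventuallyEq (φ.expr_eventuallyEq_zero hK hKs ha hp)

omit [FiniteDimensional ℂ F] [FiniteDimensional ℂ G] in
lemma flatD_expr (c : ℂ) (hK : IsCompact K) (hKs : K ⊆ φ.dom.source)
    (ha : ∀ x ∉ K, a x = 0) (hs : ∀ x, SmoothAt a x) :
    flatD c (φ.expr a) = φ.expr (dc c a) := by
  funext p
  by_cases hp : p ∈ φ.dom.target
  · rw [flatD_congr c (φ.expr_eventuallyEq a hp), expr_of_mem _ _ hp,
      ← dc_pull c (hs _) (φ.contMDiffAt_dom_symm hp), dc_flat]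
  · rw [flatD_congr c (φ.expr_eventuallyEq_zero hK hKs ha hp), ← dc_flat, dc_zero,
      expr_eq_zero _ fun h ↦ absurd h hp]

end FiberChart

lemma dc_eq_zero_of_notMem (c : ℂ) {K : Set M} (hK : IsClosed K) {q : ℕ} {a : Form E M q}
    (ha : ∀ x ∉ K, a x = 0) : ∀ x ∉ K, dc c a x = 0 := fun x hx ↦ by
  have h : a =ᶠ[𝓝 x] 0 := by
    filter_upwards [hK.isOpen_compl.mem_nhds hx] with x' hx'
    exact ha x' hx'
  rw [dc_congr c h, dc_zero]

namespace FiberChart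
variable {f : M → N} (φ : FiberChart E F G f)
  [FiniteDimensional ℂ F] [FiniteDimensional ℂ G]
  [MeasurableSpace G] [BorelSpace G] (μ : Measure G) [μ.IsAddHaarMeasure] {s k q : ℕ}

open Classical in
/-- The push-forward of a form supported in the domain of a fibre chart. -/
def push (h : q = s + k) (R : Fin s → G) (a : Form E M q) : Form F N k := fun y ↦
  if y ∈ φ.cod.source then pull F φ.cod (fiberInt μ h R (φ.expr a)) y else 0

omit [BorelSpace G] [μ.IsAddHaarMeasure] in
lemma push_of_mem (h : q = s + k) (R : Fin s → G) (a : Form E M q) {y : N}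
    (hy : y ∈ φ.cod.source) :
    φ.push μ h R a y = pull F φ.cod (fiberInt μ h R (φ.expr a)) y := if_pos hy

variable {K : Set M} {a : Form E M q}

omit [BorelSpace G] [μ.IsAddHaarMeasure] in
lemma push_eq_zero (h : q = s + k) (R : Fin s → G) (ha : ∀ x ∉ K, a x = 0) {y : N}
    (hy : y ∉ f '' K) : φ.push μ h R a y = 0 := by
  by_cases hys : y ∈ φ.cod.source
  · have h0 : ∀ z, φ.expr a (φ.cod y, z) = 0 := fun z ↦ φ.expr_eq_zero fun ht ↦
      ha _ fun hmem ↦ hy ⟨_, hmem, φ.map_dom_symm ht hys rfl⟩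
    rw [push_of_mem _ _ _ _ _ hys, pull_apply, fiberInt]
    simp only [h0, map_zero, integral_zero]
    rfl
  · exact if_neg hys

/-- The image of `K` under `f` is compact, hence closed in `N`, and contained in the domain of the
base chart; outside that image the push-forward is zero. -/
lemma push_eventuallyEq_zero [T2Space N] (h : q = s + k) (R : Fin s → G) (hf : Continuous f)
    (hK : IsCompact K) (hKs : K ⊆ φ.dom.source)
    (ha : ∀ x ∉ K, a x = 0) {y : N} (hy : y ∉ φ.cod.source) : φ.push μ h R a =ᶠ[𝓝 y] 0 := by
  have hy' : y ∉ f '' K := by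
    rintro ⟨x, hx, rfl⟩
    exact hy (φ.map_mem x (hKs hx))
  filter_upwards [(hK.image hf).isClosed.isOpen_compl.mem_nhds hy'] with y' hy''
  exact φ.push_eq_zero μ h R ha hy''

omit [BorelSpace G] [μ.IsAddHaarMeasure] in
lemma push_eventuallyEq (h : q = s + k) (R : Fin s → G) (a : Form E M q) {y : N}
    (hy : y ∈ φ.cod.source) :
    φ.push μ h R a =ᶠ[𝓝 y] pull F φ.cod (fiberInt μ h R (φ.expr a)) := by
  filter_upwards [φ.cod.open_source.mem_nhds hy] with y' hy'
  exact φ.push_of_mem μ h R a hy'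

variable [T2Space N] [IsManifold 𝓘(ℂ, E) ω M] [IsManifold 𝓘(ℂ, F) ω N]

lemma smoothAt_push (h : q = s + k) (R : Fin s → G) (hf : Continuous f)
    (hK : IsCompact K) (hKs : K ⊆ φ.dom.source) (ha : ∀ x ∉ K, a x = 0)
    (hs : ∀ x, SmoothAt a x) (y : N) : SmoothAt (φ.push μ h R a) y := by
  by_cases hy : y ∈ φ.cod.source
  · refine SmoothAt.congr ?_ (φ.push_eventuallyEq μ h R a hy)
    refine SmoothAt.pull ((smoothAt_flat _ _).2 ?_) (φ.contMDiffAt_cod hy)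
    exact (contDiff_fiberInt μ h R (φ.contDiff_expr hK hKs ha hs)
      (φ.hasCompactSupport_expr hK hKs ha)).contDiffAt
  · exact (smoothAt_zero y).congr (φ.push_eventuallyEq_zero μ h R hf hK hKs ha hy)

lemma dc_push [T2Space M] (c : ℂ) (h : q = s + k) (hse : Even s) (R : Fin s → G)
    (hf : Continuous f)
    (hK : IsCompact K) (hKs : K ⊆ φ.dom.source) (ha : ∀ x ∉ K, a x = 0)
    (hs : ∀ x, SmoothAt a x) :
    dc c (φ.push μ h R a) =
      φ.push μ (q := q + 1) (k := k + 1) (congrArg Nat.succ h) R (dc c a) := by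
  have hsm := φ.contDiff_expr hK hKs ha hs
  have hcs := φ.hasCompactSupport_expr hK hKs ha
  funext y
  by_cases hy : y ∈ φ.cod.source
  · rw [dc_congr c (φ.push_eventuallyEq μ h R a hy), dc_pull c ((smoothAt_flat _ _).2
      (contDiff_fiberInt μ h R hsm hcs).contDiffAt) (φ.contMDiffAt_cod hy), dc_flat,
      flatD_fiberInt μ c h hse R hsm hcs, φ.flatD_expr c hK hKs ha hs, push_of_mem _ _ _ _ _ hy]
  · rw [dc_congr c (φ.push_eventuallyEq_zero μ h R hf hK hKs ha hy), dc_zero]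
    exact (if_neg hy).symm

end FiberChart
end FiberChart

/-! ### Dependence on the fibre frame -/

section Frame
variable {F G : Type*} [NormedAddCommGroup F] [NormedSpace ℂ F]
  [NormedAddCommGroup G] [NormedSpace ℂ G]

lemma exists_basis_eq_pairs {m : ℕ} (b : Module.Basis (Fin m) ℂ G) :
    ∃ B : Module.Basis (Fin (2 * m)) ℝ G, ⇑B = pairs b := by
  have hli := linearIndependent_pairs b.linearIndependent
  have : FiniteDimensional ℂ G := b.finiteDimensional_of_finite
  have : FiniteDimensional ℝ G := FiniteDimensional.complexToReal G
  have hcard : Fintype.card (Fin (2 * m)) = Module.finrank ℝ G := by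
    rw [Fintype.card_fin, ← Module.finrank_mul_finrank ℝ ℂ G, Complex.finrank_real_complex,
      Module.finrank_eq_card_basis b, Fintype.card_fin]
  exact ⟨Module.Basis.mk hli (hli.span_eq_top_of_card_eq_finrank' hcard).ge,
    Module.Basis.coe_mk _ _⟩

lemma append_update_left {X : Type*} {s k : ℕ} (x : Fin s → X) (u : Fin k → X) (i : Fin s) (z : X) :
    Fin.append (Function.update x i z) u = Function.update (Fin.append x u) (Fin.castAdd k i) z := by
  funext j
  refine Fin.addCases (fun j ↦ ?_) (fun j ↦ ?_) j
  · rw [Fin.append_left]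
    rcases eq_or_ne j i with rfl | h
    · simp
    · rw [Function.update_of_ne h, Function.update_of_ne, Fin.append_left]
      simpa [Fin.ext_iff] using h
  · rw [Fin.append_right, Function.update_of_ne, Fin.append_right]
    simp [Fin.ext_iff]
    omega

/-- A form on `F × G` as an alternating map of its first arguments, taken in `G`. -/
def verticalMap {s k : ℕ} (B : (F × G) [⋀^Fin (s + k)]→L[ℝ] ℂ) (t : Fin k → F × G) :
    G [⋀^Fin s]→ₗ[ℝ] ℂ where
  toFun r := B (Fin.append (fun j ↦ ((0 : F), r j)) t)
  map_update_add' r i x y := by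
    rename_i inst
    obtain rfl : inst = instDecidableEqFin s := Subsingleton.elim _ _
    have h : ∀ z, (fun j ↦ ((0 : F), Function.update r i z j)) =
        Function.update (fun j ↦ ((0 : F), r j)) i ((0 : F), z) := fun z ↦ by
      funext j
      rcases eq_or_ne j i with rfl | h <;> simp [*]
    simp only [h, append_update_left]
    rw [← B.map_update_add, Prod.mk_add_mk, add_zero]
  map_update_smul' r i c x := by
    rename_i inst
    obtain rfl : inst = instDecidableEqFin s := Subsingleton.elim _ _
    have h : ∀ z, (fun j ↦ ((0 : F), Function.update r i z j)) =
        Function.update (fun j ↦ ((0 : F), r j)) i ((0 : F), z) := fun z ↦ by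
      funext j
      rcases eq_or_ne j i with rfl | h <;> simp [*]
    simp only [h, append_update_left]
    rw [← B.map_update_smul, Prod.smul_mk, smul_zero]
  map_eq_zero_of_eq' r i j hij hne :=
    B.map_eq_zero_of_eq _ (i := Fin.castAdd k i) (j := Fin.castAdd k j)
      (by simp [Fin.append_left, hij]) (by simpa [Fin.ext_iff] using hne)

/-- The form already has a full basis of `G` among its arguments, so a vertical component in any
further argument is a combination of repeated vectors. -/
lemma append_frame_add_vertical {s k : ℕ} (B : (F × G) [⋀^Fin (s + k)]→L[ℝ] ℂ)
    (b : Module.Basis (Fin s) ℝ G) (v : Fin k → F) (w : Fin k → G) :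
    B (Fin.append (fun j ↦ ((0 : F), b j)) (fun j ↦ (v j, w j))) =
      B (Fin.append (fun j ↦ ((0 : F), b j)) (fun j ↦ (v j, (0 : G)))) := by
  have h := MultilinearMap.map_add_eq_of_update_eq_zero
    (contrFun rfl (fun j ↦ ((0 : F), b j)) (ContinuousLinearMap.id ℝ (F × G)) B).toMultilinearMap
    (fun j ↦ (v j, (0 : G))) (fun j ↦ ((0 : F), w j)) fun x i ↦ by
      have h1 : ((contrFun rfl (fun j ↦ ((0 : F), b j))
          (ContinuousLinearMap.id ℝ (F × G)) B).toMultilinearMap.toLinearMap x i) ∘ₗ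
          LinearMap.inr ℝ F G = 0 := by
        refine b.ext fun j ↦ ?_
        change B (Fin.append (fun j ↦ ((0 : F), b j)) (Function.update x i ((0 : F), b j))) = 0
        refine B.map_eq_zero_of_eq _ (i := Fin.castAdd k j) (j := Fin.natAdd s i) ?_ ?_
        · rw [Fin.append_left, Fin.append_right, Function.update_self]
        · simp [Fin.ext_iff]
          omega
      exact LinearMap.congr_fun h1 (w i)
  refine Eq.trans ?_ h
  change B (Fin.append (fun j ↦ ((0 : F), b j)) (fun j ↦ (v j, w j))) =
    B (Fin.append (fun j ↦ ((0 : F), b j)) (fun j ↦ (v j + 0, 0 + w j)))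
  simp

/-- As a function of the frame the form is of top degree on `G`, so applying `D` multiplies it by
`det D`. -/
lemma append_frame_eq {s k : ℕ} (B : (F × G) [⋀^Fin (s + k)]→L[ℝ] ℂ)
    (b : Module.Basis (Fin s) ℝ G) (D : G →ₗ[ℝ] G) (v : Fin k → F) (w : Fin k → G) :
    B (Fin.append (fun j ↦ ((0 : F), D (b j))) (fun j ↦ (v j, w j))) =
      LinearMap.det D • B (Fin.append (fun j ↦ ((0 : F), b j)) (fun j ↦ (v j, (0 : G)))) := by
  rw [← append_frame_add_vertical B b v w]
  exact alternating_map_comp b (verticalMap B fun j ↦ (v j, w j)) D b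

end Frame

/-! ### Independence of the fibre chart -/

namespace FiberChart
open MeasureTheory
variable {E : Type*} [NormedAddCommGroup E] [NormedSpace ℂ E]
  {F : Type*} [NormedAddCommGroup F] [NormedSpace ℂ F]
  {G : Type*} [NormedAddCommGroup G] [NormedSpace ℂ G]
  {M : Type*} [TopologicalSpace M] [ChartedSpace E M]
  {N : Type*} [TopologicalSpace N] [ChartedSpace F N]
  {f : M → N} (φ φ' : FiberChart E F G f)

/-- The part of a fibre over which two fibre charts are defined. -/
def overlap (y : N) : Set G :=
  {z | (φ.cod y, z) ∈ φ.dom.target ∧ φ.dom.symm (φ.cod y, z) ∈ φ'.dom.source}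

/-- The transition map between two fibre charts. -/
def transition : F × G → F × G := φ'.dom ∘ φ.dom.symm

variable {φ φ'} {y : N} (hy : y ∈ φ.cod.source) (hy' : y ∈ φ'.cod.source)

include hy in
lemma transition_fst {z : G} (hz : z ∈ overlap φ φ' y) :
    (transition φ φ' (φ.cod y, z)).1 = φ'.cod y := by
  rw [transition, Function.comp_apply, ← φ'.cod_map _ hz.2, φ.map_dom_symm hz.1 hy rfl]

include hy in
lemma transition_eq {z : G} (hz : z ∈ overlap φ φ' y) :
    transition φ φ' (φ.cod y, z) = (φ'.cod y, (transition φ φ' (φ.cod y, z)).2) :=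
  Prod.ext (transition_fst hy hz) rfl

include hy in
lemma dom_symm_transition {z : G} (hz : z ∈ overlap φ φ' y) :
    φ'.dom.symm (φ'.cod y, (transition φ φ' (φ.cod y, z)).2) = φ.dom.symm (φ.cod y, z) := by
  rw [← transition_eq hy hz, transition, Function.comp_apply, φ'.dom.left_inv hz.2]

include hy in
lemma transition_mem {z : G} (hz : z ∈ overlap φ φ' y) :
    (transition φ φ' (φ.cod y, z)).2 ∈ overlap φ' φ y := by
  refine ⟨?_, ?_⟩
  · rw [← transition_eq hy hz]
    exact φ'.dom.map_source hz.2
  · rw [dom_symm_transition hy hz]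
    exact φ.dom.map_target hz.1

include hy in
lemma transition_transition {z : G} (hz : z ∈ overlap φ φ' y) :
    (transition φ' φ (φ'.cod y, (transition φ φ' (φ.cod y, z)).2)).2 = z := by
  rw [← transition_eq hy hz, transition, transition, Function.comp_apply, Function.comp_apply,
    φ'.dom.left_inv hz.2, φ.dom.right_inv hz.1]

include hy hy' in
lemma image_overlap : (fun z ↦ (transition φ φ' (φ.cod y, z)).2) '' overlap φ φ' y =
    overlap φ' φ y := by
  refine Set.Subset.antisymm ?_ fun z hz ↦ ⟨_, transition_mem hy' hz, transition_transition hy' hz⟩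
  rintro _ ⟨z, hz, rfl⟩
  exact transition_mem hy hz

include hy in
lemma injOn_overlap : Set.InjOn (fun z ↦ (transition φ φ' (φ.cod y, z)).2) (overlap φ φ' y) :=
  fun z hz z' hz' h ↦ by
    rw [← transition_transition hy hz, ← transition_transition hy hz']
    exact congrArg (fun t ↦ (transition φ' φ (φ'.cod y, t)).2) h

variable (φ φ' y) in
lemma isOpen_overlap : IsOpen (overlap φ φ' y) := by
  have h1 : IsOpen (φ.dom.target ∩ φ.dom.symm ⁻¹' φ'.dom.source) :=
    φ.dom.continuousOn_symm.isOpen_inter_preimage φ.dom.open_target φ'.dom.open_source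
  exact h1.preimage (Continuous.prodMk_right (φ.cod y))

lemma contDiffAt_transition {z : G} (hz : z ∈ overlap φ φ' y) :
    ContDiffAt ℂ ω (transition φ φ') (φ.cod y, z) :=
  contMDiffAt_iff_contDiffAt.1
    ((φ'.contMDiffAt_dom hz.2).comp (φ.cod y, z) (φ.contMDiffAt_dom_symm hz.1))

-- Both charts turn `f` into the first projection, so the base component of a transition depends on
-- the base point alone. Its derivative is therefore block triangular.
include hy hy' in
lemma fst_fderiv_transition {z : G} (hz : z ∈ overlap φ φ' y) (p : F × G) :
    (fderiv ℂ (transition φ φ') (φ.cod y, z) p).1 =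
      fderiv ℂ (φ'.cod ∘ φ.cod.symm) (φ.cod y) p.1 := by
  have hT := ((contDiffAt_transition hz).differentiableAt (by simp)).hasFDerivAt
  have hC : ContDiffAt ℂ ω (φ'.cod ∘ φ.cod.symm) (φ.cod y) := by
    refine contMDiffAt_iff_contDiffAt.1 (ContMDiffAt.comp (φ.cod y) ?_
      (φ.contMDiffAt_cod_symm (φ.cod.map_source hy)))
    rw [φ.cod.left_inv hy]
    exact φ'.contMDiffAt_cod hy'
  have hC' := (hC.differentiableAt (by simp)).hasFDerivAt
  have h1 : HasFDerivAt (Prod.fst ∘ transition φ φ')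
      ((ContinuousLinearMap.fst ℂ F G).comp (fderiv ℂ (transition φ φ') (φ.cod y, z)))
      (φ.cod y, z) := hasFDerivAt_fst.comp _ hT
  have h2 : HasFDerivAt ((φ'.cod ∘ φ.cod.symm) ∘ Prod.fst)
      ((fderiv ℂ (φ'.cod ∘ φ.cod.symm) (φ.cod y)).comp (ContinuousLinearMap.fst ℂ F G))
      (φ.cod y, z) := HasFDerivAt.comp (f := Prod.fst) (φ.cod y, z) hC' hasFDerivAt_fst
  have h3 : Prod.fst ∘ transition φ φ' =ᶠ[𝓝 (φ.cod y, z)] (φ'.cod ∘ φ.cod.symm) ∘ Prod.fst := by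
    have h4 : IsOpen (φ.dom.target ∩ φ.dom.symm ⁻¹' φ'.dom.source) :=
      φ.dom.continuousOn_symm.isOpen_inter_preimage φ.dom.open_target φ'.dom.open_source
    filter_upwards [h4.mem_nhds hz] with p hp
    have h5 := φ.dom.map_target hp.1
    have h6 : f (φ.dom.symm p) = φ.cod.symm p.1 := by
      rw [← φ.cod.left_inv (φ.map_mem _ h5), φ.cod_map _ h5, φ.dom.right_inv hp.1]
    rw [Function.comp_apply, transition, Function.comp_apply, ← φ'.cod_map _ hp.2, h6]
    rfl
  exact congrArg (fun L : F × G →L[ℂ] F ↦ L p) ((h2.congr_of_eventuallyEq h3).unique h1).symm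

include hy hy' in
lemma tderiv_cod (u : F) : tderiv F F φ'.cod y u =
    fderiv ℂ (φ'.cod ∘ φ.cod.symm) (φ.cod y) (tderiv F F φ.cod y u) := by
  have h1 : φ'.cod =ᶠ[𝓝 y] (φ'.cod ∘ φ.cod.symm) ∘ φ.cod := by
    filter_upwards [φ.cod.open_source.mem_nhds hy] with y' hy''
    simp only [Function.comp_apply, φ.cod.left_inv hy'']
  have hC : ContMDiffAt 𝓘(ℂ, F) 𝓘(ℂ, F) ω (φ'.cod ∘ φ.cod.symm) (φ.cod y) := by
    refine ContMDiffAt.comp (φ.cod y) ?_ (φ.contMDiffAt_cod_symm (φ.cod.map_source hy))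
    rw [φ.cod.left_inv hy]
    exact φ'.contMDiffAt_cod hy'
  rw [tderiv_congr h1, tderiv_comp (E' := F) y (hC.mdifferentiableAt (by simp))
    ((φ.contMDiffAt_cod hy).mdifferentiableAt (by simp)), tderiv_flat]
  rfl

include hy in
lemma expr_eq_comp {q : ℕ} (a : Form E M q) {z : G} (hz : z ∈ overlap φ φ' y) :
    φ.expr a (φ.cod y, z) =
      (φ'.expr a (φ'.cod y, (transition φ φ' (φ.cod y, z)).2)).compContinuousLinearMap
        ((fderiv ℂ (transition φ φ') (φ.cod y, z)).restrictScalars ℝ) := by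
  have hm := (transition_mem hy hz).1
  have h1 : (φ.dom.symm : F × G → M) =ᶠ[𝓝 (φ.cod y, z)] φ'.dom.symm ∘ transition φ φ' := by
    have h4 : IsOpen (φ.dom.target ∩ φ.dom.symm ⁻¹' φ'.dom.source) :=
      φ.dom.continuousOn_symm.isOpen_inter_preimage φ.dom.open_target φ'.dom.open_source
    filter_upwards [h4.mem_nhds hz] with p hp
    simp only [transition, Function.comp_apply, φ'.dom.left_inv hp.2]
  have h2 : MDifferentiableAt 𝓘(ℂ, F × G) 𝓘(ℂ, E) φ'.dom.symm (transition φ φ' (φ.cod y, z)) := by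
    rw [transition_eq hy hz]
    exact (φ'.contMDiffAt_dom_symm hm).mdifferentiableAt (by simp)
  have h3 : MDifferentiableAt 𝓘(ℂ, F × G) 𝓘(ℂ, F × G) (transition φ φ') (φ.cod y, z) :=
    ((contDiffAt_transition hz).differentiableAt (by simp)).mdifferentiableAt
  rw [φ.expr_of_mem _ hz.1, φ'.expr_of_mem _ hm, pull_apply_congr a h1, pull_comp_apply a h2 h3,
    pull_flat, ← transition_eq hy hz]

end FiberChart

namespace FiberChart
open MeasureTheory
variable {E : Type*} [NormedAddCommGroup E] [NormedSpace ℂ E]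
  {F : Type*} [NormedAddCommGroup F] [NormedSpace ℂ F]
  {G : Type*} [NormedAddCommGroup G] [NormedSpace ℂ G]
  {M : Type*} [TopologicalSpace M] [ChartedSpace E M]
  {N : Type*} [TopologicalSpace N] [ChartedSpace F N]
  {f : M → N}

lemma det_restrictScalars_nonneg (L : G →ₗ[ℂ] G) : 0 ≤ LinearMap.det (L.restrictScalars ℝ) := by
  rw [LinearMap.det_restrictScalars, Algebra.norm_complex_apply]
  exact Complex.normSq_nonneg _

/-- The derivative of a transition map along the fibre. -/
def vertDeriv (φ φ' : FiberChart E F G f) (y : N) (z : G) : G →L[ℂ] G :=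
  (ContinuousLinearMap.snd ℂ F G).comp
    ((fderiv ℂ (transition φ φ') (φ.cod y, z)).comp (ContinuousLinearMap.inr ℂ F G))

lemma hasFDerivAt_transition_snd {φ φ' : FiberChart E F G f} {y : N} {z : G}
    (hz : z ∈ overlap φ φ' y) :
    HasFDerivAt (𝕜 := ℝ) (fun z ↦ (transition φ φ' (φ.cod y, z)).2)
      ((vertDeriv φ φ' y z).restrictScalars ℝ) z := by
  have h1 := ((contDiffAt_transition hz).differentiableAt (by simp)).hasFDerivAt
  have h2 : HasFDerivAt (𝕜 := ℂ) (fun z : G ↦ (φ.cod y, z)) (ContinuousLinearMap.inr ℂ F G) z :=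
    hasFDerivAt_prodMk_right _ _
  exact (hasFDerivAt_snd.comp z (h1.comp z h2)).restrictScalars ℝ

variable [FiniteDimensional ℂ F] [FiniteDimensional ℂ G] [IsManifold 𝓘(ℂ, E) ω M]
  [MeasurableSpace G] [BorelSpace G] (μ : Measure G) [μ.IsAddHaarMeasure] {s k q : ℕ}
  {K : Set M} {a : Form E M q}

lemma push_apply (φ : FiberChart E F G f) (h : q = s + k) (R : Fin s → G)
    (hK : IsCompact K) (hKs : K ⊆ φ.dom.source) (ha : ∀ x ∉ K, a x = 0)
    (hs : ∀ x, SmoothAt a x) {y : N} (hy : y ∈ φ.cod.source) (u : Fin k → F) :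
    φ.push μ h R a y u = ∫ z, φ.expr a (φ.cod y, z) (Fin.append (fun j ↦ ((0 : F), R j))
      (fun j ↦ (tderiv F F φ.cod y (u j), (0 : G))) ∘ Fin.cast h) ∂μ := by
  rw [push_of_mem _ _ _ _ _ hy, pull_apply]
  exact fiberInt_apply μ h R (φ.contDiff_expr hK hKs ha hs).continuous
    (φ.hasCompactSupport_expr hK hKs ha) _ _

/-- By the triangular shape of the transition derivative the integrands differ by the real
determinant of the derivative along the fibre. This derivative is complex-linear, so the determinant
is nonnegative and equals the Jacobian of the change of variables. The frame and the measure are the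
same in both charts, so no constant appears. -/
theorem push_eq_push (φ φ' : FiberChart E F G f) (h : q = s + k) (b : Module.Basis (Fin s) ℝ G)
    (hK : IsCompact K) (hKs : K ⊆ φ.dom.source) (hKs' : K ⊆ φ'.dom.source)
    (ha : ∀ x ∉ K, a x = 0) (hs : ∀ x, SmoothAt a x) :
    φ.push μ h b a = φ'.push μ h b a := by
  subst h
  funext y
  -- Off the image of `K` both sides vanish; on it `y` lies in both base charts, as the comparison
  -- of integrals requires.
  by_cases hyK : y ∈ f '' K
  swap
  · rw [push_eq_zero _ _ _ _ ha hyK, push_eq_zero _ _ _ _ ha hyK]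
  obtain ⟨x, hx, rfl⟩ := hyK
  have hy := φ.map_mem x (hKs hx)
  have hy' := φ'.map_mem x (hKs' hx)
  set y := f x
  ext u
  rw [push_apply μ φ rfl b hK hKs ha hs hy, push_apply μ φ' rfl b hK hKs' ha hs hy']
  set I : G → ℂ := fun z ↦ φ.expr a (φ.cod y, z) (Fin.append (fun j ↦ ((0 : F), b j))
    (fun j ↦ (tderiv F F φ.cod y (u j), (0 : G)))) with hI
  set I' : G → ℂ := fun z ↦ φ'.expr a (φ'.cod y, z) (Fin.append (fun j ↦ ((0 : F), b j))
    (fun j ↦ (tderiv F F φ'.cod y (u j), (0 : G)))) with hI'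
  have key : ∀ z ∈ overlap φ φ' y, I z = |((vertDeriv φ φ' y z).restrictScalars ℝ).det| •
      I' (transition φ φ' (φ.cod y, z)).2 := fun z hz ↦ by
    have hdet : 0 ≤ ((vertDeriv φ φ' y z).restrictScalars ℝ).det :=
      det_restrictScalars_nonneg (vertDeriv φ φ' y z).toLinearMap
    rw [abs_of_nonneg hdet]
    have h1 := append_frame_eq (φ'.expr a (φ'.cod y, (transition φ φ' (φ.cod y, z)).2)) b
      ((vertDeriv φ φ' y z).restrictScalars ℝ).toLinearMap
      (fun j ↦ tderiv F F φ'.cod y (u j))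
      (fun j ↦ (fderiv ℂ (transition φ φ') (φ.cod y, z) (tderiv F F φ.cod y (u j), 0)).2)
    refine Eq.trans ?_ h1
    simp only [hI, expr_eq_comp hy a hz]
    change φ'.expr a _ (fun i ↦ fderiv ℂ (transition φ φ') (φ.cod y, z) _) = φ'.expr a _ _
    congr 1
    funext i
    refine Fin.addCases (fun j ↦ ?_) (fun j ↦ ?_) i
    · simp only [Fin.append_left]
      refine Prod.ext ?_ rfl
      rw [fst_fderiv_transition hy hy' hz, map_zero]
    · simp only [Fin.append_right]
      refine Prod.ext ?_ rfl
      rw [fst_fderiv_transition hy hy' hz, tderiv_cod hy hy']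
  have hz0 : ∀ (ψ ψ' : FiberChart E F G f), K ⊆ ψ'.dom.source → ∀ (v) (z : G), z ∉ overlap ψ ψ' y →
      ψ.expr a (ψ.cod y, z) v = 0 := fun ψ ψ' hψ v z hz ↦ by
    rw [ψ.expr_eq_zero fun ht ↦ ha _ fun hm ↦ hz ⟨ht, hψ hm⟩]
    rfl
  have hm := (isOpen_overlap φ φ' y).measurableSet
  calc ∫ z, I z ∂μ = ∫ z in overlap φ φ' y, I z ∂μ :=
        (setIntegral_eq_integral_of_forall_compl_eq_zero fun z hz ↦ hz0 φ φ' hKs' _ z hz).symm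
    _ = ∫ z in overlap φ φ' y, |((vertDeriv φ φ' y z).restrictScalars ℝ).det| •
          I' (transition φ φ' (φ.cod y, z)).2 ∂μ := setIntegral_congr_fun hm key
    _ = ∫ z in (fun z ↦ (transition φ φ' (φ.cod y, z)).2) '' overlap φ φ' y, I' z ∂μ :=
        (integral_image_eq_integral_abs_det_fderiv_smul μ hm
          (fun z hz ↦ (hasFDerivAt_transition_snd hz).hasFDerivWithinAt) (injOn_overlap hy) _).symm
    _ = ∫ z in overlap φ' φ y, I' z ∂μ := by rw [image_overlap hy hy']
    _ = ∫ z, I' z ∂μ :=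
        setIntegral_eq_integral_of_forall_compl_eq_zero fun z hz ↦ hz0 φ' φ hKs _ z hz

lemma push_add (φ : FiberChart E F G f) (h : q = s + k) (R : Fin s → G)
    (hK : IsCompact K) (hKs : K ⊆ φ.dom.source) {a b : Form E M q}
    (ha : ∀ x ∉ K, a x = 0) (hs : ∀ x, SmoothAt a x)
    (hb : ∀ x ∉ K, b x = 0) (hsb : ∀ x, SmoothAt b x) :
    φ.push μ h R (a + b) = φ.push μ h R a + φ.push μ h R b := by
  funext y
  rw [Pi.add_apply]
  by_cases hy : y ∈ φ.cod.source
  swap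
  · simp only [push, if_neg hy, add_zero]
  have hint : ∀ {c : Form E M q}, (∀ x ∉ K, c x = 0) → (∀ x, SmoothAt c x) →
      ∀ v : Fin q → F × G, Integrable (fun z ↦ φ.expr c (φ.cod y, z) v) μ := fun hc hsc v ↦
    (ContinuousAlternatingMap.apply ℝ (F × G) ℂ v).integrable_comp (integrable_slice μ
      (φ.contDiff_expr hK hKs hc hsc).continuous (φ.hasCompactSupport_expr hK hKs hc) _)
  ext u
  rw [ContinuousAlternatingMap.add_apply, push_apply μ φ h R hK hKs ha hs hy, push_apply μ φ h R hK hKs hb hsb hy,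
    push_apply μ φ h R hK hKs (fun x hx ↦ by rw [Pi.add_apply, ha x hx, hb x hx, add_zero])
      (fun x ↦ (hs x).add (hsb x)) hy, ← integral_add (hint ha hs _) (hint hb hsb _)]
  congr 1
  funext z
  by_cases hz : (φ.cod y, z) ∈ φ.dom.target
  · simp only [expr_of_mem _ _ hz, pull_apply, Pi.add_apply]
    rfl
  · simp only [expr_eq_zero _ fun h ↦ absurd h hz]
    change (0 : ℂ) = 0 + 0
    rw [add_zero]

omit [IsManifold 𝓘(ℂ, E) ω M] in
lemma push_zero (φ : FiberChart E F G f) (h : q = s + k) (R : Fin s → G) :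
    φ.push μ h R (0 : Form E M q) = 0 := by
  funext y
  exact φ.push_eq_zero μ h R (K := ∅) (fun _ _ ↦ rfl) (by simp)

lemma push_sum {ι : Type*} (S : Finset ι) (φ : FiberChart E F G f) (h : q = s + k) (R : Fin s → G)
    (hK : IsCompact K) (hKs : K ⊆ φ.dom.source) {a : ι → Form E M q}
    (ha : ∀ i, ∀ x ∉ K, a i x = 0) (hs : ∀ i x, SmoothAt (a i) x) :
    φ.push μ h R (∑ i ∈ S, a i) = ∑ i ∈ S, φ.push μ h R (a i) := by
  classical
  induction S using Finset.induction_on with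
  | empty => simp only [Finset.sum_empty, push_zero]
  | insert i S hi ih =>
    rw [Finset.sum_insert hi, Finset.sum_insert hi, push_add μ φ h R hK hKs (ha i) (hs i) _ _, ih]
    · intro x hx
      rw [Finset.sum_apply]
      exact Finset.sum_eq_zero fun j _ ↦ ha j x hx
    · exact fun x ↦ SmoothAt.sum S fun j _ ↦ hs j x

end FiberChart

/-! ### Reality, type and positivity of the push-forward -/

section PairsAppend
variable {V : Type*} [NormedAddCommGroup V] [NormedSpace ℂ V]

lemma pairs_apply {k : ℕ} (v : Fin k → V) (i : Fin (2 * k)) :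
    pairs v i = if (i : ℕ) % 2 = 0 then v ⟨i / 2, by omega⟩ else Complex.I • v ⟨i / 2, by omega⟩ := by
  induction k with
  | zero => exact i.elim0
  | succ k ih =>
    obtain ⟨i, hi⟩ := i
    rcases i with _ | _ | i
    · rw [if_pos (by simp)]
      change v 0 = _
      exact congrArg v (Fin.ext (by simp))
    · rw [if_neg (by simp)]
      change Complex.I • v 0 = _
      exact congrArg (fun j ↦ Complex.I • v j) (Fin.ext (by simp))
    · have h1 := ih (Fin.tail v) ⟨i, by omega⟩
      have h2 : (i + 1 + 1) / 2 = i / 2 + 1 := by omega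
      have h3 : (i + 1 + 1) % 2 = i % 2 := by omega
      refine h1.trans ?_
      simp only [h2, h3]
      rfl

lemma append_pairs {d m : ℕ} (h : 2 * (d + m) = 2 * d + 2 * m) (g : Fin d → V) (v : Fin m → V) :
    Fin.append (pairs g) (pairs v) ∘ Fin.cast h = pairs (Fin.append g v) := by
  funext i
  rw [Function.comp_apply, pairs_apply]
  by_cases hi : (i : ℕ) < 2 * d
  · have h1 : Fin.cast h i = Fin.castAdd (2 * m) ⟨i, hi⟩ := rfl
    have h2 : (⟨i / 2, by omega⟩ : Fin (d + m)) = Fin.castAdd m ⟨i / 2, by omega⟩ := rfl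
    rw [h1, h2, Fin.append_left, Fin.append_left, pairs_apply]
  · have h1 : Fin.cast h i = Fin.natAdd (2 * d) ⟨i - 2 * d, by omega⟩ := by
      ext
      simp only [Fin.val_cast, Fin.natAdd_mk]
      omega
    have h2 : (⟨i / 2, by omega⟩ : Fin (d + m)) = Fin.natAdd d ⟨(i - 2 * d) / 2, by omega⟩ := by
      ext
      simp only [Fin.natAdd_mk]
      omega
    have h3 : ((i : ℕ) - 2 * d) % 2 = i % 2 := by omega
    rw [h1, h2, Fin.append_right, Fin.append_right, pairs_apply]
    simp only [h3]

lemma linearIndependent_append {F G : Type*} [AddCommGroup F] [Module ℂ F] [AddCommGroup G]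
    [Module ℂ G] {d m : ℕ} {g : Fin d → G} {v : Fin m → F} (hg : LinearIndependent ℂ g)
    (hv : LinearIndependent ℂ v) :
    LinearIndependent ℂ (Fin.append (fun j ↦ ((0 : F), g j)) (fun j ↦ (v j, (0 : G)))) := by
  have h1 := (linearIndependent_inl_union_inr' hv hg).comp
    ((Equiv.sumComm _ _) ∘ finSumFinEquiv.symm)
    ((Equiv.injective _).comp (Equiv.injective _))
  convert h1 using 1
  funext i
  refine Fin.addCases (fun j ↦ ?_) (fun j ↦ ?_) i <;> simp

end PairsAppend

section
variable {E : Type*} [NormedAddCommGroup E] [NormedSpace ℂ E]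
  {F : Type*} [NormedAddCommGroup F] [NormedSpace ℂ F]
  {G : Type*} [NormedAddCommGroup G] [NormedSpace ℂ G]
  {M : Type*} [TopologicalSpace M] [ChartedSpace E M]
  {N : Type*} [TopologicalSpace N] [ChartedSpace F N]
  {f : M → N}

lemma tderiv_injective {ψ : M → N} {φ : N → M} {x : M}
    (hψ : MDifferentiableAt 𝓘(ℂ, E) 𝓘(ℂ, F) ψ x) (hφ : MDifferentiableAt 𝓘(ℂ, F) 𝓘(ℂ, E) φ (ψ x))
    (h : φ ∘ ψ =ᶠ[𝓝 x] id) : Function.Injective (tderiv E F ψ x) := by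
  have h1 := tderiv_congr (E' := E) (E := E) h
  rw [tderiv_id, tderiv_comp x hφ hψ] at h1
  exact Function.LeftInverse.injective (g := tderiv F E φ (ψ x))
    fun v ↦ congrArg (fun L : E →L[ℂ] E ↦ L v) h1

namespace FiberChart
variable (φ : FiberChart E F G f)

lemma tderiv_cod_injective {y : N} (hy : y ∈ φ.cod.source) :
    Function.Injective (tderiv F F φ.cod y) := by
  refine tderiv_injective (φ := φ.cod.symm) ((φ.contMDiffAt_cod hy).mdifferentiableAt (by simp))
    ((φ.contMDiffAt_cod_symm (φ.cod.map_source hy)).mdifferentiableAt (by simp)) ?_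
  filter_upwards [φ.cod.open_source.mem_nhds hy] with z hz
  exact φ.cod.left_inv hz

lemma tderiv_dom_symm_injective {p : F × G} (hp : p ∈ φ.dom.target) :
    Function.Injective (tderiv (F × G) E φ.dom.symm p) := by
  refine tderiv_injective (φ := φ.dom) ((φ.contMDiffAt_dom_symm hp).mdifferentiableAt (by simp))
    ((φ.contMDiffAt_dom (φ.dom.map_target hp)).mdifferentiableAt (by simp)) ?_
  filter_upwards [φ.dom.open_target.mem_nhds hp] with z hz
  exact φ.dom.right_inv hz

open MeasureTheory
variable [FiniteDimensional ℂ F] [FiniteDimensional ℂ G] [IsManifold 𝓘(ℂ, E) ω M]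
  [MeasurableSpace G] [BorelSpace G] (μ : Measure G) [μ.IsAddHaarMeasure] {s k q : ℕ}
  {K : Set M} {a : Form E M q}

lemma push_im (h : q = s + k) (R : Fin s → G)
    (hK : IsCompact K) (hKs : K ⊆ φ.dom.source) (ha : ∀ x ∉ K, a x = 0)
    (hs : ∀ x, SmoothAt a x) (hr : ∀ x v, (a x v).im = 0) (y : N) (u : Fin k → F) :
    (φ.push μ h R a y u).im = 0 := by
  by_cases hy : y ∈ φ.cod.source
  swap
  · rw [push, if_neg hy]
    rfl
  rw [push_apply μ φ h R hK hKs ha hs hy]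
  have h1 : ∀ p v, ((φ.expr a p v).re : ℂ) = φ.expr a p v := fun p v ↦ by
    refine Complex.ext rfl ?_
    rw [Complex.ofReal_im]
    by_cases hp : p ∈ φ.dom.target
    · rw [expr_of_mem _ _ hp]
      exact (hr _ _).symm
    · rw [expr_eq_zero _ fun h ↦ absurd h hp]
      rfl
  refine (congrArg Complex.im (integral_congr_ae (.of_forall fun z ↦ (h1 _ _).symm))).trans ?_
  rw [integral_complex_ofReal, Complex.ofReal_im]

/-- The fibre frame may be multiplied by `i` without changing the integrand, since this has real
determinant one on `G`. Then all arguments are multiplied by `i`, and the invariance of `a` applies.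
-/
lemma push_comp_mulI (h : q = s + k) (b : Module.Basis (Fin s) ℝ G)
    (hK : IsCompact K) (hKs : K ⊆ φ.dom.source) (ha : ∀ x ∉ K, a x = 0)
    (hs : ∀ x, SmoothAt a x) (hI : ∀ x, (a x).compContinuousLinearMap (mulI E) = a x) (y : N) :
    (φ.push μ h b a y).compContinuousLinearMap (mulI F) = φ.push μ h b a y := by
  subst h
  by_cases hy : y ∈ φ.cod.source
  swap
  · rw [push, if_neg hy]
    rfl
  ext u
  rw [ContinuousAlternatingMap.compContinuousLinearMap_apply, push_apply μ φ rfl b hK hKs ha hs hy,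
    push_apply μ φ rfl b hK hKs ha hs hy]
  congr 1
  funext z
  have h1 : (φ.expr a (φ.cod y, z)).compContinuousLinearMap (mulI (F × G)) =
      φ.expr a (φ.cod y, z) := by
    by_cases hp : (φ.cod y, z) ∈ φ.dom.target
    · rw [expr_of_mem _ _ hp, pull_apply]
      conv_rhs => rw [← hI]
      ext v
      change a _ (fun i ↦ tderiv (F × G) E φ.dom.symm _ (Complex.I • v i)) =
        a _ (fun i ↦ Complex.I • tderiv (F × G) E φ.dom.symm _ (v i))
      simp only [(tderiv (F × G) E φ.dom.symm (φ.cod y, z)).map_smul]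
    · rw [expr_eq_zero _ fun h ↦ absurd h hp]
      rfl
  have h2 : LinearMap.det (mulI G).toLinearMap = 1 := by
    change LinearMap.det ((Complex.I • (LinearMap.id : G →ₗ[ℂ] G)).restrictScalars ℝ) = 1
    rw [LinearMap.det_restrictScalars, Algebra.norm_complex_apply, LinearMap.det_smul,
      LinearMap.det_id, mul_one, map_pow, Complex.normSq_I, one_pow]
  have h3 := append_frame_eq (φ.expr a (φ.cod y, z)) b (mulI G).toLinearMap
    (fun j ↦ tderiv F F φ.cod y (Complex.I • u j)) (fun _ ↦ 0)
  rw [h2, one_smul] at h3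
  refine h3.symm.trans ?_
  conv_rhs => rw [← h1]
  rw [ContinuousAlternatingMap.compContinuousLinearMap_apply]
  congr 1
  funext i
  refine Fin.addCases (fun j ↦ ?_) (fun j ↦ ?_) i
  · simp only [Fin.append_left, Function.comp_apply, Fin.cast_eq_self]
    exact Prod.ext (smul_zero Complex.I).symm rfl
  · simp only [Fin.append_right, Function.comp_apply, Fin.cast_eq_self]
    refine Prod.ext ?_ (smul_zero Complex.I).symm
    exact (tderiv F F φ.cod y).map_smul Complex.I (u j)

variable {d m : ℕ}

-- When the fibre frame and the base arguments both come from complex tuples, the integrand is a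
-- value of `a` on a single complex tuple of length `d + m`. So positivity of `a` on complex frames
-- passes to the integrand.
omit [FiniteDimensional ℂ F] [FiniteDimensional ℂ G] [IsManifold 𝓘(ℂ, E) ω M]
  [MeasurableSpace G] [BorelSpace G] in
lemma expr_pairs {a : Form E M (2 * (d + m))} (h : 2 * (d + m) = 2 * d + 2 * m) (b : Fin d → G)
    {y : N} {z : G} (hz : (φ.cod y, z) ∈ φ.dom.target) (v : Fin m → F) :
    φ.expr a (φ.cod y, z) (Fin.append (fun j ↦ ((0 : F), pairs b j))
      (fun j ↦ (tderiv F F φ.cod y (pairs v j), (0 : G))) ∘ Fin.cast h) =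
    a (φ.dom.symm (φ.cod y, z)) (pairs fun i ↦ tderiv (F × G) E φ.dom.symm (φ.cod y, z)
      (Fin.append (fun j ↦ ((0 : F), b j)) (fun j ↦ (tderiv F F φ.cod y (v j), (0 : G))) i)) := by
  have h1 : (fun j ↦ ((0 : F), pairs b j)) = pairs (fun j ↦ ((0 : F), b j)) :=
    funext fun j ↦ map_pairs (ContinuousLinearMap.inr ℂ F G) b j
  have h2 : (fun j ↦ (tderiv F F φ.cod y (pairs v j), (0 : G))) =
      pairs (fun j ↦ (tderiv F F φ.cod y (v j), (0 : G))) :=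
    funext fun j ↦ map_pairs ((ContinuousLinearMap.inl ℂ F G).comp (tderiv F F φ.cod y)) v j
  rw [h1, h2, append_pairs, expr_of_mem _ _ hz, pull_apply]
  exact congrArg (a _) (funext fun i ↦ map_pairs _ _ i)

omit [FiniteDimensional ℂ F] [FiniteDimensional ℂ G] [IsManifold 𝓘(ℂ, E) ω M]
  [MeasurableSpace G] [BorelSpace G] in
lemma linearIndependent_frame {b : Fin d → G} (hb : LinearIndependent ℂ b) {y : N}
    (hy : y ∈ φ.cod.source) {z : G} (hz : (φ.cod y, z) ∈ φ.dom.target) {v : Fin m → F}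
    (hv : LinearIndependent ℂ v) :
    LinearIndependent ℂ fun i ↦ tderiv (F × G) E φ.dom.symm (φ.cod y, z)
      (Fin.append (fun j ↦ ((0 : F), b j)) (fun j ↦ (tderiv F F φ.cod y (v j), (0 : G))) i) :=
  (linearIndependent_append hb (hv.map' (tderiv F F φ.cod y).toLinearMap
    (LinearMap.ker_eq_bot.2 (φ.tderiv_cod_injective hy)))).map'
    (tderiv (F × G) E φ.dom.symm (φ.cod y, z)).toLinearMap
    (LinearMap.ker_eq_bot.2 (φ.tderiv_dom_symm_injective hz))

variable {a : Form E M (2 * (d + m))} {b : Fin d → G}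

omit [FiniteDimensional ℂ F] [FiniteDimensional ℂ G] [IsManifold 𝓘(ℂ, E) ω M]
  [MeasurableSpace G] [BorelSpace G] in
lemma re_expr_pairs_nonneg (h : 2 * (d + m) = 2 * d + 2 * m) (hb : LinearIndependent ℂ b)
    (hpos : ∀ x v, LinearIndependent ℂ v → 0 ≤ (a x (pairs v)).re) {y : N}
    (hy : y ∈ φ.cod.source) {v : Fin m → F} (hv : LinearIndependent ℂ v) (z : G) :
    0 ≤ (φ.expr a (φ.cod y, z) (Fin.append (fun j ↦ ((0 : F), pairs b j))
      (fun j ↦ (tderiv F F φ.cod y (pairs v j), (0 : G))) ∘ Fin.cast h)).re := by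
  by_cases hz : (φ.cod y, z) ∈ φ.dom.target
  · rw [expr_pairs φ h b hz]
    exact hpos _ _ (φ.linearIndependent_frame hb hy hz hv)
  · rw [expr_eq_zero _ fun h ↦ absurd h hz]
    exact le_rfl

lemma re_push_pairs (h : 2 * (d + m) = 2 * d + 2 * m)
    (hK : IsCompact K) (hKs : K ⊆ φ.dom.source) (ha : ∀ x ∉ K, a x = 0)
    (hs : ∀ x, SmoothAt a x) {y : N} (hy : y ∈ φ.cod.source) (v : Fin m → F) :
    (φ.push μ h (pairs b) a y (pairs v)).re =
      ∫ z, (φ.expr a (φ.cod y, z) (Fin.append (fun j ↦ ((0 : F), pairs b j))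
      (fun j ↦ (tderiv F F φ.cod y (pairs v j), (0 : G))) ∘ Fin.cast h)).re ∂μ := by
  rw [push_apply μ φ h _ hK hKs ha hs hy]
  refine (integral_re (𝕜 := ℂ) ?_).symm
  exact (ContinuousAlternatingMap.apply ℝ (F × G) ℂ _).integrable_comp (integrable_slice μ
    (φ.contDiff_expr hK hKs ha hs).continuous (φ.hasCompactSupport_expr hK hKs ha) _)

lemma re_push_pairs_nonneg (h : 2 * (d + m) = 2 * d + 2 * m) (hb : LinearIndependent ℂ b)
    (hK : IsCompact K) (hKs : K ⊆ φ.dom.source) (ha : ∀ x ∉ K, a x = 0)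
    (hs : ∀ x, SmoothAt a x) (hpos : ∀ x v, LinearIndependent ℂ v → 0 ≤ (a x (pairs v)).re)
    (y : N) {v : Fin m → F} (hv : LinearIndependent ℂ v) :
    0 ≤ (φ.push μ h (pairs b) a y (pairs v)).re := by
  by_cases hy : y ∈ φ.cod.source
  · rw [re_push_pairs φ μ h hK hKs ha hs hy]
    exact integral_nonneg fun z ↦ φ.re_expr_pairs_nonneg h hb hpos hy hv z
  · rw [push, if_neg hy]
    exact le_rfl

/-- The integrand is continuous, compactly supported and nonnegative, and it is positive at the
fibre coordinate of `x`. -/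
lemma re_push_pairs_pos (h : 2 * (d + m) = 2 * d + 2 * m) (hb : LinearIndependent ℂ b)
    (hK : IsCompact K) (hKs : K ⊆ φ.dom.source) (ha : ∀ x ∉ K, a x = 0)
    (hs : ∀ x, SmoothAt a x) (hpos : ∀ x v, LinearIndependent ℂ v → 0 ≤ (a x (pairs v)).re)
    {x : M} (hx : x ∈ φ.dom.source) (hxpos : ∀ v, LinearIndependent ℂ v → 0 < (a x (pairs v)).re)
    {v : Fin m → F} (hv : LinearIndependent ℂ v) :
    0 < (φ.push μ h (pairs b) a (f x) (pairs v)).re := by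
  have hy := φ.map_mem x hx
  have hcx : (φ.cod (f x), (φ.dom x).2) = φ.dom x := Prod.ext (φ.cod_map x hx) rfl
  rw [re_push_pairs φ μ h hK hKs ha hs hy]
  have hc1 := (φ.contDiff_expr hK hKs ha hs).continuous
  have hc2 := φ.hasCompactSupport_expr hK hKs ha
  obtain ⟨C, hC, hC'⟩ := exists_compact_snd hc2
  refine Continuous.integral_pos_of_hasCompactSupport_nonneg_nonzero (x := (φ.dom x).2) ?_ ?_
    (fun z ↦ φ.re_expr_pairs_nonneg h hb hpos hy hv z) ?_
  · exact Complex.continuous_re.comp ((ContinuousAlternatingMap.apply ℝ (F × G) ℂ _).continuous.comp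
      (hc1.comp (Continuous.prodMk_right _)))
  · refine HasCompactSupport.intro hC fun z hz ↦ ?_
    rw [image_eq_zero_of_notMem_tsupport (hC' (φ.cod (f x)) z hz)]
    rfl
  · have ht : (φ.cod (f x), (φ.dom x).2) ∈ φ.dom.target := by
      rw [hcx]
      exact φ.dom.map_source hx
    have hsx : φ.dom.symm (φ.cod (f x), (φ.dom x).2) = x := by rw [hcx, φ.dom.left_inv hx]
    simp only [expr_pairs φ h b ht, hsx]
    exact (hxpos _ (φ.linearIndependent_frame hb hy ht hv)).ne'

end FiberChart
end

/-! ### The global push-forward -/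

section Pushforward
open MeasureTheory
variable {E : Type*} [NormedAddCommGroup E] [NormedSpace ℂ E]
  {F : Type*} [NormedAddCommGroup F] [NormedSpace ℂ F]
  {G : Type*} [NormedAddCommGroup G] [NormedSpace ℂ G]
  {M : Type*} [TopologicalSpace M] [ChartedSpace E M]
  {N : Type*} [TopologicalSpace N] [ChartedSpace F N]
  {f : M → N}

lemma SmoothAt.smul {k : ℕ} {r : M → ℝ} {a : Form E M k} {x : M}
    (hr : ContMDiffAt 𝓘(ℝ, E) 𝓘(ℝ, ℝ) ∞ r x) (ha : SmoothAt a x) :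
    SmoothAt (fun x ↦ r x • a x) x := by
  have h1 := (contMDiffAt_iff.1 hr).2
  rw [modelWithCornersSelf_coe, Set.range_id, contDiffWithinAt_univ] at h1
  exact ContDiffAt.smul h1 ha

lemma isManifold_real [IsManifold 𝓘(ℂ, E) ω M] : IsManifold 𝓘(ℝ, E) ∞ M := by
  refine isManifold_of_contDiffOn _ _ _ fun e e' he he' ↦ ?_
  have h1 := (contDiffGroupoid ω 𝓘(ℂ, E)).compatible he he'
  rw [contDiffGroupoid, mem_groupoid_of_pregroupoid] at h1
  exact (ContDiffOn.restrict_scalars ℝ h1.1).of_le (by simp)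

variable [FiniteDimensional ℂ E] [FiniteDimensional ℂ F] [FiniteDimensional ℂ G]
  [T2Space M] [CompactSpace M] [IsManifold 𝓘(ℂ, E) ω M]
  [T2Space N] [IsManifold 𝓘(ℂ, F) ω N]

/-- The push-forward is the sum of local push-forwards of the pieces `ρ i • a` of a partition of
unity. The Haar measure and the basis of `G` are chosen once for all charts, so that the pieces are
compatible. -/
theorem exists_pushforward (hf : Continuous f)
    (hφ : ∀ x, ∃ φ : FiberChart E F G f, x ∈ φ.dom.source) :
    ∃ P : ∀ q k : ℕ, q = 2 * Module.finrank ℂ G + k → Form E M q → Form F N k,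
      (∀ (q k : ℕ) (h : q = 2 * Module.finrank ℂ G + k) (a : Form E M q),
        (∀ x, SmoothAt a x) → (∀ y, SmoothAt (P _ _ h a) y) ∧
          ∀ c, dc c (P _ _ h a) = P (q + 1) (k + 1) (congrArg Nat.succ h) (dc c a)) ∧
      ∀ (m : ℕ) (h : 2 * (Module.finrank ℂ G + m) = 2 * Module.finrank ℂ G + 2 * m)
        (a : Form E M (2 * (Module.finrank ℂ G + m))), (∀ x, SmoothAt a x) →
        (∀ x, IsCopositive (a x)) → ∀ x, IsCopositive (P _ _ h a (f x)) := by
  set d := Module.finrank ℂ G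
  have := isManifold_real (E := E) (M := M)
  let _ : MeasurableSpace G := borel G
  have : BorelSpace G := ⟨rfl⟩
  set μ : Measure G := Measure.addHaar
  set b : Module.Basis (Fin d) ℂ G := Module.finBasis ℂ G
  obtain ⟨B, hB⟩ := exists_basis_eq_pairs b
  choose φ' hφ' using hφ
  obtain ⟨t, -, ht⟩ := isCompact_univ.elim_nhds_subcover (fun x : M ↦ (φ' x).dom.source)
    fun x _ ↦ (φ' x).dom.open_source.mem_nhds (hφ' x)
  set φ : t → FiberChart E F G f := fun i ↦ φ' i
  obtain ⟨ρ, hρ⟩ := SmoothPartitionOfUnity.exists_isSubordinate 𝓘(ℝ, E) (M := M) isClosed_univ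
    (fun i : t ↦ (φ i).dom.source) (fun i ↦ (φ i).dom.open_source) fun x hx ↦ by
      obtain ⟨i, hi, hx'⟩ := Set.mem_iUnion₂.1 (ht hx)
      exact Set.mem_iUnion.2 ⟨⟨i, hi⟩, hx'⟩
  set K : t → Set M := fun i ↦ tsupport (ρ i) with hKdef
  have hK : ∀ i, IsCompact (K i) := fun i ↦ (isClosed_tsupport _).isCompact
  have hKs : ∀ i, K i ⊆ (φ i).dom.source := hρ
  have hρ1 : ∀ x, ∑ i, ρ i x = 1 := fun x ↦ by
    rw [← finsum_eq_sum_of_fintype]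
    exact ρ.sum_eq_one (Set.mem_univ x)
  have hρ0 : ∀ i x, x ∉ K i → ρ i x = 0 := fun i x hx ↦ image_eq_zero_of_notMem_tsupport hx
  set S : ∀ q : ℕ, t → Form E M q → Form E M q := fun _ i a x ↦ ρ i x • a x with hS
  have hS0 : ∀ {q : ℕ} i (a : Form E M q), ∀ x ∉ K i, S _ i a x = 0 := fun i a x hx ↦ by
    change ρ i x • a x = 0
    rw [hρ0 i x hx]
    exact zero_smul ℝ (a x)
  have hSs : ∀ {q : ℕ} i {a : Form E M q}, (∀ x, SmoothAt a x) → ∀ x, SmoothAt (S _ i a) x :=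
    fun i _ ha x ↦ SmoothAt.smul (ρ i).contMDiff.contMDiffAt (ha x)
  have hSK : ∀ {q : ℕ} i {a : Form E M q} {x : M}, a x = 0 → S _ i a x = 0 := fun i a x hx ↦ by
    change ρ i x • a x = 0
    rw [hx]
    ext v
    exact smul_zero (A := ℂ) (ρ i x)
  have hSsum : ∀ {q : ℕ} (a : Form E M q), ∑ i, S _ i a = a := fun a ↦ by
    funext x
    rw [Finset.sum_apply]
    exact (Finset.sum_smul ..).symm.trans (by rw [hρ1, one_smul])
  set P : ∀ q k : ℕ, q = 2 * d + k → Form E M q → Form F N k :=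
    fun _ _ h a ↦ ∑ i, (φ i).push μ h B (S _ i a) with hP
  -- A form supported in one `K i` may be pushed forward in that chart alone: its pieces are
  -- supported in intersections `K i ∩ K j`, where the two charts give the same result.
  have hlocal : ∀ {q k : ℕ} (h : q = 2 * d + k) (i : t) {a : Form E M q},
      (∀ x ∉ K i, a x = 0) → (∀ x, SmoothAt a x) → (φ i).push μ h B a = P _ _ h a := by
    intro q k h i a ha hs
    conv_lhs => rw [← hSsum a]
    rw [(φ i).push_sum μ _ h B (hK i) (hKs i) (fun j x hx ↦ hSK j (ha x hx)) fun j ↦ hSs j hs]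
    refine Finset.sum_congr rfl fun j _ ↦ ?_
    refine FiberChart.push_eq_push μ (φ i) (φ j) h B ((hK i).inter (hK j))
      (fun x hx ↦ hKs i hx.1) (fun x hx ↦ hKs j hx.2) (fun x hx ↦ ?_) (hSs j hs)
    by_cases hi : x ∈ K i
    · exact hS0 j a x fun hj ↦ hx ⟨hi, hj⟩
    · exact hSK j (ha x hi)
  have hPsum : ∀ {q k : ℕ} (h : q = 2 * d + k) {a : t → Form E M q},
      (∀ i x, SmoothAt (a i) x) → P _ _ h (∑ i, a i) = ∑ i, P _ _ h (a i) := by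
    intro q k h a hs
    rw [hP]
    simp only
    rw [Finset.sum_comm]
    refine Finset.sum_congr rfl fun j _ ↦ ?_
    rw [← (φ j).push_sum μ _ h B (hK j) (hKs j) (fun i ↦ hS0 j (a i)) fun i ↦ hSs j (hs i)]
    congr 1
    funext x
    rw [hS]
    simp only [Finset.sum_apply, Finset.smul_sum]
  refine ⟨P, fun q k h a ha ↦ ⟨fun y ↦ SmoothAt.sum _ fun i _ ↦ (φ i).smoothAt_push μ h B hf
    (hK i) (hKs i) (hS0 i a) (hSs i ha) y, fun c ↦ ?_⟩, fun m h a ha hpos x ↦ ?_⟩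
  · have h1 : dc c (P _ _ h a) = ∑ i, dc c ((φ i).push μ h B (S _ i a)) := by
      funext y
      rw [Finset.sum_apply]
      exact dc_sum c _ fun i _ ↦ (φ i).smoothAt_push μ h B hf (hK i) (hKs i) (hS0 i a) (hSs i ha) y
    -- In general `dc c (ρ i • a)` is not `ρ i • dc c a`. No Leibniz rule is needed: the forms `dc c
    -- (ρ i • a)` add up to `dc c a` and keep the supports `K i`, so `hlocal` applies to each.
    have h2 : ∑ i, dc c (S _ i a) = dc c a := by
      funext x
      rw [Finset.sum_apply, ← dc_sum c _ fun i _ ↦ hSs i ha x, hSsum]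
    rw [h1, ← h2, hPsum _ fun i ↦ smoothAt_dc c (hSs i ha)]
    refine Finset.sum_congr rfl fun i _ ↦ ?_
    rw [(φ i).dc_push μ c h (even_two_mul d) B hf (hK i) (hKs i) (hS0 i a) (hSs i ha)]
    exact hlocal _ i (dc_eq_zero_of_notMem c (isClosed_tsupport _) (hS0 i a))
      (smoothAt_dc c (hSs i ha))
  · have hPa : ∀ u, P _ _ h a (f x) u = ∑ i, (φ i).push μ h B (S _ i a) (f x) u := fun u ↦ by
      rw [hP]
      simp only [Finset.sum_apply]
      exact map_sum (ContinuousAlternatingMap.apply ℝ F ℂ u) _ _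
    have hSr : ∀ i x u, (S _ i a x u).im = 0 := fun i x u ↦ by
      change (ρ i x • a x u).im = 0
      rw [Complex.smul_im, (hpos x).real, smul_zero]
    have hSre : ∀ i x u, (S _ i a x u).re = ρ i x * (a x u).re := fun i x u ↦ Complex.smul_re _ _
    have hSn : ∀ i x v, LinearIndependent ℂ v → 0 ≤ (S _ i a x (pairs v)).re := fun i x v hv ↦ by
      rw [hSre]
      exact mul_nonneg (ρ.nonneg i x) ((hpos x).pos v hv).le
    refine ⟨fun u ↦ ?_, ?_, fun v hv ↦ ?_⟩
    · rw [hPa, Complex.im_sum]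
      exact Finset.sum_eq_zero fun i _ ↦ (φ i).push_im μ h B (hK i) (hKs i) (hS0 i a) (hSs i ha)
        (hSr i) _ u
    · ext u
      rw [ContinuousAlternatingMap.compContinuousLinearMap_apply, hPa, hPa]
      refine Finset.sum_congr rfl fun i _ ↦ ?_
      have h3 := (φ i).push_comp_mulI μ h B (hK i) (hKs i) (hS0 i a) (hSs i ha) (fun x ↦ by
        conv_rhs => rw [hS]
        simp only
        rw [← (hpos x).map_I]
        rfl) (f x)
      exact congrArg (fun η : F [⋀^Fin (2 * m)]→L[ℝ] ℂ ↦ η u) h3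
    · rw [hPa, Complex.re_sum, hB]
      obtain ⟨i, hi⟩ : ∃ i, 0 < ρ i x := by
        by_contra! hcon
        have := hρ1 x
        rw [Finset.sum_eq_zero fun i _ ↦ le_antisymm (hcon i) (ρ.nonneg i x)] at this
        exact zero_ne_one this
      refine Finset.sum_pos' (fun j _ ↦ (φ j).re_push_pairs_nonneg μ h b.linearIndependent (hK j)
        (hKs j) (hS0 j a) (hSs j ha) (hSn j) _ hv) ⟨i, Finset.mem_univ i, ?_⟩
      refine (φ i).re_push_pairs_pos μ h b.linearIndependent (hK i) (hKs i) (hS0 i a) (hSs i ha)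
        (hSn i) (hKs i (subset_tsupport _ hi.ne')) (fun v hv ↦ ?_) hv
      rw [hSre]
      exact mul_pos hi ((hpos x).pos v hv)

end Pushforward

/-! ### Descent of strongly Gauduchon metrics along submersions -/

section Submersion
variable {E : Type*} [NormedAddCommGroup E] [NormedSpace ℂ E]
  {F : Type*} [NormedAddCommGroup F] [NormedSpace ℂ F]
  {G : Type*} [NormedAddCommGroup G] [NormedSpace ℂ G]
  {M : Type*} [TopologicalSpace M] [ChartedSpace E M]
  {N : Type*} [TopologicalSpace N] [ChartedSpace F N]
  {f : M → N}

lemma dc_constOfIsEmpty (c : ℂ) (x : M) :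
    dc c (fun _ : M ↦ ContinuousAlternatingMap.constOfIsEmpty ℝ E (Fin 0) (1 : ℂ)) x = 0 := by
  have h : coord (fun _ : M ↦ ContinuousAlternatingMap.constOfIsEmpty ℝ E (Fin 0) (1 : ℂ)) x =
      fun _ ↦ ContinuousAlternatingMap.constOfIsEmpty ℝ E (Fin 0) (1 : ℂ) := rfl
  rw [dc, h, flatD_eq_symbolD]
  simp only [fderiv_fun_const, Pi.zero_apply, map_zero]
  rfl

lemma smoothAt_constOfIsEmpty (x : M) :
    SmoothAt (fun _ : M ↦ ContinuousAlternatingMap.constOfIsEmpty ℝ E (Fin 0) (1 : ℂ)) x :=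
  (contDiffAt_const : ContDiffAt ℝ ∞
    (fun _ : E ↦ ContinuousAlternatingMap.constOfIsEmpty ℝ E (Fin 0) (1 : ℂ)) _)

lemma isOpenMap_of_fiberChart (hφ : ∀ x, ∃ φ : FiberChart E F G f, x ∈ φ.dom.source) :
    IsOpenMap f := by
  refine isOpenMap_iff_nhds_le.2 fun x ↦ ?_
  obtain ⟨φ, hx⟩ := hφ x
  have h1 : f =ᶠ[𝓝 x] φ.cod.symm ∘ Prod.fst ∘ φ.dom := by
    filter_upwards [φ.dom.open_source.mem_nhds hx] with z hz
    rw [Function.comp_apply, Function.comp_apply, ← φ.cod_map z hz, φ.cod.left_inv (φ.map_mem z hz)]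
  rw [Filter.map_congr h1, ← Filter.map_map, ← Filter.map_map, φ.dom.map_nhds_eq hx, map_fst_nhds,
    ← φ.cod_map x hx, φ.cod.symm.map_nhds_eq (φ.cod.map_source (φ.map_mem x hx)),
    φ.cod.left_inv (φ.map_mem x hx)]

variable [FiniteDimensional ℂ E]

lemma SmoothAt.wedgePow {w : Form E M 2} {x : M} (hw : SmoothAt w x) (k : ℕ) :
    SmoothAt (fun x ↦ wedgePow (w x) k) x := by
  have h : coord (fun x ↦ StronglyGauduchon.wedgePow (w x) k) x =
      fun y ↦ StronglyGauduchon.wedgePow (coord w x y) k :=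
    funext fun y ↦ (wedgePow_compContinuousLinearMap _ _ k).symm
  rw [SmoothAt, h]
  exact (contDiff_wedgePow k).contDiffAt.comp _ hw

variable [IsManifold 𝓘(ℂ, E) ω M]

omit [FiniteDimensional ℂ E] in
lemma tderiv_extChartAt_symm_injective {x : M} {y : E} (hy : y ∈ (extChartAt 𝓘(ℂ, E) x).target) :
    Function.Injective (tderiv E E (extChartAt 𝓘(ℂ, E) x).symm y) := by
  refine tderiv_injective (φ := extChartAt 𝓘(ℂ, E) x)
    ((contMDiffAt_extChartAt_symm hy).mdifferentiableAt (by simp))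
    (mdifferentiableAt_extChartAt (by simpa using (extChartAt 𝓘(ℂ, E) x).map_target hy)) ?_
  filter_upwards [(isOpen_extChartAt_target x).mem_nhds hy] with z hz
  exact (extChartAt 𝓘(ℂ, E) x).right_inv hz

/-- A smooth form which is positive in the sense of a power of a metric is such a power. -/
theorem exists_smooth_root {k : ℕ} (hk : Module.finrank ℂ E = k + 2) {Ω : Form E M (2 * (k + 1))}
    (hs : ∀ x, SmoothAt Ω x) (hΩ : ∀ x, IsCopositive (Ω x)) :
    ∃ w : Form E M 2, (∀ x, SmoothAt w x) ∧ (∀ x, IsPositiveForm (w x)) ∧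
      (fun x ↦ wedgePow (w x) (k + 1)) = Ω := by
  obtain ⟨Φ, h1, h2, h3⟩ := exists_root hk
  refine ⟨fun x ↦ Φ (Ω x), fun x ↦ ?_, fun x ↦ ?_, funext fun x ↦ ?_⟩
  -- `Φ` was built without regard to charts. It nevertheless commutes with an injective
  -- complex-linear pullback on copositive forms: write the form as a power of a positive `w`, pull
  -- back `w`, and use that `Φ` recovers the base of a power.
  · have h4 : coord (fun x ↦ Φ (Ω x)) x =ᶠ[𝓝 (extChartAt 𝓘(ℂ, E) x x)] Φ ∘ coord Ω x := by
      filter_upwards [extChartAt_target_mem_nhds (I := 𝓘(ℂ, E)) x] with y hy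
      obtain ⟨w, hw, hw'⟩ := h3 _ (hΩ ((extChartAt 𝓘(ℂ, E) x).symm y))
      rw [Function.comp_apply, coord, coord, pull_apply, pull_apply, ← hw', h1 w hw,
        ← wedgePow_compContinuousLinearMap,
        h1 _ (hw.comp _ (tderiv_extChartAt_symm_injective hy))]
    refine ContDiffAt.congr_of_eventuallyEq ?_ h4
    exact ContDiffAt.comp _ (h2 _ ((hΩ _).comp _ (tderiv_extChartAt_symm_injective
      (mem_extChartAt_target x)))) (hs x)
  · obtain ⟨w, hw, hw'⟩ := h3 _ (hΩ x)
    simp only [← hw', h1 w hw]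
    exact hw
  · obtain ⟨w, hw, hw'⟩ := h3 _ (hΩ x)
    simp only [← hw', h1 w hw]

variable (E M) in
lemma isStronglyGauduchon_iff_of_finrank {p : ℕ} (hp : Module.finrank ℂ E - 1 = p) :
    IsStronglyGauduchon 𝓘(ℂ, E) M ↔
    ∃ w : Form E M 2, (∀ x, SmoothAt w x) ∧ (∀ x, IsPositiveForm (w x)) ∧
      ∃ α : Form E M (2 * p), (∀ x, SmoothAt α x) ∧
        dc (-Complex.I) (fun x ↦ wedgePow (w x) p) = dc Complex.I α := by
  subst hp
  exact isStronglyGauduchon_iff E M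

/-- On zero tangent spaces positivity is vacuous and forms of positive degree vanish, so zero serves
both as metric and as potential. -/
lemma isStronglyGauduchon_of_finrank_eq_zero (h : Module.finrank ℂ E = 0) :
    IsStronglyGauduchon 𝓘(ℂ, E) M := by
  have := Module.finrank_zero_iff.1 h
  rw [isStronglyGauduchon_iff_of_finrank E M (p := 0) (by omega)]
  refine ⟨0, smoothAt_zero, fun x ↦ ⟨fun _ _ ↦ rfl, fun _ _ ↦ rfl,
    fun v hv ↦ absurd (Subsingleton.elim v 0) hv⟩, 0, smoothAt_zero, funext fun x ↦ ?_⟩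
  ext v
  rw [ContinuousAlternatingMap.map_coord_zero _ 0 (Subsingleton.elim _ _),
    ContinuousAlternatingMap.map_coord_zero _ 0 (Subsingleton.elim _ _)]

lemma isStronglyGauduchon_of_isEmpty [IsEmpty M] : IsStronglyGauduchon 𝓘(ℂ, E) M :=
  (isStronglyGauduchon_iff E M).2 ⟨0, smoothAt_zero, isEmptyElim, 0, smoothAt_zero,
    funext isEmptyElim⟩

variable [FiniteDimensional ℂ F] [FiniteDimensional ℂ G]
  [T2Space M] [CompactSpace M] [T2Space N] [IsManifold 𝓘(ℂ, F) ω N]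

theorem IsStronglyGauduchon.of_fiberChart (hf : Continuous f) (hsurj : Function.Surjective f)
    (hφ : ∀ x, ∃ φ : FiberChart E F G f, x ∈ φ.dom.source)
    (hdim : Module.finrank ℂ E = Module.finrank ℂ F + Module.finrank ℂ G)
    (h : IsStronglyGauduchon 𝓘(ℂ, E) M) : IsStronglyGauduchon 𝓘(ℂ, F) N := by
  obtain ⟨P, hP, hpos⟩ := exists_pushforward hf hφ
  obtain hF | hF | ⟨k, hF⟩ : Module.finrank ℂ F = 0 ∨ Module.finrank ℂ F = 1 ∨
      ∃ k, Module.finrank ℂ F = k + 2 := by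
    rcases Module.finrank ℂ F with _ | _ | k
    exacts [.inl rfl, .inr (.inl rfl), .inr (.inr ⟨k, rfl⟩)]
  · exact isStronglyGauduchon_of_finrank_eq_zero hF
  -- The exponent for `N` is zero, so any metric works: the push-forward of the top power of `w`,
  -- here of degree two, is one. The constant function one serves as potential because ∂ and ∂̄ both
  -- kill it.
  · obtain ⟨w, hw, hwpos, -⟩ := (isStronglyGauduchon_iff E M).1 h
    rw [isStronglyGauduchon_iff_of_finrank F N (p := 0) (by omega)]
    have hsm := fun x ↦ (hw x).wedgePow (Module.finrank ℂ G + 1)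
    refine ⟨P _ _ (by ring) _, (hP _ _ (by ring) _ hsm).1, fun y ↦ ?_,
      fun _ ↦ ContinuousAlternatingMap.constOfIsEmpty ℝ F (Fin 0) (1 : ℂ),
      smoothAt_constOfIsEmpty, funext fun x ↦ ?_⟩
    · obtain ⟨x, rfl⟩ := hsurj y
      have h1 := hpos 1 (by ring) _ hsm (fun x ↦ (hwpos x).isCopositive _) x
      refine ⟨fun u v ↦ h1.real _, fun u v ↦ ?_, fun v hv ↦ ?_⟩
      · conv_rhs => rw [← h1.map_I]
        rw [ContinuousAlternatingMap.compContinuousLinearMap_apply]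
        congr 1
        funext i
        fin_cases i <;> rfl
      · convert h1.pos ![v] (by simpa using hv) using 3
        funext i
        fin_cases i <;> rfl
    · exact (dc_constOfIsEmpty _ x).trans (dc_constOfIsEmpty _ x).symm
  · obtain ⟨w, hw, hwpos, α, hα, hwα⟩ := (isStronglyGauduchon_iff_of_finrank E M
      (p := Module.finrank ℂ G + (k + 1)) (by omega)).1 h
    have hsm := fun x ↦ (hw x).wedgePow (Module.finrank ℂ G + (k + 1))
    have hdeg : 2 * (Module.finrank ℂ G + (k + 1)) = 2 * Module.finrank ℂ G + 2 * (k + 1) := by ring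
    -- The new metric is the root of the push-forward. Surjectivity enters because copositivity is
    -- available only at points `f x`.
    obtain ⟨w', hw', hwpos', hroot⟩ := exists_smooth_root hF (hP _ _ hdeg _ hsm).1 fun y ↦ by
      obtain ⟨x, rfl⟩ := hsurj y
      exact hpos (k + 1) hdeg _ hsm (fun x ↦ (hwpos x).isCopositive _) x
    refine (isStronglyGauduchon_iff_of_finrank F N (p := k + 1) (by omega)).2 ⟨w', hw', hwpos',
      P _ _ hdeg α, (hP _ _ hdeg _ hα).1, ?_⟩
    rw [hroot, (hP _ _ hdeg _ hsm).2, (hP _ _ hdeg _ hα).2, hwα]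

-- The image is closed because `M` is compact and open because `f` is locally a projection; it meets
-- every component, so `f` is onto. If `M` is empty, the same hypothesis makes `N` empty.
omit [FiniteDimensional ℂ G] in
theorem IsStronglyGauduchon.of_isSubmersionOfComplement
    (hfG : Manifold.IsSubmersionOfComplement G 𝓘(ℂ, E) 𝓘(ℂ, F) ω f)
    (hc : ∀ y : N, ∃ x : M, f x ∈ connectedComponent y)
    (h : IsStronglyGauduchon 𝓘(ℂ, E) M) : IsStronglyGauduchon 𝓘(ℂ, F) N := by
  rcases isEmpty_or_nonempty M with hM | ⟨⟨x₀⟩⟩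
  · have : IsEmpty N := ⟨fun y ↦ hM.elim (hc y).choose⟩
    exact isStronglyGauduchon_of_isEmpty
  have hcont : Continuous f := hfG.contMDiff.continuous
  -- `G` is a quotient of `E`, through the splitting of `E` at a point of `M`.
  have : FiniteDimensional ℂ G := Module.Finite.of_surjective
    (LinearMap.snd ℂ F G ∘ₗ (hfG x₀).equiv.toLinearEquiv.toLinearMap)
    (Prod.snd_surjective.comp (hfG x₀).equiv.surjective)
  have hφ : ∀ x, ∃ φ : FiberChart E F G f, x ∈ φ.dom.source := fun x ↦ exists_fiberChart (hfG x)
  have hrange : IsClopen (Set.range f) :=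
    ⟨(isCompact_range hcont).isClosed, (isOpenMap_of_fiberChart hφ).isOpen_range⟩
  refine IsStronglyGauduchon.of_fiberChart hcont (fun y ↦ ?_) hφ
    ((hfG x₀).equiv.toLinearEquiv.finrank_eq.trans (Module.finrank_prod (R := ℂ) (M := F) (M' := G))) h
  obtain ⟨x, hx⟩ := hc y
  refine hrange.connectedComponent_subset ⟨x, rfl⟩ ?_
  rw [← connectedComponent_eq hx]
  exact mem_connectedComponent

end Submersion

/-! ### Differentiation after contraction with a frame of one factor -/

section Contraction
variable {F W : Type*} [NormedAddCommGroup F] [NormedSpace ℂ F] [NormedAddCommGroup W]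
  [NormedSpace ℂ W]

lemma map_append_smul_right {s k q : ℕ} (h : q = s + k) (a : W [⋀^Fin q]→L[ℝ] ℂ) (R : Fin s → W)
    (t : Fin k → W) (c : ℝ) :
    a (Fin.append R (fun i ↦ c • t i) ∘ Fin.cast h) = c ^ k * a (Fin.append R t ∘ Fin.cast h) := by
  have h1 := (contrFun h R (ContinuousLinearMap.id ℝ W) a).toMultilinearMap.map_smul_univ
    (fun _ ↦ c) t
  rw [Finset.prod_const, Finset.card_univ, Fintype.card_fin, Complex.real_smul,
    Complex.ofReal_pow] at h1
  exact h1

lemma removeNth_append_left {X : Type*} {s k : ℕ} (x : Fin (s + 1) → X) (u : Fin k → X)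
    (j : Fin (s + 1)) (h : s + 1 + k = s + k + 1) :
    Fin.removeNth (n := s + k) (Fin.cast h (Fin.castAdd k j)) (Fin.append x u ∘ Fin.cast h.symm) =
      Fin.append (j.removeNth x) u := by
  funext i
  refine Fin.addCases (fun i ↦ ?_) (fun i ↦ ?_) i
  · rw [Fin.append_left, Fin.removeNth, Fin.removeNth, Function.comp_apply]
    have : Fin.cast h.symm ((Fin.cast h (Fin.castAdd k j)).succAbove (Fin.castAdd k i)) =
        Fin.castAdd k (j.succAbove i) := by
      ext
      simp [Fin.succAbove, Fin.lt_def]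
      split_ifs <;> rfl
    rw [this, Fin.append_left]
  · rw [Fin.append_right, Fin.removeNth, Function.comp_apply]
    have : Fin.cast h.symm ((Fin.cast h (Fin.castAdd k j)).succAbove (Fin.natAdd s i)) =
        Fin.natAdd (s + 1) i := by
      ext
      have h1 : ¬ (Fin.castSucc (Fin.natAdd s i) < Fin.cast h (Fin.castAdd k j)) := by
        simp only [Fin.lt_def, Fin.val_castSucc, Fin.val_natAdd, Fin.val_cast, Fin.val_castAdd]
        omega
      simp only [Fin.succAbove, if_neg h1, Fin.val_cast, Fin.val_succ, Fin.val_natAdd]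
      omega
    rw [this, Fin.append_right]

/-- The operators `∂` and `∂̄` on a form on `W` which restricts to a multiple of the pull-back of a
form on `F`, after contraction with a frame of a complement of `F`. -/
lemma flatD_append (c : ℂ) {s k : ℕ} (hs : Even s) (hk : Even k) (R : Fin s → W) (A : F →L[ℂ] W)
    (T : W →L[ℝ] W) (hTR : ∀ j, T (R j) = R j) (hTA : ∀ t, T (A t) = - A t)
    {Θ : Form W W (s + k)} {z : W} (hΘ : DifferentiableAt ℝ Θ z)
    (hT : ∀ z, (Θ z).compContinuousLinearMap T = Θ z) {b : Form F F k} {y : F}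
    (hb : DifferentiableAt ℝ b y) (C : ℂ)
    (h : ∀ t f, Θ (z + A t) (Fin.append R (A ∘ f)) = C * b (y + t) f) (u : Fin (k + 1) → F) :
    flatD c Θ z (Fin.append (n := k + 1) R (A ∘ u)) = C * flatD c b y u := by
  -- Moving in the directions of `F` from `z`, the contracted form is `C` times a translate of `b`,
  -- with `C` constant; both sides are differentiated at the origin.
  have hder : ∀ t f, fderiv ℝ Θ z (A t) (Fin.append R (A ∘ f)) = C * fderiv ℝ b y t f := by
    intro t f
    have h1 : HasFDerivAt (fun t ↦ Θ (z + A t) (Fin.append R (A ∘ f)))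
        ((ContinuousAlternatingMap.apply ℝ W ℂ (Fin.append R (A ∘ f))).comp
          ((fderiv ℝ Θ z).comp (A.restrictScalars ℝ))) 0 := by
      refine (ContinuousAlternatingMap.apply ℝ W ℂ (Fin.append R (A ∘ f))).hasFDerivAt.comp 0 ?_
      have h2 : HasFDerivAt (fun t ↦ z + A t) (A.restrictScalars ℝ) 0 :=
        (A.restrictScalars ℝ).hasFDerivAt.const_add z
      have h3 : HasFDerivAt Θ (fderiv ℝ Θ z) (z + A 0) := by
        rw [map_zero, add_zero]
        exact hΘ.hasFDerivAt
      exact h3.comp 0 h2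
    have h4 : HasFDerivAt (fun t ↦ C * b (y + t) f)
        (C • ((ContinuousAlternatingMap.apply ℝ F ℂ f).comp (fderiv ℝ b y))) 0 := by
      refine HasFDerivAt.const_mul ?_ C
      refine (ContinuousAlternatingMap.apply ℝ F ℂ f).hasFDerivAt.comp 0 ?_
      have h3 : HasFDerivAt b (fderiv ℝ b y) (y + 0) := by
        rw [add_zero]
        exact hb.hasFDerivAt
      exact HasFDerivAt.comp (f := fun t ↦ y + t) 0 h3 ((hasFDerivAt_id 0).const_add y)
    have h5 : (fun t ↦ Θ (z + A t) (Fin.append R (A ∘ f))) = fun t ↦ C * b (y + t) f :=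
      funext fun t ↦ h t f
    rw [h5] at h1
    exact congrArg (fun L : F →L[ℝ] ℂ ↦ L t) (h1.unique h4)
  -- If a frame vector is the direction of differentiation, `k + 1` arguments from `F` remain. Their
  -- number is odd, so the invariance under `T`, which is `1` on the frame and `-1` on `F`, forces
  -- the term to be its own negative. Invariance passes to derivatives because `T` acts on the
  -- arguments and not on the base point.
  have hodd : ∀ t (j : Fin s), fderiv ℝ Θ z t (Fin.removeNth (n := s + k) (Fin.castAdd (k + 1) j)
      (Fin.append (n := k + 1) R (A ∘ u))) = 0 := by
    intro t j
    obtain ⟨s, rfl⟩ : ∃ s', s = s' + 1 := ⟨s - 1, by have := j.2; omega⟩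
    have hinv : (fderiv ℝ Θ z t).compContinuousLinearMap T = fderiv ℝ Θ z t := by
      have h1 : HasFDerivAt (fun z ↦ (Θ z).compContinuousLinearMap T)
          ((ContinuousAlternatingMap.compContinuousLinearMapCLM T).comp (fderiv ℝ Θ z)) z :=
        (ContinuousAlternatingMap.compContinuousLinearMapCLM (F := ℂ) (ι := Fin (s + 1 + k))
          T).hasFDerivAt.comp z hΘ.hasFDerivAt
      rw [show (fun z ↦ (Θ z).compContinuousLinearMap T) = Θ from funext hT] at h1
      exact congrArg (fun L : W →L[ℝ] W [⋀^Fin (s + 1 + k)]→L[ℝ] ℂ ↦ L t)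
        (h1.unique hΘ.hasFDerivAt)
    set η := fderiv ℝ Θ z t
    have hd : s + 1 + k = s + (k + 1) := by ring
    have h2 : Fin.removeNth (n := s + 1 + k) (Fin.castAdd (k + 1) j)
        (Fin.append (n := k + 1) R (A ∘ u)) = Fin.append (j.removeNth R) (A ∘ u) ∘ Fin.cast hd := by
      rw [← removeNth_append_left R (A ∘ u) j (by ring)]
      funext i
      simp only [Fin.removeNth, Function.comp_apply]
      congr 1
      ext
      simp [Fin.succAbove, Fin.lt_def]
      split_ifs <;> rfl
    rw [h2]
    have h3 := congrArg (fun η : W [⋀^Fin (s + 1 + k)]→L[ℝ] ℂ ↦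
      η (Fin.append (j.removeNth R) (A ∘ u) ∘ Fin.cast hd)) hinv
    have h4 : T ∘ (Fin.append (j.removeNth R) (A ∘ u) ∘ Fin.cast hd) =
        Fin.append (j.removeNth R) (fun i ↦ (-1 : ℝ) • A (u i)) ∘ Fin.cast hd := by
      funext i
      simp only [Function.comp_apply]
      generalize Fin.cast hd i = i
      refine Fin.addCases (fun i ↦ ?_) (fun i ↦ ?_) i
      · rw [Fin.append_left, Fin.append_left, Fin.removeNth, hTR]
      · rw [Fin.append_right, Fin.append_right, Function.comp_apply, hTA, neg_one_smul]
    simp only [ContinuousAlternatingMap.compContinuousLinearMap_apply] at h3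
    rw [h4, map_append_smul_right hd η (j.removeNth R) (fun i ↦ A (u i))] at h3
    have h5 : ((-1 : ℝ) : ℂ) ^ (k + 1) = -1 := by
      rw [pow_succ, Complex.ofReal_neg, Complex.ofReal_one, hk.neg_one_pow, one_mul]
    rw [h5, neg_one_mul] at h3
    exact self_eq_neg.1 h3.symm
  have hmain := contrFun_symbolD c R (A.restrictScalars ℝ) (fderiv ℝ Θ z) u
  refine hmain.trans ?_
  rw [Finset.sum_eq_zero fun j _ ↦ ?_, zero_add, flatD_eq_symbolD, symbolD_apply, Finset.mul_sum]
  · refine Finset.sum_congr rfl fun j _ ↦ ?_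
    have h1 : ∀ t, contrFun rfl R (A.restrictScalars ℝ) (fderiv ℝ Θ z (A t)) (j.removeNth u) =
      C * fderiv ℝ b y t (j.removeNth u) := fun t ↦ hder t _
    change _ * (1 / 2 * (contrFun rfl R (A.restrictScalars ℝ) (fderiv ℝ Θ z (A (u j)))
      (j.removeNth u) + c * contrFun rfl R (A.restrictScalars ℝ)
        (fderiv ℝ Θ z (Complex.I • A (u j))) (j.removeNth u))) = _
    rw [← A.map_smul, h1, h1, pow_add, hs.neg_one_pow]
    ring
  · have h1 : ∀ t, fderiv ℝ Θ z t (Fin.removeNth (n := s + k) (Fin.castAdd (k + 1) j)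
        (Fin.append (n := k + 1) R (A.restrictScalars ℝ ∘ u))) = 0 := fun t ↦ hodd t j
    rw [h1, h1]
    ring

/-- A permutation moves the positions of the frame to the front, at the price of a sign. -/
lemma map_eq_zero_of_forall_append {s k d : ℕ} (h : d = s + k) {η : W [⋀^Fin d]→L[ℝ] ℂ}
    {x : Fin s → W} {S : Set W}
    (hη : ∀ t : Fin k → W, (∀ i, t i ∈ S) → η (Fin.append x t ∘ Fin.cast h) = 0)
    {v : Fin d → W} {i : Fin s → Fin d} (hi : Function.Injective i) (hx : ∀ j, v (i j) = x j)
    (hv : ∀ l, (∀ j, i j ≠ l) → v l ∈ S) : η v = 0 := by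
  subst h
  classical
  have hcard : Fintype.card {l // ¬ (l ∈ Set.range i)} = k := by
    rw [Fintype.card_subtype_compl, Fintype.card_fin, ← Fintype.card_congr
      (Equiv.ofInjective i hi), Fintype.card_fin, Nat.add_sub_cancel_left]
  set e := (Fintype.equivFinOfCardEq hcard).symm
  set g : Equiv.Perm (Fin (s + k)) := finSumFinEquiv.symm.trans
    (((Equiv.ofInjective i hi).sumCongr e).trans (Equiv.sumCompl (· ∈ Set.range i))) with hg
  have h1 : v ∘ g = Fin.append x (fun l ↦ v (e l)) := by
    funext l
    refine Fin.addCases (fun l ↦ ?_) (fun l ↦ ?_) l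
    · rw [Fin.append_left, ← hx]
      simp [hg]
    · rw [Fin.append_right]
      simp [hg]
  have h2 : η (v ∘ g) = Equiv.Perm.sign g • η v := η.toAlternatingMap.map_perm v g
  rw [h1] at h2
  have h3 := hη (fun l ↦ v (e l)) fun l ↦ hv _ fun j hj ↦ (e l).2 ⟨j, hj⟩
  rw [Fin.cast_refl, Function.comp_id] at h3
  rw [h3] at h2
  rcases Int.units_eq_one_or (Equiv.Perm.sign g) with h | h <;> simpa [h] using h2.symm

end Contraction

/-! ### Frames in which a metric is diagonal -/

section Frame
variable {V : Type*} [NormedAddCommGroup V] [NormedSpace ℂ V]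

/-- A complex frame on which a real `(1, 1)`-form is diagonal. -/
structure IsOrthogonalFrame {k : ℕ} (w : V [⋀^Fin 2]→L[ℝ] ℂ) (e : Fin k → V) : Prop where
  type_one_one : ∀ u v, w ![Complex.I • u, Complex.I • v] = w ![u, v]
  zero : ∀ i j, i ≠ j → w ![e i, e j] = 0
  zero' : ∀ i j, i ≠ j → w ![e i, Complex.I • e j] = 0

lemma IsOrthogonalFrame.zero'' {k : ℕ} {w : V [⋀^Fin 2]→L[ℝ] ℂ} {e : Fin k → V}
    (h : IsOrthogonalFrame w e) (i j : Fin k) (hij : i ≠ j) : w ![Complex.I • e i, e j] = 0 := by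
  rw [two_form_swap, h.zero' j i hij.symm, neg_zero]

lemma IsOrthogonalFrame.tail {k : ℕ} {w : V [⋀^Fin 2]→L[ℝ] ℂ} {e : Fin (k + 1) → V}
    (h : IsOrthogonalFrame w e) : IsOrthogonalFrame w (Fin.tail e) where
  type_one_one := h.type_one_one
  zero i j hij := h.zero _ _ (by simpa using hij)
  zero' i j hij := h.zero' _ _ (by simpa using hij)

/-- `wedgePow_succ_cons_cons` strips off one complex frame vector at a time. The factors `q + k, …,
q + 1` collected on the way form the ascending factorial. -/
lemma wedgePow_append_pairs {w : V [⋀^Fin 2]→L[ℝ] ℂ} {k q : ℕ} {e : Fin k → V}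
    (he : IsOrthogonalFrame w e) {f : Fin (2 * q) → V} (hf : ∀ i j, w ![e i, f j] = 0)
    (hf' : ∀ i j, w ![Complex.I • e i, f j] = 0) (h : 2 * (q + k) = 2 * k + 2 * q) :
    wedgePow w (q + k) (Fin.append (pairs e) f ∘ Fin.cast h) =
      ((q + 1).ascFactorial k * ∏ j, w ![e j, Complex.I • e j]) * wedgePow w q f := by
  induction k with
  | zero =>
    simp only [Nat.ascFactorial_zero, Nat.cast_one, Finset.univ_eq_empty, Finset.prod_empty,
      one_mul]
    congr 1
    funext i
    have h1 : Fin.cast h i = Fin.natAdd (2 * 0) (Fin.cast (by ring) i) := by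
      ext
      simp
    rw [Function.comp_apply, h1, Fin.append_right]
    rfl
  | succ k ih =>
    have h' : 2 * (q + k) = 2 * k + 2 * q := by ring
    have hcons : (Fin.append (pairs e) f ∘ Fin.cast h : Fin (2 * (q + k) + 1 + 1) → V) =
        Fin.cons (e 0) (Fin.cons (Complex.I • e 0)
          (Fin.append (pairs (Fin.tail e)) f ∘ Fin.cast h')) := by
      funext i
      refine Fin.cases ?_ (fun i ↦ Fin.cases ?_ (fun i ↦ ?_) i) i
      · have h1 : Fin.cast h (0 : Fin (2 * (q + k) + 1 + 1)) =
          Fin.castAdd (2 * q) (0 : Fin (2 * k + 1 + 1)) := rfl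
        rw [Function.comp_apply, h1, Fin.append_left]
        rfl
      · have h1 : Fin.cast h (Fin.succ (0 : Fin (2 * (q + k) + 1))) =
          Fin.castAdd (2 * q) (Fin.succ (0 : Fin (2 * k + 1))) := rfl
        rw [Function.comp_apply, h1, Fin.append_left]
        rfl
      · simp only [Fin.cons_succ, Function.comp_apply]
        obtain ⟨j, rfl⟩ : ∃ j, i = Fin.cast h'.symm j := ⟨Fin.cast h' i, rfl⟩
        refine Fin.addCases (fun j ↦ ?_) (fun j ↦ ?_) j
        · have h1 : Fin.cast h (Fin.succ (Fin.succ (Fin.cast h'.symm (Fin.castAdd (2 * q) j)))) =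
            Fin.castAdd (2 * q) (Fin.succ (Fin.succ j) : Fin (2 * k + 1 + 1)) := rfl
          rw [h1, Fin.append_left]
          simp only [Fin.cast_cast, Fin.cast_eq_self, Fin.append_left]
          rfl
        · have h1 : Fin.cast h (Fin.succ (Fin.succ (Fin.cast h'.symm (Fin.natAdd (2 * k) j)))) =
              Fin.natAdd (2 * (k + 1)) j := by
            ext
            simp
            omega
          rw [h1, Fin.append_right]
          simp only [Fin.cast_cast, Fin.cast_eq_self, Fin.append_right]
    have h0 : ∀ j : Fin k, (0 : Fin (k + 1)) ≠ j.succ := fun j ↦ (Fin.succ_ne_zero j).symm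
    have hall : ∀ {p : V → Prop}, (∀ j : Fin k, p (e j.succ) ∧ p (Complex.I • e j.succ)) →
        (∀ j, p (f j)) → ∀ i, p ((Fin.append (pairs (Fin.tail e)) f ∘ Fin.cast h') i) := by
      intro p hp hpf i
      rw [Function.comp_apply]
      generalize Fin.cast h' i = i
      refine Fin.addCases (fun j ↦ ?_) (fun j ↦ ?_) i
      · rw [Fin.append_left]
        exact pairs_forall _ hp j
      · rw [Fin.append_right]
        exact hpf j
    have hstep := wedgePow_succ_cons_cons w (e 0) (Complex.I • e 0) (q + k)
      (Fin.append (pairs (Fin.tail e)) f ∘ Fin.cast h')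
      (hall (p := fun x ↦ w ![e 0, x] = 0) (fun j ↦ ⟨he.zero _ _ (h0 j), he.zero' _ _ (h0 j)⟩)
        (hf 0))
      (hall (p := fun x ↦ w ![Complex.I • e 0, x] = 0) (fun j ↦ ⟨he.zero'' _ _ (h0 j), by
        rw [he.type_one_one]
        exact he.zero _ _ (h0 j)⟩) (hf' 0))
    rw [← hcons, ih he.tail (fun i ↦ hf _) (fun i ↦ hf' _) h'] at hstep
    refine hstep.trans ?_
    rw [Fin.prod_univ_succ, Nat.ascFactorial_succ]
    simp only [Fin.tail]
    push_cast
    ring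

lemma wedgePow_pairs {w : V [⋀^Fin 2]→L[ℝ] ℂ} {k : ℕ} {e : Fin k → V}
    (he : IsOrthogonalFrame w e) :
    wedgePow w k (pairs e) = k.factorial * ∏ j, w ![e j, Complex.I • e j] := by
  have h1 : ∀ (q : ℕ) (hq : q = 0) (f : Fin (2 * q) → V) (h : 2 * (q + k) = 2 * k + 2 * q),
      wedgePow w (q + k) (Fin.append (pairs e) f ∘ Fin.cast h) = wedgePow w k (pairs e) := by
    rintro q rfl f h
    have h2 : ∀ (n : ℕ) (hn : n = k) (h' : 2 * n = 2 * k),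
        wedgePow w n (pairs e ∘ Fin.cast h') = wedgePow w k (pairs e) := by
      rintro _ rfl _
      rfl
    rw [← h2 (0 + k) (by ring) (by ring)]
    congr 1
    funext i
    exact Fin.append_left (pairs e) f (Fin.cast (by ring) i)
  rw [← h1 0 rfl Fin.elim0 (by ring), wedgePow_append_pairs he (fun i j ↦ j.elim0)
    (fun i j ↦ j.elim0)]
  simp [wedgePow, Nat.one_ascFactorial]

/-- Eigenvectors of the operator of `w`, for an auxiliary Hermitian structure, are orthogonal for
`w` too. -/
lemma IsPositiveForm.exists_isOrthogonalFrame [FiniteDimensional ℂ V]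
    {w : V [⋀^Fin 2]→L[ℝ] ℂ} (hw : IsPositiveForm w) :
    ∃ e : Module.Basis (Fin (Module.finrank ℂ V)) ℂ V, IsOrthogonalFrame w e := by
  let L : V ≃L[ℂ] EuclideanSpace ℂ (Fin (Module.finrank ℂ V)) :=
    ContinuousLinearEquiv.ofFinrankEq (by rw [finrank_euclideanSpace_fin])
  have hw' := hw.comp (L.symm : EuclideanSpace ℂ (Fin (Module.finrank ℂ V)) →L[ℂ] V)
    L.symm.injective
  obtain ⟨S, hS, hSw⟩ := hw'.exists_isPosOp (EuclideanSpace.basisFun _ ℂ)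
  obtain ⟨e, l, -, he⟩ := hS.exists_eigenbasis (EuclideanSpace.basisFun _ ℂ)
  have h1 : ∀ x y, w ![L.symm x, L.symm y] = ((- rin (S x) (Complex.I • y) : ℝ) : ℂ) := by
    intro x y
    rw [← hS.opForm_apply, hSw, ContinuousAlternatingMap.compContinuousLinearMap_apply]
    congr 1
    funext i
    fin_cases i <;> rfl
  have h2 : ∀ i j, i ≠ j → inner ℂ (e i) (e j) = 0 := fun i j hij ↦ e.orthonormal.2 hij
  refine ⟨e.toBasis.map L.symm.toLinearEquiv, hw.type_one_one, fun i j hij ↦ ?_, fun i j hij ↦ ?_⟩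
  · change w ![L.symm (e.toBasis i), L.symm (e.toBasis j)] = 0
    rw [h1, OrthonormalBasis.coe_toBasis, he, rin_smul_left, rin, inner_smul_right, h2 i j hij]
    simp
  · change w ![L.symm (e.toBasis i), Complex.I • L.symm (e.toBasis j)] = 0
    rw [← L.symm.map_smul, h1, OrthonormalBasis.coe_toBasis, he, rin_smul_left, rin,
      inner_smul_right, inner_smul_right, h2 i j hij]
    simp

end Frame

section CastForm
variable {V : Type*} [NormedAddCommGroup V] [NormedSpace ℝ V]

/-- A form of degree `p`, considered as a form of degree `q = p`. -/
def castForm {p q : ℕ} (h : p = q) (a : V [⋀^Fin p]→L[ℝ] ℂ) : V [⋀^Fin q]→L[ℝ] ℂ := h ▸ a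

lemma castForm_apply {p q : ℕ} (h : p = q) (a : V [⋀^Fin p]→L[ℝ] ℂ) (v : Fin q → V) :
    castForm h a v = a (v ∘ Fin.cast h) := by
  subst h
  rfl

lemma castForm_compContinuousLinearMap {W : Type*} [NormedAddCommGroup W] [NormedSpace ℝ W]
    {p q : ℕ} (h : p = q) (a : V [⋀^Fin p]→L[ℝ] ℂ) (L : W →L[ℝ] V) :
    (castForm h a).compContinuousLinearMap L = castForm h (a.compContinuousLinearMap L) := by
  subst h
  rfl

lemma contDiff_castForm {p q : ℕ} (h : p = q) {n : WithTop ℕ∞} :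
    ContDiff ℝ n (castForm h : (V [⋀^Fin p]→L[ℝ] ℂ) → V [⋀^Fin q]→L[ℝ] ℂ) := by
  subst h
  exact contDiff_id

lemma compContinuousLinearMap_neg_of_even {W : Type*} [NormedAddCommGroup W] [NormedSpace ℝ W]
    {p : ℕ} (hp : Even p) (a : V [⋀^Fin p]→L[ℝ] ℂ) (L : W →L[ℝ] V) :
    a.compContinuousLinearMap (-L) = a.compContinuousLinearMap L := by
  ext v
  have h := a.toMultilinearMap.map_smul_univ (fun _ ↦ (-1 : ℝ)) (fun i ↦ L (v i))
  rw [Finset.prod_const, Finset.card_univ, Fintype.card_fin, hp.neg_one_pow, one_smul] at h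
  refine Eq.trans ?_ h
  change a (fun i ↦ - L (v i)) = a (fun i ↦ (-1 : ℝ) • L (v i))
  simp only [neg_one_smul]

lemma compContinuousLinearMap_smul {W : Type*} [NormedAddCommGroup W] [NormedSpace ℝ W]
    {p : ℕ} (a : V [⋀^Fin p]→L[ℝ] ℂ) (L : W →L[ℝ] V) (c : ℝ) :
    a.compContinuousLinearMap (c • L) = c ^ p • a.compContinuousLinearMap L := by
  ext v
  have h := a.toMultilinearMap.map_smul_univ (fun _ ↦ c) (fun i ↦ L (v i))
  rw [Finset.prod_const, Finset.card_univ, Fintype.card_fin] at h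
  exact h

end CastForm

/-! ### Exterior products and powers on a direct sum -/

section Biproduct
variable {E F W : Type*} [NormedAddCommGroup E] [NormedSpace ℂ E] [NormedAddCommGroup F]
  [NormedSpace ℂ F] [NormedAddCommGroup W] [NormedSpace ℂ W]

/-- Inclusions and projections of two complementary subspaces. -/
structure IsBiproduct (i₁ : E →L[ℂ] W) (i₂ : F →L[ℂ] W) (π₁ : W →L[ℂ] E) (π₂ : W →L[ℂ] F) :
    Prop where
  fst_inl : ∀ x, π₁ (i₁ x) = x
  snd_inr : ∀ y, π₂ (i₂ y) = y
  fst_inr : ∀ y, π₁ (i₂ y) = 0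
  snd_inl : ∀ x, π₂ (i₁ x) = 0

lemma IsBiproduct.symm {i₁ : E →L[ℂ] W} {i₂ : F →L[ℂ] W} {π₁ : W →L[ℂ] E} {π₂ : W →L[ℂ] F}
    (h : IsBiproduct i₁ i₂ π₁ π₂) : IsBiproduct i₂ i₁ π₂ π₁ :=
  ⟨h.snd_inr, h.fst_inl, h.snd_inl, h.fst_inr⟩

/-- The pullback of an alternating form under a complex linear map. -/
abbrev pullC {k : ℕ} (π : W →L[ℂ] E) (a : E [⋀^Fin k]→L[ℝ] ℂ) : W [⋀^Fin k]→L[ℝ] ℂ :=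
  a.compContinuousLinearMap (π.restrictScalars ℝ)

lemma pullC_two (π : W →L[ℂ] E) (a : E [⋀^Fin 2]→L[ℝ] ℂ) (u v : W) :
    pullC π a ![u, v] = a ![π u, π v] := by
  rw [ContinuousAlternatingMap.compContinuousLinearMap_apply]
  congr 1
  funext i
  fin_cases i <;> rfl

lemma two_form_zero_left (a : E [⋀^Fin 2]→L[ℝ] ℂ) (v : E) : a ![0, v] = 0 :=
  a.map_coord_zero 0 rfl

lemma two_form_zero_right (a : E [⋀^Fin 2]→L[ℝ] ℂ) (v : E) : a ![v, 0] = 0 :=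
  a.map_coord_zero 1 rfl

variable {i₁ : E →L[ℂ] W} {i₂ : F →L[ℂ] W} {π₁ : W →L[ℂ] E} {π₂ : W →L[ℂ] F}
  (H : IsBiproduct i₁ i₂ π₁ π₂)

-- This is the binomial term of bidegree `(2 m, 2 n)`. The ascending factorial of
-- `wedgePow_append_pairs` equals the binomial coefficient times `m!`, and `m!` belongs to the value
-- of the top power of `a` on its frame.
include H in
lemma IsBiproduct.wedgePow_append {a : E [⋀^Fin 2]→L[ℝ] ℂ} {b : F [⋀^Fin 2]→L[ℝ] ℂ} {m n : ℕ}
    {e : Fin m → E} (he : IsOrthogonalFrame a e) (hb : ∀ u v, b ![Complex.I • u, Complex.I • v] = b ![u, v])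
    (f : Fin (2 * n) → F) (h : 2 * (n + m) = 2 * m + 2 * n) :
    wedgePow (pullC π₁ a + pullC π₂ b) (n + m) (Fin.append (i₁ ∘ pairs e) (i₂ ∘ f) ∘ Fin.cast h) =
      ((n + m).choose m * wedgePow a m (pairs e)) * wedgePow b n f := by
  set w := pullC π₁ a + pullC π₂ b with hw
  have hw2 : ∀ u v, w ![u, v] = a ![π₁ u, π₁ v] + b ![π₂ u, π₂ v] := fun u v ↦ by
    rw [hw, ContinuousAlternatingMap.add_apply, pullC_two, pullC_two]
  have hE : ∀ u v, w ![i₁ u, i₁ v] = a ![u, v] := fun u v ↦ by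
    rw [hw2, H.fst_inl, H.fst_inl, H.snd_inl, two_form_zero_left, add_zero]
  have hEF : ∀ u v, w ![i₁ u, i₂ v] = 0 := fun u v ↦ by
    rw [hw2, H.snd_inl, H.fst_inr, two_form_zero_left, two_form_zero_right, add_zero]
  have hI : ∀ x, Complex.I • i₁ x = i₁ (Complex.I • x) := fun x ↦ (i₁.map_smul _ _).symm
  have hwe : IsOrthogonalFrame w (fun j ↦ i₁ (e j)) := by
    refine ⟨fun u v ↦ ?_, fun i j hij ↦ ?_, fun i j hij ↦ ?_⟩
    · rw [hw2, hw2, π₁.map_smul, π₁.map_smul, π₂.map_smul, π₂.map_smul, he.type_one_one, hb]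
    · rw [hE, he.zero i j hij]
    · rw [hI, hE, he.zero' i j hij]
  have hp : i₁ ∘ pairs e = pairs fun j ↦ i₁ (e j) := funext fun j ↦ map_pairs i₁ e j
  have hb' : w.compContinuousLinearMap (i₂.restrictScalars ℝ) = b := by
    ext v
    change a (fun i ↦ π₁ (i₂ (v i))) + b (fun i ↦ π₂ (i₂ (v i))) = b v
    simp only [H.fst_inr, H.snd_inr]
    rw [a.map_coord_zero 0 rfl, zero_add]
  rw [hp, wedgePow_append_pairs (f := i₂ ∘ f) hwe (fun i j ↦ hEF _ _) (fun i j ↦ by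
    rw [hI]
    exact hEF _ _), wedgePow_pairs he, Nat.ascFactorial_eq_factorial_mul_choose]
  have h1 : wedgePow w n (i₂ ∘ f) = wedgePow b n f := by
    rw [← hb', wedgePow_compContinuousLinearMap]
    rfl
  simp only [hI, hE, h1]
  push_cast
  ring

include H in
lemma IsBiproduct.wedge_append {p q : ℕ} (a : E [⋀^Fin p]→L[ℝ] ℂ) (b : F [⋀^Fin q]→L[ℝ] ℂ)
    (e : Fin p → E) (f : Fin q → F) :
    wedge (pullC π₁ a) (pullC π₂ b) (Fin.append (i₁ ∘ e) (i₂ ∘ f)) = a e * b f := by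
  rw [StronglyGauduchon.wedge_append]
  · rw [ContinuousAlternatingMap.compContinuousLinearMap_apply,
      ContinuousAlternatingMap.compContinuousLinearMap_apply]
    congr 2 <;> funext i
    · exact H.fst_inl _
    · exact H.snd_inr _
  · rintro u ⟨i, j, hij⟩
    rw [ContinuousAlternatingMap.compContinuousLinearMap_apply]
    refine a.map_coord_zero i ?_
    change π₁ (u i) = 0
    rw [hij]
    exact H.fst_inr _

-- Doubling the second summand multiplies the product form by `2 ^ q`, the degree of `b`, and the
-- chosen arguments by `2 ^ k`. As `k ≠ q`, the value is zero.
include H in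
lemma IsBiproduct.wedge_append_eq_zero {p q s k : ℕ} (a : E [⋀^Fin p]→L[ℝ] ℂ)
    (b : F [⋀^Fin q]→L[ℝ] ℂ) (e : Fin s → E) (f : Fin k → F) (h : q + p = s + k) (hk : k ≠ q) :
    wedge (pullC π₂ b) (pullC π₁ a) (Fin.append (i₁ ∘ e) (i₂ ∘ f) ∘ Fin.cast h) = 0 := by
  set η := wedge (pullC π₂ b) (pullC π₁ a) with hη
  set T : W →L[ℝ] W := (i₁.comp π₁ + (2 : ℂ) • i₂.comp π₂).restrictScalars ℝ with hT
  have h1 : (π₁.restrictScalars ℝ).comp T = π₁.restrictScalars ℝ := by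
    ext v
    change π₁ (i₁ (π₁ v) + (2 : ℂ) • i₂ (π₂ v)) = π₁ v
    rw [map_add, π₁.map_smul, H.fst_inl, H.fst_inr, smul_zero, add_zero]
  have h2 : (π₂.restrictScalars ℝ).comp T = (2 : ℝ) • π₂.restrictScalars ℝ := by
    ext v
    change π₂ (i₁ (π₁ v) + (2 : ℂ) • i₂ (π₂ v)) = (2 : ℝ) • π₂ v
    rw [map_add, π₂.map_smul, H.snd_inl, H.snd_inr, zero_add, ← Complex.coe_smul]
    norm_num
  have h3 : η.compContinuousLinearMap T = (2 : ℝ) ^ q • η := by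
    rw [hη, ← wedge_compContinuousLinearMap, ← wedge_smul_left,
      ← compContinuousLinearMap_smul, ← h2]
    conv_rhs => rw [pullC, ← h1]
    rfl
  have h4 := congrArg (fun η : W [⋀^Fin (q + p)]→L[ℝ] ℂ ↦
    η (Fin.append (i₁ ∘ e) (i₂ ∘ f) ∘ Fin.cast h)) h3
  simp only [ContinuousAlternatingMap.compContinuousLinearMap_apply,
    ContinuousAlternatingMap.smul_apply] at h4
  have h5 : T ∘ (Fin.append (i₁ ∘ e) (i₂ ∘ f) ∘ Fin.cast h) =
      Fin.append (i₁ ∘ e) (fun i ↦ (2 : ℝ) • (i₂ ∘ f) i) ∘ Fin.cast h := by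
    funext i
    simp only [Function.comp_apply]
    generalize Fin.cast h i = i
    refine Fin.addCases (fun i ↦ ?_) (fun i ↦ ?_) i
    · rw [Fin.append_left, Fin.append_left, Function.comp_apply]
      change i₁ (π₁ (i₁ (e i))) + (2 : ℂ) • i₂ (π₂ (i₁ (e i))) = _
      rw [H.fst_inl, H.snd_inl, map_zero, smul_zero, add_zero]
    · rw [Fin.append_right, Fin.append_right, Function.comp_apply]
      change i₁ (π₁ (i₂ (f i))) + (2 : ℂ) • i₂ (π₂ (i₂ (f i))) = _
      rw [H.snd_inr, H.fst_inr, map_zero, zero_add, ← Complex.coe_smul]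
      norm_num
  rw [h5, map_append_smul_right, Complex.real_smul] at h4
  have h6 : ((2 : ℝ) : ℂ) ^ k - (((2 : ℝ) ^ q : ℝ) : ℂ) ≠ 0 := by
    rw [← Complex.ofReal_pow, ← Complex.ofReal_sub, Complex.ofReal_ne_zero, sub_ne_zero]
    exact fun h ↦ hk (pow_right_injective₀ two_pos (by norm_num) h)
  refine (mul_eq_zero.1 ?_).resolve_left h6
  rw [sub_mul, h4, sub_self]

end Biproduct

/-! ### The sum of two metrics and its potential -/

section ProductForm
variable {E F W : Type*} [NormedAddCommGroup E] [NormedSpace ℂ E] [NormedAddCommGroup F]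
  [NormedSpace ℂ F] [NormedAddCommGroup W] [NormedSpace ℂ W]

/-- The sum of the pullbacks of two metrics. -/
def sumForm (π₁ : W →L[ℂ] E) (π₂ : W →L[ℂ] F) (a : E [⋀^Fin 2]→L[ℝ] ℂ)
    (b : F [⋀^Fin 2]→L[ℝ] ℂ) : W [⋀^Fin 2]→L[ℝ] ℂ := pullC π₁ a + pullC π₂ b

/-- The form whose `∂̄` is `∂` of a power of the sum of two metrics. -/
def sumPotential (π₁ : W →L[ℂ] E) (π₂ : W →L[ℂ] F) {m m' n n' p : ℕ} (h₁ : 2 * n + 2 * m' = 2 * p)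
    (h₂ : 2 * m + 2 * n' = 2 * p) (a : E [⋀^Fin 2]→L[ℝ] ℂ) (b : F [⋀^Fin 2]→L[ℝ] ℂ)
    (α : E [⋀^Fin (2 * m')]→L[ℝ] ℂ) (β : F [⋀^Fin (2 * n')]→L[ℝ] ℂ) :
    W [⋀^Fin (2 * p)]→L[ℝ] ℂ :=
  (p.choose n : ℝ) • castForm h₁ (wedge (pullC π₂ (wedgePow b n)) (pullC π₁ α)) +
    (p.choose m : ℝ) • castForm h₂ (wedge (pullC π₁ (wedgePow a m)) (pullC π₂ β))

lemma sumForm_comm (π₁ : W →L[ℂ] E) (π₂ : W →L[ℂ] F) (a : E [⋀^Fin 2]→L[ℝ] ℂ)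
    (b : F [⋀^Fin 2]→L[ℝ] ℂ) : sumForm π₁ π₂ a b = sumForm π₂ π₁ b a := add_comm _ _

lemma sumPotential_comm (π₁ : W →L[ℂ] E) (π₂ : W →L[ℂ] F) {m m' n n' p : ℕ}
    (h₁ : 2 * n + 2 * m' = 2 * p) (h₂ : 2 * m + 2 * n' = 2 * p) (a : E [⋀^Fin 2]→L[ℝ] ℂ)
    (b : F [⋀^Fin 2]→L[ℝ] ℂ) (α : E [⋀^Fin (2 * m')]→L[ℝ] ℂ) (β : F [⋀^Fin (2 * n')]→L[ℝ] ℂ) :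
    sumPotential π₁ π₂ h₁ h₂ a b α β = sumPotential π₂ π₁ h₂ h₁ b a β α := add_comm _ _

lemma sumForm_comp {W' : Type*} [NormedAddCommGroup W'] [NormedSpace ℂ W'] (π₁ : W →L[ℂ] E)
    (π₂ : W →L[ℂ] F) (a : E [⋀^Fin 2]→L[ℝ] ℂ) (b : F [⋀^Fin 2]→L[ℝ] ℂ) (L : W' →L[ℝ] W) :
    (sumForm π₁ π₂ a b).compContinuousLinearMap L =
      a.compContinuousLinearMap ((π₁.restrictScalars ℝ).comp L) +
        b.compContinuousLinearMap ((π₂.restrictScalars ℝ).comp L) := rfl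

lemma sumPotential_comp {W' : Type*} [NormedAddCommGroup W'] [NormedSpace ℂ W'] (π₁ : W →L[ℂ] E)
    (π₂ : W →L[ℂ] F) {m m' n n' p : ℕ}
    (h₁ : 2 * n + 2 * m' = 2 * p) (h₂ : 2 * m + 2 * n' = 2 * p) (a : E [⋀^Fin 2]→L[ℝ] ℂ)
    (b : F [⋀^Fin 2]→L[ℝ] ℂ) (α : E [⋀^Fin (2 * m')]→L[ℝ] ℂ) (β : F [⋀^Fin (2 * n')]→L[ℝ] ℂ)
    (L : W' →L[ℝ] W) :
    (sumPotential π₁ π₂ h₁ h₂ a b α β).compContinuousLinearMap L =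
      (p.choose n : ℝ) • castForm h₁
        (wedge ((wedgePow b n).compContinuousLinearMap ((π₂.restrictScalars ℝ).comp L))
          (α.compContinuousLinearMap ((π₁.restrictScalars ℝ).comp L))) +
      (p.choose m : ℝ) • castForm h₂
        (wedge ((wedgePow a m).compContinuousLinearMap ((π₁.restrictScalars ℝ).comp L))
          (β.compContinuousLinearMap ((π₂.restrictScalars ℝ).comp L))) := by
  have h3 : ∀ {q} (a : W [⋀^Fin q]→L[ℝ] ℂ) (b : W [⋀^Fin q]→L[ℝ] ℂ) (r s : ℝ),
    (r • a + s • b).compContinuousLinearMap L = r • a.compContinuousLinearMap L +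
      s • b.compContinuousLinearMap L := fun _ _ _ _ ↦ rfl
  rw [sumPotential, h3, castForm_compContinuousLinearMap, castForm_compContinuousLinearMap,
    ← wedge_compContinuousLinearMap, ← wedge_compContinuousLinearMap]
  rfl

lemma contDiffAt_pullC {k : ℕ} (π : W →L[ℂ] E) {a : Form E E k} {z : W}
    (ha : ContDiffAt ℝ ∞ a (π z)) : ContDiffAt ℝ ∞ (fun z ↦ pullC π (a (π z))) z :=
  (ContinuousAlternatingMap.compContinuousLinearMapCLM (F := ℂ) (ι := Fin k)
    (π.restrictScalars ℝ)).contDiff.contDiffAt.comp z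
    (ha.comp z (π.restrictScalars ℝ).contDiff.contDiffAt)

lemma contDiffAt_sumForm {π₁ : W →L[ℂ] E} {π₂ : W →L[ℂ] F} {a : Form E E 2} {b : Form F F 2} {z : W}
    (ha : ContDiffAt ℝ ∞ a (π₁ z)) (hb : ContDiffAt ℝ ∞ b (π₂ z)) :
    ContDiffAt ℝ ∞ (fun z ↦ sumForm π₁ π₂ (a (π₁ z)) (b (π₂ z))) z :=
  (contDiffAt_pullC π₁ ha).add (contDiffAt_pullC π₂ hb)

variable [FiniteDimensional ℂ E] [FiniteDimensional ℂ F] [FiniteDimensional ℂ W]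

lemma contDiffAt_sumPotential {π₁ : W →L[ℂ] E} {π₂ : W →L[ℂ] F} {m m' n n' p : ℕ}
    (h₁ : 2 * n + 2 * m' = 2 * p) (h₂ : 2 * m + 2 * n' = 2 * p) {a : Form E E 2} {b : Form F F 2}
    {α : Form E E (2 * m')} {β : Form F F (2 * n')} {z : W}
    (ha : ContDiffAt ℝ ∞ a (π₁ z)) (hb : ContDiffAt ℝ ∞ b (π₂ z))
    (hα : ContDiffAt ℝ ∞ α (π₁ z)) (hβ : ContDiffAt ℝ ∞ β (π₂ z)) :
    ContDiffAt ℝ ∞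
      (fun z ↦ sumPotential π₁ π₂ h₁ h₂ (a (π₁ z)) (b (π₂ z)) (α (π₁ z)) (β (π₂ z))) z := by
  have ha' := contDiffAt_pullC π₁ (a := fun x ↦ wedgePow (a x) m)
    ((contDiff_wedgePow m).contDiffAt.comp _ ha)
  have hb' := contDiffAt_pullC π₂ (a := fun x ↦ wedgePow (b x) n)
    ((contDiff_wedgePow n).contDiffAt.comp _ hb)
  have h3 := (((wedgeL W _ _).contDiff.contDiffAt.comp z hb').clm_apply (contDiffAt_pullC π₁ hα))
  have h4 := (((wedgeL W _ _).contDiff.contDiffAt.comp z ha').clm_apply (contDiffAt_pullC π₂ hβ))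
  exact (((contDiff_castForm h₁).contDiffAt.comp z h3).const_smul _).add
    (((contDiff_castForm h₂).contDiffAt.comp z h4).const_smul _)

omit [FiniteDimensional ℂ F] [FiniteDimensional ℂ W] in
lemma flatD_append_cast (c : ℂ) {s k q : ℕ} (hq : q = s + k) (hs : Even s) (hk : Even k)
    (R : Fin s → W) (A : F →L[ℂ] W)
    (T : W →L[ℝ] W) (hTR : ∀ j, T (R j) = R j) (hTA : ∀ t, T (A t) = - A t)
    {Θ : Form W W q} {z : W} (hΘ : DifferentiableAt ℝ Θ z)
    (hT : ∀ z, (Θ z).compContinuousLinearMap T = Θ z) {b : Form F F k} {y : F}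
    (hb : DifferentiableAt ℝ b y) (C : ℂ)
    (h : ∀ t f, Θ (z + A t) (Fin.append R (A ∘ f) ∘ Fin.cast hq) = C * b (y + t) f)
    (u : Fin (k + 1) → F) (hq' : q + 1 = s + (k + 1)) :
    flatD c Θ z (Fin.append R (A ∘ u) ∘ Fin.cast hq') = C * flatD c b y u := by
  subst hq
  exact flatD_append c hs hk R A T hTR hTA hΘ hT hb C h u

/-- Contracted with a diagonal frame of the first factor, the power of the sum becomes `C` times the
power of `b`, and the potential becomes the same `C` times `β`; the term containing `α` drops out,
having the wrong degree along `F` since `n' ≠ n`. So the identity reduces to the one on the second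
factor. -/
lemma IsBiproduct.flatD_eq_flatD {i₁ : E →L[ℂ] W} {i₂ : F →L[ℂ] W} {π₁ : W →L[ℂ] E}
    {π₂ : W →L[ℂ] F} (H : IsBiproduct i₁ i₂ π₁ π₂) {m m' n n' p : ℕ}
    (h₁ : 2 * n + 2 * m' = 2 * p) (h₂ : 2 * m + 2 * n' = 2 * p) (hn : n' ≠ n)
    {a : Form E E 2} {b : Form F F 2}
    {α : Form E E (2 * m')} {β : Form F F (2 * n')} {z : W}
    (ha : ContDiffAt ℝ ∞ a (π₁ z)) (hb : ContDiffAt ℝ ∞ b (π₂ z))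
    (hα : ContDiffAt ℝ ∞ α (π₁ z)) (hβ : ContDiffAt ℝ ∞ β (π₂ z))
    (hbI : ∀ y u v, b y ![Complex.I • u, Complex.I • v] = b y ![u, v])
    (hD : flatD (-Complex.I) (fun y ↦ wedgePow (b y) n') (π₂ z) = flatD Complex.I β (π₂ z))
    {e : Fin m → E} (he : IsOrthogonalFrame (a (π₁ z)) e) (u : Fin (2 * n' + 1) → F)
    (hq : 2 * p + 1 = 2 * m + (2 * n' + 1)) :
    flatD (-Complex.I) (fun z ↦ wedgePow (sumForm π₁ π₂ (a (π₁ z)) (b (π₂ z))) p) z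
        (Fin.append (i₁ ∘ pairs e) (i₂ ∘ u) ∘ Fin.cast hq) =
      flatD Complex.I
        (fun z ↦ sumPotential π₁ π₂ h₁ h₂ (a (π₁ z)) (b (π₂ z)) (α (π₁ z)) (β (π₂ z))) z
        (Fin.append (i₁ ∘ pairs e) (i₂ ∘ u) ∘ Fin.cast hq) := by
  -- The reflection in the first summand. It fixes both forms because every factor pulled back from
  -- the second summand has even degree.
  set T : W →L[ℝ] W := (i₁.comp π₁ - i₂.comp π₂).restrictScalars ℝ with hT
  have hT1 : (π₁.restrictScalars ℝ).comp T = π₁.restrictScalars ℝ := by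
    ext v
    change π₁ (i₁ (π₁ v) - i₂ (π₂ v)) = π₁ v
    rw [map_sub, H.fst_inl, H.fst_inr, sub_zero]
  have hT2 : (π₂.restrictScalars ℝ).comp T = - π₂.restrictScalars ℝ := by
    ext v
    change π₂ (i₁ (π₁ v) - i₂ (π₂ v)) = - π₂ v
    rw [map_sub, H.snd_inl, H.snd_inr, zero_sub]
  have hTR : ∀ j, T ((i₁ ∘ pairs e) j) = (i₁ ∘ pairs e) j := fun j ↦ by
    change i₁ (π₁ (i₁ (pairs e j))) - i₂ (π₂ (i₁ (pairs e j))) = i₁ (pairs e j)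
    rw [H.fst_inl, H.snd_inl, map_zero, sub_zero]
  have hTA : ∀ t, T (i₂ t) = - i₂ t := fun t ↦ by
    change i₁ (π₁ (i₂ t)) - i₂ (π₂ (i₂ t)) = - i₂ t
    rw [H.snd_inr, H.fst_inr, map_zero, zero_sub]
  have hz1 : ∀ t, π₁ (z + i₂ t) = π₁ z := fun t ↦ by rw [map_add, H.fst_inr, add_zero]
  have hz2 : ∀ t, π₂ (z + i₂ t) = π₂ z + t := fun t ↦ by rw [map_add, H.snd_inr]
  have hp : p = n' + m := by omega
  have hq0 : 2 * p = 2 * m + 2 * n' := by omega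
  set C : ℂ := p.choose m * wedgePow (a (π₁ z)) m (pairs e) with hC
  have hΩ := flatD_append_cast (-Complex.I) hq0 (even_two_mul m) (even_two_mul n')
    (i₁ ∘ pairs e) i₂ T hTR hTA (z := z) (y := π₂ z) (b := fun y ↦ wedgePow (b y) n')
    (Θ := fun z ↦ wedgePow (sumForm π₁ π₂ (a (π₁ z)) (b (π₂ z))) p)
    (ContDiffAt.differentiableAt ((contDiff_wedgePow p).contDiffAt.comp z
      (contDiffAt_sumForm ha hb)) (by simp))
    (fun z ↦ by
      rw [← wedgePow_compContinuousLinearMap, sumForm_comp, hT1, hT2,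
        compContinuousLinearMap_neg_of_even even_two]
      rfl)
    (ContDiffAt.differentiableAt ((contDiff_wedgePow n').contDiffAt.comp _ hb) (by simp)) C
    (fun t f ↦ by
      subst hp
      simp only [hz1, hz2]
      exact H.wedgePow_append he (hbI _) f hq0) u hq
  have hβ' := flatD_append_cast Complex.I hq0 (even_two_mul m) (even_two_mul n')
    (i₁ ∘ pairs e) i₂ T hTR hTA (z := z) (y := π₂ z) (b := β)
    (Θ := fun z ↦ sumPotential π₁ π₂ h₁ h₂ (a (π₁ z)) (b (π₂ z)) (α (π₁ z)) (β (π₂ z)))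
    (ContDiffAt.differentiableAt (contDiffAt_sumPotential h₁ h₂ ha hb hα hβ) (by simp))
    (fun z ↦ by
      rw [sumPotential_comp, hT1, hT2, compContinuousLinearMap_neg_of_even (even_two_mul n),
        compContinuousLinearMap_neg_of_even (even_two_mul n')]
      rfl)
    (ContDiffAt.differentiableAt hβ (by simp)) C
    (fun t f ↦ by
      simp only [hz1, hz2]
      rw [sumPotential, ContinuousAlternatingMap.add_apply, ContinuousAlternatingMap.smul_apply,
        ContinuousAlternatingMap.smul_apply, castForm_apply, castForm_apply]
      have h3 := H.wedge_append_eq_zero (α (π₁ z)) (wedgePow (b (π₂ z + t)) n) (pairs e) f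
        (by omega) (by omega)
      have h4 := H.wedge_append (wedgePow (a (π₁ z)) m) (β (π₂ z + t)) (pairs e) f
      have h5 : (Fin.append (i₁ ∘ pairs e) (i₂ ∘ f) ∘ Fin.cast hq0) ∘ Fin.cast h₂ =
        Fin.append (i₁ ∘ pairs e) (i₂ ∘ f) := rfl
      have h6 : (Fin.append (i₁ ∘ pairs e) (i₂ ∘ f) ∘ Fin.cast hq0) ∘ Fin.cast h₁ =
        Fin.append (i₁ ∘ pairs e) (i₂ ∘ f) ∘ Fin.cast (h₁.trans hq0) := rfl
      rw [h5, h6, h3, h4, smul_zero, zero_add, Complex.real_smul, Complex.ofReal_natCast, hC]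
      ring) u hq
  rw [hΩ, hβ', hD]

end ProductForm

/-! ### The product identity in coordinates -/

section Flat
variable {E F : Type*} [NormedAddCommGroup E] [NormedSpace ℂ E] [NormedAddCommGroup F]
  [NormedSpace ℂ F]

lemma IsPositiveForm.exists_isOrthogonalFrame_of_finrank [FiniteDimensional ℂ E]
    {w : E [⋀^Fin 2]→L[ℝ] ℂ} (hw : IsPositiveForm w) {m : ℕ} (hm : Module.finrank ℂ E = m) :
    ∃ e : Module.Basis (Fin m) ℂ E, IsOrthogonalFrame w e := by
  subst hm
  exact hw.exists_isOrthogonalFrame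

lemma isBiproduct_prod (E F : Type*) [NormedAddCommGroup E] [NormedSpace ℂ E]
    [NormedAddCommGroup F] [NormedSpace ℂ F] :
    IsBiproduct (ContinuousLinearMap.inl ℂ E F) (ContinuousLinearMap.inr ℂ E F)
      (ContinuousLinearMap.fst ℂ E F) (ContinuousLinearMap.snd ℂ E F) :=
  ⟨fun _ ↦ rfl, fun _ ↦ rfl, fun _ ↦ rfl, fun _ ↦ rfl⟩

/-- A form of codimension one on a product vanishes if its contractions with frames of the factors
vanish. -/
lemma eq_zero_of_append {s r d : ℕ} (hd : d + 1 = s + r) (B₁ : Module.Basis (Fin s) ℝ E)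
    (B₂ : Module.Basis (Fin r) ℝ F) {η : (E × F) [⋀^Fin d]→L[ℝ] ℂ} {k l : ℕ} (hk : d = s + k)
    (hl : d = r + l)
    (h₁ : ∀ u : Fin k → F, η (Fin.append (ContinuousLinearMap.inl ℂ E F ∘ B₁)
      (ContinuousLinearMap.inr ℂ E F ∘ u) ∘ Fin.cast hk) = 0)
    (h₂ : ∀ u : Fin l → E, η (Fin.append (ContinuousLinearMap.inr ℂ E F ∘ B₂)
      (ContinuousLinearMap.inl ℂ E F ∘ u) ∘ Fin.cast hl) = 0) : η = 0 := by
  have h0 : η.toAlternatingMap = 0 := by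
    refine Module.Basis.ext_alternating (B₁.prod B₂) fun v hv ↦ ?_
    change η (fun i ↦ B₁.prod B₂ (v i)) = 0
    have hB1 : ∀ j, B₁.prod B₂ (.inl j) = (ContinuousLinearMap.inl ℂ E F ∘ B₁) j := fun j ↦ by
      simp
    have hB2 : ∀ j, B₁.prod B₂ (.inr j) = (ContinuousLinearMap.inr ℂ E F ∘ B₂) j := fun j ↦ by
      simp
    -- An injective tuple of basis vectors with one entry fewer than the basis omits only one
    -- vector, so it contains the basis of one factor entirely.
    have hcases : (∀ j, ∃ i, v i = .inl j) ∨ (∀ j, ∃ i, v i = .inr j) := by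
      by_contra! hcon
      obtain ⟨⟨j, hj⟩, j', hj'⟩ := hcon
      have h3 := Finset.card_le_card (s := insert (Sum.inl j) (insert (Sum.inr j')
        (Finset.univ.image v))) (t := Finset.univ) (Finset.subset_univ _)
      rw [Finset.card_insert_of_notMem (by simp [hj]), Finset.card_insert_of_notMem
        (by simp [hj']), Finset.card_image_of_injective _ hv] at h3
      simp only [Finset.card_univ, Fintype.card_fin, Fintype.card_sum] at h3
      omega
    rcases hcases with h | h
    · choose i hi using h
      refine map_eq_zero_of_forall_append hk (x := ContinuousLinearMap.inl ℂ E F ∘ B₁)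
        (S := Set.range (ContinuousLinearMap.inr ℂ E F)) (fun t ht ↦ ?_) (i := i)
        (fun j j' hjj ↦ Sum.inl_injective (by rw [← hi, ← hi, hjj])) (fun j ↦ ?_) (fun c hc ↦ ?_)
      · choose u hu using ht
        rw [show t = ContinuousLinearMap.inr ℂ E F ∘ u from funext fun i ↦ (hu i).symm]
        exact h₁ u
      · rw [hi, hB1]
      · rcases hvc : v c with j | j
        · exact absurd (hv ((hi j).trans hvc.symm)) (hc j)
        · exact ⟨_, (hB2 j).symm⟩
    · choose i hi using h
      refine map_eq_zero_of_forall_append hl (x := ContinuousLinearMap.inr ℂ E F ∘ B₂)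
        (S := Set.range (ContinuousLinearMap.inl ℂ E F)) (fun t ht ↦ ?_) (i := i)
        (fun j j' hjj ↦ Sum.inr_injective (by rw [← hi, ← hi, hjj])) (fun j ↦ ?_) (fun c hc ↦ ?_)
      · choose u hu using ht
        rw [show t = ContinuousLinearMap.inl ℂ E F ∘ u from funext fun i ↦ (hu i).symm]
        exact h₂ u
      · rw [hi, hB2]
      · rcases hvc : v c with j | j
        · exact ⟨_, (hB1 j).symm⟩
        · exact absurd (hv ((hi j).trans hvc.symm)) (hc j)
  ext v
  exact congrArg (fun f ↦ f v) h0

variable [FiniteDimensional ℂ E] [FiniteDimensional ℂ F]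

/-- The product formula in coordinates. -/
theorem flatD_sum {m' n' : ℕ} (hm : Module.finrank ℂ E = m' + 1) (hn : Module.finrank ℂ F = n' + 1)
    (h₁ : 2 * (n' + 1) + 2 * m' = 2 * (m' + n' + 1)) (h₂ : 2 * (m' + 1) + 2 * n' = 2 * (m' + n' + 1))
    {a : Form E E 2} {b : Form F F 2} {α : Form E E (2 * m')} {β : Form F F (2 * n')} {z : E × F}
    (ha : ContDiffAt ℝ ∞ a z.1) (hb : ContDiffAt ℝ ∞ b z.2)
    (hα : ContDiffAt ℝ ∞ α z.1) (hβ : ContDiffAt ℝ ∞ β z.2)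
    (haI : ∀ x u v, a x ![Complex.I • u, Complex.I • v] = a x ![u, v])
    (hbI : ∀ y u v, b y ![Complex.I • u, Complex.I • v] = b y ![u, v])
    (hapos : IsPositiveForm (a z.1)) (hbpos : IsPositiveForm (b z.2))
    (haD : flatD (-Complex.I) (fun x ↦ wedgePow (a x) m') z.1 = flatD Complex.I α z.1)
    (hbD : flatD (-Complex.I) (fun y ↦ wedgePow (b y) n') z.2 = flatD Complex.I β z.2) :
    flatD (-Complex.I) (fun z : E × F ↦ wedgePow (sumForm (ContinuousLinearMap.fst ℂ E F)
      (ContinuousLinearMap.snd ℂ E F) (a z.1) (b z.2)) (m' + n' + 1)) z =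
    flatD Complex.I (fun z : E × F ↦ sumPotential (ContinuousLinearMap.fst ℂ E F)
      (ContinuousLinearMap.snd ℂ E F) h₁ h₂ (a z.1) (b z.2) (α z.1) (β z.2)) z := by
  obtain ⟨e₁, he₁⟩ := hapos.exists_isOrthogonalFrame_of_finrank hm
  obtain ⟨e₂, he₂⟩ := hbpos.exists_isOrthogonalFrame_of_finrank hn
  obtain ⟨B₁, hB₁⟩ := exists_basis_eq_pairs e₁
  obtain ⟨B₂, hB₂⟩ := exists_basis_eq_pairs e₂
  refine sub_eq_zero.1 (eq_zero_of_append (d := 2 * (m' + n' + 1) + 1) (by omega) B₁ B₂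
    (k := 2 * n' + 1) (l := 2 * m' + 1) (by omega) (by omega) (fun u ↦ ?_) fun u ↦ ?_)
  · rw [hB₁, ContinuousAlternatingMap.sub_apply, sub_eq_zero]
    exact (isBiproduct_prod E F).flatD_eq_flatD h₁ h₂ (by omega) ha hb hα hβ hbI hbD he₁ u _
  · rw [hB₂, ContinuousAlternatingMap.sub_apply, sub_eq_zero]
    simp only [sumForm_comm (ContinuousLinearMap.fst ℂ E F),
      sumPotential_comm (ContinuousLinearMap.fst ℂ E F)]
    exact (isBiproduct_prod E F).symm.flatD_eq_flatD h₂ h₁ (by omega) hb ha hβ hα haI haD he₂ u _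

end Flat

/-! ### Products of strongly Gauduchon manifolds -/

section ProductManifold

variable {E F W : Type*} [NormedAddCommGroup E] [NormedSpace ℂ E] [NormedAddCommGroup F]
  [NormedSpace ℂ F] [NormedAddCommGroup W] [NormedSpace ℂ W]

lemma sumForm_pullC {W' E' F' : Type*} [NormedAddCommGroup W'] [NormedSpace ℂ W']
    [NormedAddCommGroup E'] [NormedSpace ℂ E'] [NormedAddCommGroup F'] [NormedSpace ℂ F']
    {π₁ : W →L[ℂ] E} {π₂ : W →L[ℂ] F} {ρ₁ : W' →L[ℂ] E'} {ρ₂ : W' →L[ℂ] F'} {L : W' →L[ℂ] W}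
    {A : E' →L[ℂ] E} {B : F' →L[ℂ] F} (hA : π₁.comp L = A.comp ρ₁) (hB : π₂.comp L = B.comp ρ₂)
    (a : E [⋀^Fin 2]→L[ℝ] ℂ) (b : F [⋀^Fin 2]→L[ℝ] ℂ) :
    pullC L (sumForm π₁ π₂ a b) = sumForm ρ₁ ρ₂ (pullC A a) (pullC B b) := by
  change pullC (π₁.comp L) a + pullC (π₂.comp L) b = _
  rw [hA, hB]
  rfl

lemma sumPotential_pullC {W' E' F' : Type*} [NormedAddCommGroup W'] [NormedSpace ℂ W']
    [NormedAddCommGroup E'] [NormedSpace ℂ E'] [NormedAddCommGroup F'] [NormedSpace ℂ F']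
    {π₁ : W →L[ℂ] E} {π₂ : W →L[ℂ] F} {ρ₁ : W' →L[ℂ] E'} {ρ₂ : W' →L[ℂ] F'} {L : W' →L[ℂ] W}
    {A : E' →L[ℂ] E} {B : F' →L[ℂ] F} (hA : π₁.comp L = A.comp ρ₁) (hB : π₂.comp L = B.comp ρ₂)
    {m m' n n' p : ℕ} (h₁ : 2 * n + 2 * m' = 2 * p) (h₂ : 2 * m + 2 * n' = 2 * p)
    (a : E [⋀^Fin 2]→L[ℝ] ℂ) (b : F [⋀^Fin 2]→L[ℝ] ℂ) (α : E [⋀^Fin (2 * m')]→L[ℝ] ℂ)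
    (β : F [⋀^Fin (2 * n')]→L[ℝ] ℂ) :
    pullC L (sumPotential π₁ π₂ h₁ h₂ a b α β) =
      sumPotential ρ₁ ρ₂ h₁ h₂ (pullC A a) (pullC B b) (pullC A α) (pullC B β) := by
  have hA' : (π₁.restrictScalars ℝ).comp (L.restrictScalars ℝ) =
    (A.restrictScalars ℝ).comp (ρ₁.restrictScalars ℝ) :=
    congrArg (ContinuousLinearMap.restrictScalars ℝ) hA
  have hB' : (π₂.restrictScalars ℝ).comp (L.restrictScalars ℝ) =
    (B.restrictScalars ℝ).comp (ρ₂.restrictScalars ℝ) :=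
    congrArg (ContinuousLinearMap.restrictScalars ℝ) hB
  rw [pullC, sumPotential_comp, hA', hB', sumPotential, wedgePow_compContinuousLinearMap,
    wedgePow_compContinuousLinearMap]
  rfl

variable {X : Type*} [TopologicalSpace X] [ChartedSpace (E × F) X]
  {M : Type*} [TopologicalSpace M] [ChartedSpace E M]
  {N : Type*} [TopologicalSpace N] [ChartedSpace F N]

/-- A manifold whose preferred charts are products of preferred charts of two manifolds. -/
structure IsChartProduct (E F : Type*) [NormedAddCommGroup E] [NormedSpace ℂ E]
    [NormedAddCommGroup F] [NormedSpace ℂ F] {X : Type*} [TopologicalSpace X]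
    [ChartedSpace (E × F) X] {M : Type*} [TopologicalSpace M] [ChartedSpace E M]
    {N : Type*} [TopologicalSpace N] [ChartedSpace F N] (p₁ : X → M) (p₂ : X → N) : Prop where
  contMDiff_fst : ContMDiff 𝓘(ℂ, E × F) 𝓘(ℂ, E) ω p₁
  contMDiff_snd : ContMDiff 𝓘(ℂ, E × F) 𝓘(ℂ, F) ω p₂
  fst_symm : ∀ x y, p₁ ((extChartAt 𝓘(ℂ, E × F) x).symm y) = (extChartAt 𝓘(ℂ, E) (p₁ x)).symm y.1
  snd_symm : ∀ x y, p₂ ((extChartAt 𝓘(ℂ, E × F) x).symm y) = (extChartAt 𝓘(ℂ, F) (p₂ x)).symm y.2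
  fst_chart : ∀ x, (extChartAt 𝓘(ℂ, E × F) x x).1 = extChartAt 𝓘(ℂ, E) (p₁ x) (p₁ x)
  snd_chart : ∀ x, (extChartAt 𝓘(ℂ, E × F) x x).2 = extChartAt 𝓘(ℂ, F) (p₂ x) (p₂ x)
  target_subset : ∀ x y, y ∈ (extChartAt 𝓘(ℂ, E × F) x).target →
    y.1 ∈ (extChartAt 𝓘(ℂ, E) (p₁ x)).target ∧ y.2 ∈ (extChartAt 𝓘(ℂ, F) (p₂ x)).target

variable [IsManifold 𝓘(ℂ, E × F) ω X] [IsManifold 𝓘(ℂ, E) ω M] [IsManifold 𝓘(ℂ, F) ω N]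
  {p₁ : X → M} {p₂ : X → N}

omit [IsManifold 𝓘(ℂ, E) ω M] in
lemma tderiv_comp_clm {ψ : E → M} (L : W →L[ℂ] E) {y : W}
    (hψ : MDifferentiableAt 𝓘(ℂ, E) 𝓘(ℂ, E) ψ (L y)) :
    tderiv W E (ψ ∘ L) y = (tderiv E E ψ (L y)).comp L := by
  rw [tderiv_comp (E' := E) (φ := L) y hψ (L.contMDiff.mdifferentiableAt (n := 1) (by simp)),
    tderiv_flat, ContinuousLinearMap.fderiv]

omit [IsManifold 𝓘(ℂ, E) ω M] in
lemma dc_eq_dc_of_coord {c c' : ℂ} {k : ℕ} {a b : Form E M k} {x : M}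
    {a' b' : Form E E k} (ha : coord a x =ᶠ[𝓝 (extChartAt 𝓘(ℂ, E) x x)] a')
    (hb : coord b x =ᶠ[𝓝 (extChartAt 𝓘(ℂ, E) x x)] b')
    (h : flatD c a' (extChartAt 𝓘(ℂ, E) x x) = flatD c' b' (extChartAt 𝓘(ℂ, E) x x)) :
    dc c a x = dc c' b x := by
  rw [dc, dc, flatD_congr c ha, flatD_congr c' hb, h]

omit [IsManifold 𝓘(ℂ, F) ω N] in
lemma IsChartProduct.tderiv_fst (H : IsChartProduct E F p₁ p₂) (x : X) :
    ∀ᶠ y in 𝓝 (extChartAt 𝓘(ℂ, E × F) x x),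
      (tderiv (E × F) E p₁ ((extChartAt 𝓘(ℂ, E × F) x).symm y)).comp
        (tderiv (E × F) (E × F) (extChartAt 𝓘(ℂ, E × F) x).symm y) =
      (tderiv E E (extChartAt 𝓘(ℂ, E) (p₁ x)).symm y.1).comp (ContinuousLinearMap.fst ℂ E F) := by
  have h1 : Filter.Tendsto (Prod.fst : E × F → E) (𝓝 (extChartAt 𝓘(ℂ, E × F) x x))
    (𝓝 (extChartAt 𝓘(ℂ, E) (p₁ x) (p₁ x))) := H.fst_chart x ▸ continuous_fst.tendsto _
  filter_upwards [extChartAt_target_mem_nhds (I := 𝓘(ℂ, E × F)) x,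
    h1 (extChartAt_target_mem_nhds (I := 𝓘(ℂ, E)) (p₁ x))] with y hy hy'
  rw [← tderiv_comp _ (H.contMDiff_fst.mdifferentiable (by simp) _)
    ((contMDiffAt_extChartAt_symm hy).mdifferentiableAt (by simp))]
  have h2 : p₁ ∘ (extChartAt 𝓘(ℂ, E × F) x).symm =
    (extChartAt 𝓘(ℂ, E) (p₁ x)).symm ∘ ContinuousLinearMap.fst ℂ E F := funext (H.fst_symm x)
  exact (congrArg (fun f ↦ tderiv (E × F) E f y) h2).trans (tderiv_comp_clm _
    ((contMDiffAt_extChartAt_symm hy').mdifferentiableAt (by simp)))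

omit [IsManifold 𝓘(ℂ, E) ω M] in
lemma IsChartProduct.tderiv_snd (H : IsChartProduct E F p₁ p₂) (x : X) :
    ∀ᶠ y in 𝓝 (extChartAt 𝓘(ℂ, E × F) x x),
      (tderiv (E × F) F p₂ ((extChartAt 𝓘(ℂ, E × F) x).symm y)).comp
        (tderiv (E × F) (E × F) (extChartAt 𝓘(ℂ, E × F) x).symm y) =
      (tderiv F F (extChartAt 𝓘(ℂ, F) (p₂ x)).symm y.2).comp (ContinuousLinearMap.snd ℂ E F) := by
  have h1 : Filter.Tendsto (Prod.snd : E × F → F) (𝓝 (extChartAt 𝓘(ℂ, E × F) x x))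
    (𝓝 (extChartAt 𝓘(ℂ, F) (p₂ x) (p₂ x))) := H.snd_chart x ▸ continuous_snd.tendsto _
  filter_upwards [extChartAt_target_mem_nhds (I := 𝓘(ℂ, E × F)) x,
    h1 (extChartAt_target_mem_nhds (I := 𝓘(ℂ, F)) (p₂ x))] with y hy hy'
  rw [← tderiv_comp _ (H.contMDiff_snd.mdifferentiable (by simp) _)
    ((contMDiffAt_extChartAt_symm hy).mdifferentiableAt (by simp))]
  have h2 : p₂ ∘ (extChartAt 𝓘(ℂ, E × F) x).symm =
    (extChartAt 𝓘(ℂ, F) (p₂ x)).symm ∘ ContinuousLinearMap.snd ℂ E F := funext (H.snd_symm x)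
  exact (congrArg (fun f ↦ tderiv (E × F) F f y) h2).trans (tderiv_comp_clm _
    ((contMDiffAt_extChartAt_symm hy').mdifferentiableAt (by simp)))

omit [IsManifold 𝓘(ℂ, E) ω M] in
lemma coord_wedgePow (w : Form E M 2) (k : ℕ) (x : M) :
    coord (fun x ↦ wedgePow (w x) k) x = fun y ↦ wedgePow (coord w x y) k :=
  funext fun _ ↦ (wedgePow_compContinuousLinearMap ..).symm

lemma flatD_coord (c : ℂ) {k : ℕ} {a : Form E M k} {x : M} (ha : SmoothAt a x) :
    flatD c (coord a x) (extChartAt 𝓘(ℂ, E) x x) = coord (dc c a) x (extChartAt 𝓘(ℂ, E) x x) := by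
  rw [coord, coord, ← dc_pull c (by rwa [extChartAt_to_inv])
    (contMDiffAt_extChartAt_symm (mem_extChartAt_target x)), dc_flat]

omit [IsManifold 𝓘(ℂ, E) ω M] in
lemma coord_map_I {w : Form E M 2} (hw : ∀ x, IsPositiveForm (w x)) (x : M) (y : E) (u v : E) :
    coord w x y ![Complex.I • u, Complex.I • v] = coord w x y ![u, v] := by
  change pullC _ _ _ = pullC _ _ _
  rw [pullC_two, pullC_two, map_smul, map_smul, (hw _).type_one_one]

lemma IsPositiveForm.sumForm {π₁ : W →L[ℂ] E} {π₂ : W →L[ℂ] F} {a : E [⋀^Fin 2]→L[ℝ] ℂ}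
    {b : F [⋀^Fin 2]→L[ℝ] ℂ} (ha : IsPositiveForm a) (hb : IsPositiveForm b)
    (hinj : ∀ v, π₁ v = 0 → π₂ v = 0 → v = 0) : IsPositiveForm (sumForm π₁ π₂ a b) := by
  have h : ∀ u v, StronglyGauduchon.sumForm π₁ π₂ a b ![u, v] = a ![π₁ u, π₁ v] + b ![π₂ u, π₂ v] :=
    fun u v ↦ by
      rw [StronglyGauduchon.sumForm, ContinuousAlternatingMap.add_apply, pullC_two, pullC_two]
  refine ⟨fun u v ↦ ?_, fun u v ↦ ?_, fun v hv ↦ ?_⟩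
  · rw [h, Complex.add_im, ha.real, hb.real, add_zero]
  · rw [h, h, map_smul, map_smul, map_smul, map_smul, ha.type_one_one, hb.type_one_one]
  · rw [h, Complex.add_re, map_smul, map_smul]
    by_cases h1 : π₁ v = 0
    · rw [h1, smul_zero, two_form_zero_left, Complex.zero_re, zero_add]
      exact hb.pos _ fun h2 ↦ hv (hinj v h1 h2)
    · refine add_pos_of_pos_of_nonneg (ha.pos _ h1) ?_
      by_cases h2 : π₂ v = 0
      · rw [h2, smul_zero, two_form_zero_left, Complex.zero_re]
      · exact (hb.pos _ h2).le

variable [FiniteDimensional ℂ E] [FiniteDimensional ℂ F]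

/-- In the preferred charts the derivatives of `p₁` and `p₂` become the linear projections of `E ×
F`, whose kernels meet in zero. -/
lemma IsChartProduct.eq_zero_of_tderiv (H : IsChartProduct E F p₁ p₂) (x : X) (v : E × F)
    (h₁ : tderiv (E × F) E p₁ x v = 0) (h₂ : tderiv (E × F) F p₂ x v = 0) : v = 0 := by
  have hinj := tderiv_extChartAt_symm_injective (mem_extChartAt_target (I := 𝓘(ℂ, E × F)) x)
  obtain ⟨u, rfl⟩ := LinearMap.surjective_of_injective (f := (tderiv (E × F) (E × F)
    (extChartAt 𝓘(ℂ, E × F) x).symm (extChartAt 𝓘(ℂ, E × F) x x)).toLinearMap) hinj v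
  have h3 := congrArg (fun f ↦ f u) (H.tderiv_fst x).self_of_nhds
  have h4 := congrArg (fun f ↦ f u) (H.tderiv_snd x).self_of_nhds
  rw [extChartAt_to_inv] at h3 h4
  rw [H.fst_chart] at h3
  rw [H.snd_chart] at h4
  have h5 := tderiv_extChartAt_symm_injective (mem_extChartAt_target (I := 𝓘(ℂ, E)) (p₁ x))
    (((h3.symm.trans h₁)).trans (map_zero _).symm)
  have h6 := tderiv_extChartAt_symm_injective (mem_extChartAt_target (I := 𝓘(ℂ, F)) (p₂ x))
    (((h4.symm.trans h₂)).trans (map_zero _).symm)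
  rw [show u = 0 from Prod.ext h5 h6, map_zero]

/-- In product charts the metric `w` and the potential `γ` have as coordinate expressions the sum
and the potential formed from those of the factors. Equality of their derivatives at `x` is then
`flatD_sum`, fed with the hypotheses on the factors transported to coordinates. -/
theorem IsChartProduct.isStronglyGauduchon_of_finrank (H : IsChartProduct E F p₁ p₂) {m' n' : ℕ}
    (hm : Module.finrank ℂ E = m' + 1) (hn : Module.finrank ℂ F = n' + 1)
    (hM : IsStronglyGauduchon 𝓘(ℂ, E) M) (hN : IsStronglyGauduchon 𝓘(ℂ, F) N) :
    IsStronglyGauduchon 𝓘(ℂ, E × F) X := by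
  obtain ⟨a, ha, hapos, α, hα, haD⟩ := (isStronglyGauduchon_iff_of_finrank E M (p := m')
    (by omega)).1 hM
  obtain ⟨b, hb, hbpos, β, hβ, hbD⟩ := (isStronglyGauduchon_iff_of_finrank F N (p := n')
    (by omega)).1 hN
  have h₁ : 2 * (n' + 1) + 2 * m' = 2 * (m' + n' + 1) := by ring
  have h₂ : 2 * (m' + 1) + 2 * n' = 2 * (m' + n' + 1) := by ring
  set w : Form (E × F) X 2 := fun x ↦
    sumForm (tderiv (E × F) E p₁ x) (tderiv (E × F) F p₂ x) (a (p₁ x)) (b (p₂ x)) with hw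
  set γ : Form (E × F) X (2 * (m' + n' + 1)) := fun x ↦
    sumPotential (tderiv (E × F) E p₁ x) (tderiv (E × F) F p₂ x) h₁ h₂ (a (p₁ x)) (b (p₂ x))
      (α (p₁ x)) (β (p₂ x)) with hγ
  have hwc : ∀ x, coord w x =ᶠ[𝓝 (extChartAt 𝓘(ℂ, E × F) x x)] fun z ↦
      sumForm (ContinuousLinearMap.fst ℂ E F) (ContinuousLinearMap.snd ℂ E F)
        (coord a (p₁ x) z.1) (coord b (p₂ x) z.2) := fun x ↦ by
    filter_upwards [H.tderiv_fst x, H.tderiv_snd x] with z h1 h2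
    refine (sumForm_pullC h1 h2 _ _).trans ?_
    rw [H.fst_symm, H.snd_symm]
    rfl
  have hγc : ∀ x, coord γ x =ᶠ[𝓝 (extChartAt 𝓘(ℂ, E × F) x x)] fun z ↦
      sumPotential (ContinuousLinearMap.fst ℂ E F) (ContinuousLinearMap.snd ℂ E F) h₁ h₂
        (coord a (p₁ x) z.1) (coord b (p₂ x) z.2) (coord α (p₁ x) z.1) (coord β (p₂ x) z.2) :=
      fun x ↦ by
    filter_upwards [H.tderiv_fst x, H.tderiv_snd x] with z h1 h2
    refine (sumPotential_pullC h1 h2 h₁ h₂ _ _ _ _).trans ?_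
    rw [H.fst_symm, H.snd_symm]
    rfl
  have h1 : ∀ {k} {a : Form E M k} (_ : ∀ x, SmoothAt a x) (x : X),
      ContDiffAt ℝ ∞ (coord a (p₁ x)) (extChartAt 𝓘(ℂ, E × F) x x).1 := fun ha x ↦ by
    rw [H.fst_chart]
    exact ha _
  have h2 : ∀ {k} {a : Form F N k} (_ : ∀ x, SmoothAt a x) (x : X),
      ContDiffAt ℝ ∞ (coord a (p₂ x)) (extChartAt 𝓘(ℂ, E × F) x x).2 := fun ha x ↦ by
    rw [H.snd_chart]
    exact ha _
  refine (isStronglyGauduchon_iff_of_finrank (E × F) X (p := m' + n' + 1)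
    (by rw [Module.finrank_prod]; omega)).2 ⟨w, fun x ↦ ?_, fun x ↦ ?_, γ, fun x ↦ ?_,
      funext fun x ↦ ?_⟩
  · exact (contDiffAt_sumForm (π₁ := ContinuousLinearMap.fst ℂ E F)
      (π₂ := ContinuousLinearMap.snd ℂ E F) (h1 ha x) (h2 hb x)).congr_of_eventuallyEq (hwc x)
  · exact (hapos _).sumForm (hbpos _) (H.eq_zero_of_tderiv x)
  · exact (contDiffAt_sumPotential (π₁ := ContinuousLinearMap.fst ℂ E F)
      (π₂ := ContinuousLinearMap.snd ℂ E F) h₁ h₂ (h1 ha x) (h2 hb x) (h1 hα x)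
      (h2 hβ x)).congr_of_eventuallyEq (hγc x)
  · refine dc_eq_dc_of_coord ?_ (hγc x) (flatD_sum hm hn h₁ h₂ (h1 ha x) (h2 hb x) (h1 hα x)
      (h2 hβ x) (coord_map_I hapos _) (coord_map_I hbpos _) ?_ ?_ ?_ ?_)
    · rw [coord_wedgePow]
      filter_upwards [hwc x] with z hz
      rw [hz]
    · rw [H.fst_chart]
      exact (hapos _).comp _ (tderiv_extChartAt_symm_injective (mem_extChartAt_target _))
    · rw [H.snd_chart]
      exact (hbpos _).comp _ (tderiv_extChartAt_symm_injective (mem_extChartAt_target _))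
    · rw [H.fst_chart, ← coord_wedgePow, flatD_coord _ ((ha _).wedgePow _), flatD_coord _ (hα _),
        haD]
    · rw [H.snd_chart, ← coord_wedgePow, flatD_coord _ ((hb _).wedgePow _), flatD_coord _ (hβ _),
        hbD]

end ProductManifold

section Pullback
variable {E : Type*} [NormedAddCommGroup E] [NormedSpace ℂ E]
  {F : Type*} [NormedAddCommGroup F] [NormedSpace ℂ F]
  {X : Type*} [TopologicalSpace X] [ChartedSpace E X]
  {N : Type*} [TopologicalSpace N] [ChartedSpace F N]
  [FiniteDimensional ℂ E] [FiniteDimensional ℂ F] [IsManifold 𝓘(ℂ, E) ω X] [IsManifold 𝓘(ℂ, F) ω N]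

/-- Strongly Gauduchon metrics pull back under local biholomorphisms. -/
theorem IsStronglyGauduchon.pull {ψ : X → N} (hψ : ContMDiff 𝓘(ℂ, E) 𝓘(ℂ, F) ω ψ)
    (hinj : ∀ x, Function.Injective (tderiv E F ψ x))
    (hdim : Module.finrank ℂ E = Module.finrank ℂ F) (h : IsStronglyGauduchon 𝓘(ℂ, F) N) :
    IsStronglyGauduchon 𝓘(ℂ, E) X := by
  obtain ⟨w, hw, hpos, α, hα, hD⟩ := (isStronglyGauduchon_iff F N).1 h
  refine (isStronglyGauduchon_iff_of_finrank E X (p := Module.finrank ℂ F - 1) (by rw [hdim])).2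
    ⟨StronglyGauduchon.pull E ψ w, fun x ↦ (hw _).pull (hψ x), fun x ↦ (hpos _).comp _ (hinj x),
      StronglyGauduchon.pull E ψ α, fun x ↦ (hα _).pull (hψ x), funext fun x ↦ ?_⟩
  have h1 : (fun x ↦ wedgePow (StronglyGauduchon.pull E ψ w x) (Module.finrank ℂ F - 1)) =
      StronglyGauduchon.pull E ψ fun y ↦ wedgePow (w y) (Module.finrank ℂ F - 1) :=
    funext fun x ↦ wedgePow_compContinuousLinearMap ..
  rw [h1, dc_pull _ ((hw _).wedgePow _) (hψ x), dc_pull _ (hα _) (hψ x), hD]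

end Pullback

/-! ### The equivalence for products -/

section Product
variable {E F : Type*} [NormedAddCommGroup E] [NormedSpace ℂ E] [NormedAddCommGroup F]
  [NormedSpace ℂ F] {X : Type*} [TopologicalSpace X] [ChartedSpace (E × F) X]
  {M : Type*} [TopologicalSpace M] [ChartedSpace E M]
  {N : Type*} [TopologicalSpace N] [ChartedSpace F N]
  [FiniteDimensional ℂ E] [FiniteDimensional ℂ F]
  [IsManifold 𝓘(ℂ, E × F) ω X] [IsManifold 𝓘(ℂ, E) ω M] [IsManifold 𝓘(ℂ, F) ω N]
  {p₁ : X → M} {p₂ : X → N}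

/-- The case of a zero-dimensional factor is separate because the truncated exponent `n - 1` would
break the degree count. There the projection to the other factor has injective derivative between
spaces of equal dimension, and the metric is pulled back. -/
theorem IsChartProduct.isStronglyGauduchon (H : IsChartProduct E F p₁ p₂)
    (hM : IsStronglyGauduchon 𝓘(ℂ, E) M) (hN : IsStronglyGauduchon 𝓘(ℂ, F) N) :
    IsStronglyGauduchon 𝓘(ℂ, E × F) X := by
  rcases hm : Module.finrank ℂ E with _ | m'
  · have := Module.finrank_zero_iff.1 hm
    refine hN.pull H.contMDiff_snd (fun x ↦ (injective_iff_map_eq_zero _).2 fun v hv ↦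
      H.eq_zero_of_tderiv x v (Subsingleton.elim _ _) hv) (by rw [Module.finrank_prod, hm, zero_add])
  rcases hn : Module.finrank ℂ F with _ | n'
  · have := Module.finrank_zero_iff.1 hn
    refine hM.pull H.contMDiff_fst (fun x ↦ (injective_iff_map_eq_zero _).2 fun v hv ↦
      H.eq_zero_of_tderiv x v hv (Subsingleton.elim _ _)) (by rw [Module.finrank_prod, hn, add_zero])
  exact H.isStronglyGauduchon_of_finrank hm hn hM hN

omit [FiniteDimensional ℂ E] [FiniteDimensional ℂ F] [IsManifold 𝓘(ℂ, F) ω N] in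
lemma IsChartProduct.isSubmersion_fst (H : IsChartProduct E F p₁ p₂) :
    Manifold.IsSubmersionOfComplement F 𝓘(ℂ, E × F) 𝓘(ℂ, E) ω p₁ := fun x ↦ by
  refine Manifold.IsSubmersionAtOfComplement.mk_of_continuousAt
    H.contMDiff_fst.continuous.continuousAt (ContinuousLinearEquiv.refl ℂ (E × F))
    (chartAt (E × F) x) (chartAt E (p₁ x)) (mem_chart_source _ x) (mem_chart_source _ _)
    (IsManifold.chart_mem_maximalAtlas x) (IsManifold.chart_mem_maximalAtlas _) fun y hy ↦ ?_
  change extChartAt 𝓘(ℂ, E) (p₁ x) (p₁ ((extChartAt 𝓘(ℂ, E × F) x).symm y)) = y.1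
  rw [H.fst_symm]
  exact PartialEquiv.right_inv _ (H.target_subset x y hy).1

omit [FiniteDimensional ℂ E] [FiniteDimensional ℂ F] [IsManifold 𝓘(ℂ, E) ω M] in
lemma IsChartProduct.isSubmersion_snd (H : IsChartProduct E F p₁ p₂) :
    Manifold.IsSubmersionOfComplement E 𝓘(ℂ, E × F) 𝓘(ℂ, F) ω p₂ := fun x ↦ by
  refine Manifold.IsSubmersionAtOfComplement.mk_of_continuousAt
    H.contMDiff_snd.continuous.continuousAt (ContinuousLinearEquiv.prodComm ℂ E F)
    (chartAt (E × F) x) (chartAt F (p₂ x)) (mem_chart_source _ x) (mem_chart_source _ _)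
    (IsManifold.chart_mem_maximalAtlas x) (IsManifold.chart_mem_maximalAtlas _) fun y hy ↦ ?_
  change extChartAt 𝓘(ℂ, F) (p₂ x) (p₂ ((extChartAt 𝓘(ℂ, E × F) x).symm y)) = y.2
  rw [H.snd_symm]
  exact PartialEquiv.right_inv _ (H.target_subset x y hy).2

theorem IsChartProduct.isStronglyGauduchon_iff [T2Space X] [CompactSpace X] [T2Space M] [T2Space N]
    (H : IsChartProduct E F p₁ p₂) (h₁ : Function.Surjective p₁) (h₂ : Function.Surjective p₂) :
    IsStronglyGauduchon 𝓘(ℂ, E × F) X ↔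
      IsStronglyGauduchon 𝓘(ℂ, E) M ∧ IsStronglyGauduchon 𝓘(ℂ, F) N := by
  refine ⟨fun h ↦ ⟨h.of_isSubmersionOfComplement H.isSubmersion_fst fun y ↦ ?_,
    h.of_isSubmersionOfComplement H.isSubmersion_snd fun y ↦ ?_⟩,
    fun h ↦ H.isStronglyGauduchon h.1 h.2⟩
  · obtain ⟨x, rfl⟩ := h₁ y
    exact ⟨x, mem_connectedComponent⟩
  · obtain ⟨x, rfl⟩ := h₂ y
    exact ⟨x, mem_connectedComponent⟩

end Product

section Prod
variable (E F : Type*) [NormedAddCommGroup E] [NormedSpace ℂ E] [NormedAddCommGroup F]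
  [NormedSpace ℂ F] (M : Type*) [TopologicalSpace M] [ChartedSpace E M]
  (N : Type*) [TopologicalSpace N] [ChartedSpace F N]

/-- The product charts, with values in the product of the model spaces. -/
abbrev chartedSpaceProd : ChartedSpace (E × F) (M × N) := prodChartedSpace E M F N

/-- The product of the model spaces carries two names, `ModelProd E F` and `E × F`;
`modelWithCornersSelf_prod` lets the product manifold be treated as modelled on the vector space `E
× F`. -/
lemma isManifold_prod [IsManifold 𝓘(ℂ, E) ω M] [IsManifold 𝓘(ℂ, F) ω N] :
    letI := chartedSpaceProd E F M N
    IsManifold 𝓘(ℂ, E × F) ω (M × N) := by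
  have h := IsManifold.prod (I := 𝓘(ℂ, E)) (I' := 𝓘(ℂ, F)) (n := ω) M N
  rwa [← modelWithCornersSelf_prod] at h

lemma isChartProduct_prod :
    letI := chartedSpaceProd E F M N
    IsChartProduct E F (Prod.fst : M × N → M) Prod.snd := by
  let := chartedSpaceProd E F M N
  have h1 := contMDiff_fst (I := 𝓘(ℂ, E)) (J := 𝓘(ℂ, F)) (n := ω) (M := M) (N := N)
  have h2 := contMDiff_snd (I := 𝓘(ℂ, E)) (J := 𝓘(ℂ, F)) (n := ω) (M := M) (N := N)
  have h3 := fun x : M × N ↦ extChartAt_prod (I := 𝓘(ℂ, E)) (I' := 𝓘(ℂ, F)) x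
  rw [← modelWithCornersSelf_prod] at h1 h2 h3
  have h4 : ∀ x : M × N, extChartAt 𝓘(ℂ, E × F) x =
    (extChartAt 𝓘(ℂ, E) x.1).prod (extChartAt 𝓘(ℂ, F) x.2) := h3
  refine ⟨h1, h2, fun x y ↦ ?_, fun x y ↦ ?_, fun x ↦ ?_, fun x ↦ ?_, fun x y hy ↦ ?_⟩
  · rw [h4]; rfl
  · rw [h4]; rfl
  · rw [h4]; rfl
  · rw [h4]; rfl
  · rw [h4] at hy
    exact hy

theorem isStronglyGauduchon_prod_iff [FiniteDimensional ℂ E] [FiniteDimensional ℂ F]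
    [T2Space M] [CompactSpace M] [IsManifold 𝓘(ℂ, E) ω M]
    [T2Space N] [CompactSpace N] [IsManifold 𝓘(ℂ, F) ω N] [Nonempty M] [Nonempty N] :
    IsStronglyGauduchon (𝓘(ℂ, E).prod 𝓘(ℂ, F)) (M × N) ↔
      IsStronglyGauduchon 𝓘(ℂ, E) M ∧ IsStronglyGauduchon 𝓘(ℂ, F) N := by
  let := chartedSpaceProd E F M N
  have := isManifold_prod E F M N
  rw [← modelWithCornersSelf_prod]
  exact (isChartProduct_prod E F M N).isStronglyGauduchon_iff Prod.fst_surjective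
    Prod.snd_surjective

end Prod

end StronglyGauduchon

end

/-- Strongly Gauduchon manifolds under submersions and products. Compact complex manifolds of pure
dimension are compact Hausdorff spaces with an analytic atlas over a finite-dimensional complex
vector space. In the first part, every connected component of `N` is assumed to meet the image
of `f`; this holds if `N` is connected and `M` is nonempty, or if `f` is surjective. -/
theorem mainTheorem11
    {E : Type*} [NormedAddCommGroup E] [NormedSpace ℂ E] [FiniteDimensional ℂ E]
    {F : Type*} [NormedAddCommGroup F] [NormedSpace ℂ F] [FiniteDimensional ℂ F]
    {M : Type*} [TopologicalSpace M] [T2Space M] [CompactSpace M]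
    [ChartedSpace E M] [IsManifold 𝓘(ℂ, E) ω M]
    {N : Type*} [TopologicalSpace N] [T2Space N] [CompactSpace N]
    [ChartedSpace F N] [IsManifold 𝓘(ℂ, F) ω N] :
    (∀ f : M → N, Manifold.IsSubmersion 𝓘(ℂ, E) 𝓘(ℂ, F) ω f →
      (∀ y : N, ∃ x : M, f x ∈ connectedComponent y) →
      StronglyGauduchon.IsStronglyGauduchon 𝓘(ℂ, E) M →
      StronglyGauduchon.IsStronglyGauduchon 𝓘(ℂ, F) N) ∧
    (Nonempty M → Nonempty N →
      (StronglyGauduchon.IsStronglyGauduchon (𝓘(ℂ, E).prod 𝓘(ℂ, F)) (M × N) ↔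
        StronglyGauduchon.IsStronglyGauduchon 𝓘(ℂ, E) M ∧
          StronglyGauduchon.IsStronglyGauduchon 𝓘(ℂ, F) N)) := by
  refine ⟨fun f hf hc hM ↦ ?_, fun _ _ ↦ StronglyGauduchon.isStronglyGauduchon_prod_iff E F M N⟩
  obtain ⟨G, _, _, hG⟩ := hf
  exact hM.of_isSubmersionOfComplement hG hc
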